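/- **Setting.** Let $N,n\ge 1$, $A,d>0$, $1<a<b$, $\Omega=\{-A<x_1,\dots,x_n<A,\ a<y<b\}\subset\mathbb R^{n+1}$, and write $\mathbf x=(x_1,\dots,x_n,y)$, $\mathbf x_\alpha=(\alpha,0,\dots,0)$, $\nu(\mathbf x,\alpha)=(\mathbf x-\mathbf x_\alpha)/|\mathbf x-\mathbf x_\alpha|$. Let $\{\Psi_s\}_{s\ge0}$ be the Gram–Schmidt orthonormalization of $\{\alpha^se^\alpha\}_{s\ge 0}$ in $L_2(-d,d)$. Let $0\le\mu_s\in C^2(\mathbb R^{n+1})$ vanish outside $\Omega$, and let $0\le K\in C^2(\overline\Omega\times[-d,d]^2)$. For $k,s=0,\dots,N-1$ and $i=1,\dots,n$ put $$D_N(\mathbf x)_{ks}=\int_{-d}^d\Psi_s'\Psi_k\,d\alpha+\int_{-d}^d\frac{\partial_\alpha\nu_{n+1}}{\nu_{n+1}}\Psi_s\Psi_k\,d\alpha,\qquad A_i(\mathbf x)_{ks}=\int_{-d}^d\Big(\frac{\nu_i}{\nu_{n+1}}\Psi_s'+\frac{\partial_\alpha\nu_i}{\nu_{n+1}}\Psi_s\Big)\Psi_k\,d\alpha,$$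 $$F(w,\mathbf x)_k=-\int_{-d}^d\frac{\mu_s(\mathbf x)}{\nu_{n+1}}\,\partial_\alpha\Big[e^{-\sum_s w_s\Psi_s(\alpha)}\int_{-d}^dK(\mathbf x,\alpha,\beta)e^{\sum_s w_s\Psi_s(\beta)}d\beta\Big]\Psi_k(\alpha)\,d\alpha ,\qquad w\in\mathbb R^N.$$ For an integer $m>1$ with $h=2A/m\ge h_0>0$, take the grid of nodes $(x_{1,j_1},\dots,x_{n,j_n})$, $x_{i,j}=-A+jh$, $0\le j\le m$; a node is interior if all $1\le j_i\le m-1$. Let $\Omega^h=\{\text{nodes}\}\times(a,b)$; its boundary $\partial\Omega^h$ consists of (all nodes)$\times\{a,b\}$ and (non-interior nodes)$\times(a,b)$. For $\mathbb R^N$-valued functions $W^h$ of (node, $y$), let $W^h_{x_i}$ be the central difference with step $2h$ at interior nodes. Let $H^{1,h}$ be the space with norm $$\|W^h\|_{H^{1,h}}^2=\sum_{\text{interior nodes}}\ \sum_{i=1}^n\int_a^b\big[(W^h)^2+(W^h_{x_i})^2+(W^h_y)^2\big]dy<\infty$$ (at interior nodes $W^h\in H^1(a,b)$ in $y$), let $H^{1,h}_0$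 be its subspace of functions vanishing on $\partial\Omega^h$, and put $$B(R,P^h)=\{W^h\in H^{1,h}:\ W^h|_{\partial\Omega^h}=P^h,\ \|W^h\|_{H^{1,h}}<R\},$$ with closure $\overline{B(R,P^h)}$ (the same with $\le R$). With coefficients evaluated at the nodes, let $$J_\lambda(W^h)=\sum_{\text{interior nodes}}\int_a^b\Big|D_NW^h_y+\sum_{i=1}^nA_iW^h_{x_i}+F(W^h,\mathbf x^h)\Big|^2e^{2\lambda y}\,dy .$$ **Theorem 4.4.** There is $a_0=a_0(A,d,N)>1$ such that for all $a\ge a_0$, $b>a$, the matrix $D_N(\mathbf x)$ is invertible for all $\mathbf x\in\overline\Omega$ and the following holds. There is a function $\lambda_1(R)\ge 1$, $R>0$, depending only on $R$ and on $A,d,N,n,a,b,h_0$ and upper bounds for $\|K\|_{C^1(\overline\Omega\times[-d,d]^2)}$ and $\max\mu_s$, such that $J_\lambda$ is strictly convex on $\overline{B(R,P^h)}$ for every $\lambda\ge\lambda_1(R)$ and every $P^h$: it has at each $W_1^h\in\overline{B(R,P^h)}$ a Fréchet derivative $J_\lambda'(W_1^h)$ (along $H^{1,h}_0$), and $$J_\lambda(W_2^h)-J_\lambda(W_1^h)-J_\lambda'(W_1^h)(W_2^h-W_1^h)\ge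 c\,e^{2\lambda a}\|W_2^h-W_1^h\|_{H^{1,h}}^2\qquad\forall\,W_1^h,W_2^h\in\overline{B(R,P^h)},$$ where $c>0$ depends on the same parameters as $\lambda_1(R)$. Moreover, for every $R>0$ there is $C_3>0$, depending only on these same parameters, with the following property for $\lambda_2=\lambda_1(2R)$. Let $\alpha\in(0,R)$, $\delta>0$, and let $P^h,P^{h*}$ be boundary data and $S^h\in B(R,P^h)$, $S^{h*}\in B(R,P^{h*})$ be such that $\|S^h-S^{h*}\|_{H^{1,h}}<\delta$. Let $W^{h*}\in B(R-\alpha,P^{h*})$ be an exact solution, $$D_NW^{h*}_y+\sum_{i=1}^nA_iW^{h*}_{x_i}+F(W^{h*},\mathbf x^h)=0$$ at the interior nodes for almost all $y\in(a,b)$, and let $C_3\delta<\alpha$. Then $J_{\lambda_2}$ has a unique minimizer $W^h_{\min,\lambda_2}$ on $\overline{B(R,P^h)}$, it belongs to the open set $B(R,P^h)$, and $$\|W^h_{\min,\lambda_2}-W^{h*}\|_{H^{1,h}}\le C_3\delta .$$ -/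

import Mathlib

open MeasureTheory Set

/-!
# Convexification for the radiative transport equation: the semi-discrete problem

Points of `ℝ^{n+1}` are pairs `(x, y)` with `x = (x₁, …, x_n)`; the coordinate `x₁` has index `0`.
-/

namespace RTE

noncomputable section

/-- Points `(x₁, …, x_n, y)` of `ℝ^{n+1}`. -/
abbrev Pt (n : ℕ) := (Fin n → ℝ) × ℝ

/-- The open prism `Ω = {-A < x_i < A, a < y < b}`. -/
def prism (n : ℕ) (A a b : ℝ) : Set (Pt n) :=
  {x | (∀ i, -A < x.1 i ∧ x.1 i < A) ∧ a < x.2 ∧ x.2 < b}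

/-- The closed prism `closure Ω = {-A ≤ x_i ≤ A, a ≤ y ≤ b}`. -/
def closedPrism (n : ℕ) (A a b : ℝ) : Set (Pt n) :=
  {x | (∀ i, -A ≤ x.1 i ∧ x.1 i ≤ A) ∧ a ≤ x.2 ∧ x.2 ≤ b}

/-! ### The direction field `ν(x, α) = (x - x_α) / |x - x_α|`, where `x_α = (α, 0, …, 0)` -/

/-- The `i`-th (horizontal) coordinate of `x - x_α`. -/
def relX {n : ℕ} (x : Pt n) (α : ℝ) (i : Fin n) : ℝ :=
  x.1 i - (if i.val = 0 then α else 0)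

/-- The Euclidean distance `|x - x_α|`. -/
def srcDist {n : ℕ} (x : Pt n) (α : ℝ) : ℝ :=
  Real.sqrt ((∑ i, relX x α i ^ 2) + x.2 ^ 2)

/-- `ν_i(x, α)` for `i = 1, …, n`. -/
def nuX {n : ℕ} (x : Pt n) (α : ℝ) (i : Fin n) : ℝ := relX x α i / srcDist x α

/-- `ν_{n+1}(x, α)`. -/
def nuY {n : ℕ} (x : Pt n) (α : ℝ) : ℝ := x.2 / srcDist x α

/-! ### The orthonormal basis of `L²(-d, d)` -/

/-- `psi d s` is `Ψ_s`: the Gram-Schmidt orthonormalization in `L²(-d, d)` of the sequence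
`α^s e^α`, `s = 0, 1, 2, …`. -/
def psi (d : ℝ) : ℕ → ℝ → ℝ
  | s =>
    let g : ℝ → ℝ := fun α => α ^ s * Real.exp α -
      ∑ k : Fin s, (∫ β in (-d)..d, β ^ s * Real.exp β * psi d k.val β) * psi d k.val α
    fun α => g α / Real.sqrt (∫ β in (-d)..d, g β ^ 2)
  termination_by s => s
  decreasing_by all_goals exact k.isLt

/-- The truncated Fourier series `∑_s w_s Ψ_s(α)` with coefficient vector `w`. -/
def fourierSum (d : ℝ) {N : ℕ} (w : Fin N → ℝ) (α : ℝ) : ℝ := ∑ s, w s * psi d s.val α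

/-! ### The coefficients of the system for the Fourier coefficients

Row `k` is the projection on `Ψ_k` of the equation that arises when the truncated series is
inserted in the `α`-differentiated transport equation divided by `ν_{n+1}`. -/

/-- The matrix `D_N(x) = M_N + A_{n+1}(x)` in front of `W_y`. -/
def matD (d : ℝ) (N : ℕ) {n : ℕ} (x : Pt n) : Matrix (Fin N) (Fin N) ℝ :=
  Matrix.of fun k s =>
    (∫ α in (-d)..d, deriv (psi d s.val) α * psi d k.val α) +
    ∫ α in (-d)..d, deriv (fun α' => nuY x α') α / nuY x α * psi d s.val α * psi d k.val α

/-- The matrix `A_i(x)` in front of `W_{x_i}`, `i = 1, …, n`. -/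
def matA (d : ℝ) (N : ℕ) {n : ℕ} (i : Fin n) (x : Pt n) : Matrix (Fin N) (Fin N) ℝ :=
  Matrix.of fun k s =>
    ∫ α in (-d)..d, (nuX x α i / nuY x α * deriv (psi d s.val) α +
      deriv (fun α' => nuX x α' i) α / nuY x α * psi d s.val α) * psi d k.val α

/-- The nonlinear term `F(w, x)`; its `k`-th component is
`-∫ (μ_s / ν_{n+1}) ∂_α [e^{-w(α)} ∫ K(x,α,β) e^{w(β)} dβ] Ψ_k(α) dα`,
with `w(α) = ∑_s w_s Ψ_s(α)`. -/
def vecF (d : ℝ) {n N : ℕ} (K : Pt n → ℝ → ℝ → ℝ) (μs : Pt n → ℝ) (w : Fin N → ℝ) (x : Pt n) :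
    Fin N → ℝ := fun k =>
  -∫ α in (-d)..d, μs x / nuY x α *
    deriv (fun α' => Real.exp (-fourierSum d w α') *
      ∫ β in (-d)..d, K x α' β * Real.exp (fourierSum d w β)) α * psi d k.val α

/-- The phase function: `K ≥ 0` and `K ∈ C²(closure Ω × [-d,d]²)`, with `C¹`-norm at most `κ`
(`K` and its first derivative are bounded by `κ`). -/
structure IsPhaseFunction {n : ℕ} (A a b d κ : ℝ) (K : Pt n → ℝ → ℝ → ℝ) : Prop where
  nonneg : ∀ x ∈ closedPrism n A a b, ∀ α ∈ Icc (-d) d, ∀ β ∈ Icc (-d) d, 0 ≤ K x α β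
  smooth : ContDiffOn ℝ 2 (fun q : Pt n × ℝ × ℝ => K q.1 q.2.1 q.2.2)
    (closedPrism n A a b ×ˢ Icc (-d) d ×ˢ Icc (-d) d)
  bound : ∀ q ∈ closedPrism n A a b ×ˢ Icc (-d) d ×ˢ Icc (-d) d, |K q.1 q.2.1 q.2.2| ≤ κ
  bound_fderiv : ∀ q ∈ closedPrism n A a b ×ˢ Icc (-d) d ×ˢ Icc (-d) d,
    ‖fderivWithin ℝ (fun q : Pt n × ℝ × ℝ => K q.1 q.2.1 q.2.2)
      (closedPrism n A a b ×ˢ Icc (-d) d ×ˢ Icc (-d) d) q‖ ≤ κ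

/-- The scattering coefficient: `μ_s ≥ 0`, `μ_s ∈ C²(ℝ^{n+1})`, `μ_s = 0` outside `Ω`, with
maximum at most `M`. -/
structure IsScatteringCoeff {n : ℕ} (A a b M : ℝ) (μs : Pt n → ℝ) : Prop where
  nonneg : ∀ x, 0 ≤ μs x
  smooth : ContDiff ℝ 2 μs
  support : ∀ x, x ∉ prism n A a b → μs x = 0
  bound : ∀ x, μs x ≤ M

/-! ### The grid, and vector functions of discrete `x` and continuous `y` -/

/-- Multi-indices of the nodes `(x_{1,j₁}, …, x_{n,j_n})`, `0 ≤ j_i ≤ m`. -/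
abbrev Node (n m : ℕ) := Fin n → Fin (m + 1)

/-- The grid step `h = 2A/m`. -/
def step (A : ℝ) (m : ℕ) : ℝ := 2 * A / m

/-- The node `(x_{1,j₁}, …, x_{n,j_n})` with `x_{i,j} = -A + j h`. -/
def nodePt (A : ℝ) {n m : ℕ} (j : Node n m) : Fin n → ℝ := fun i => -A + (j i).val * step A m

/-- Interior nodes: `1 ≤ j_i ≤ m - 1` for all `i`. -/
def IsInterior {n m : ℕ} (j : Node n m) : Prop := ∀ i, 0 < (j i).val ∧ (j i).val < m

open Classical in
/-- The finite set of interior nodes. -/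
def interiorNodes (n m : ℕ) : Finset (Node n m) := Finset.univ.filter IsInterior

/-- `N`-dimensional vector functions `Q^h(x^h)` of the nodes and of `y`.  Only `y ∈ [a, b]`
matters. -/
abbrev VecFun (n m N : ℕ) := Node n m → ℝ → Fin N → ℝ

/-- The central difference `∂_{x_i} Q^h`, used at interior nodes only. -/
def diffX (A : ℝ) {n m N : ℕ} (i : Fin n) (Q : VecFun n m N) : VecFun n m N := fun j y s =>
  (Q (Function.update j i (j i + 1)) y s - Q (Function.update j i (j i - 1)) y s) /
    (2 * step A m)

/-- The derivative `∂_y Q^h`, componentwise. -/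
def diffY {n m N : ℕ} (Q : VecFun n m N) : VecFun n m N := fun j y s =>
  deriv (fun t => Q j t s) y

/-- `Q ∈ H_N^{1,h}(Ω^h)`.  At interior nodes `Q` belongs to `H¹(a, b)` in the variable `y`
(it is its absolutely continuous representative, with derivative in `L²`), and the central
differences at the interior nodes are in `L²(a, b)`. -/
def MemH1 (A a b : ℝ) {n m N : ℕ} (Q : VecFun n m N) : Prop :=
  ∀ j : Node n m, IsInterior j → ∀ s : Fin N,
    AbsolutelyContinuousOnInterval (fun y => Q j y s) a b ∧
    MemLp (fun y => diffY Q j y s) 2 (volume.restrict (Ioo a b)) ∧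
    ∀ i : Fin n, MemLp (fun y => diffX A i Q j y s) 2 (volume.restrict (Ioo a b))

/-- The norm of `H_N^{1,h}(Ω^h)`. -/
def normH1 (A a b : ℝ) {n m N : ℕ} (Q : VecFun n m N) : ℝ :=
  Real.sqrt (∑ j ∈ interiorNodes n m, ∑ i : Fin n, ∫ y in a..b,
    ∑ s, (Q j y s ^ 2 + diffX A i Q j y s ^ 2 + diffY Q j y s ^ 2))

/-- The square of the norm of `L_N^{2,h}(Ω^h)`. -/
def normL2Sq (a b : ℝ) {n m N : ℕ} (Q : VecFun n m N) : ℝ :=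
  ∑ j ∈ interiorNodes n m, ∫ y in a..b, ∑ s, Q j y s ^ 2

/-- `Q = P` on `∂Ω^h`: at all nodes for `y = a` and `y = b`, and at the boundary nodes for all
`y`.  Only the values of `P` on `∂Ω^h` matter. -/
def EqOnBoundary (a b : ℝ) {n m N : ℕ} (Q P : VecFun n m N) : Prop :=
  ∀ j : Node n m, ∀ y ∈ Icc a b, (¬ IsInterior j ∨ y = a ∨ y = b) → Q j y = P j y

/-- `H_{N,0}^{1,h}(Ω^h)`. -/
def MemH10 (A a b : ℝ) {n m N : ℕ} (Q : VecFun n m N) : Prop :=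
  MemH1 A a b Q ∧ EqOnBoundary a b Q 0

/-- The open set `B(R, P^h)`. -/
def ballB (A a b R : ℝ) {n m N : ℕ} (P : VecFun n m N) : Set (VecFun n m N) :=
  {W | MemH1 A a b W ∧ EqOnBoundary a b W P ∧ normH1 A a b W < R}

/-- The closed ball `closure B(R, P^h)`. -/
def closedBallB (A a b R : ℝ) {n m N : ℕ} (P : VecFun n m N) : Set (VecFun n m N) :=
  {W | MemH1 A a b W ∧ EqOnBoundary a b W P ∧ normH1 A a b W ≤ R}

/-! ### The semi-discrete equation and the functional -/

/-- The left-hand side `D_N^h W_y^h + ∑ A_i^h W_{x_i}^h + F^h(W^h, x^h)`. -/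
def residual (A d : ℝ) {n m N : ℕ} (K : Pt n → ℝ → ℝ → ℝ) (μs : Pt n → ℝ) (W : VecFun n m N) :
    VecFun n m N := fun j y =>
  (matD d N (nodePt A j, y)).mulVec (diffY W j y) +
    ∑ i, (matA d N i (nodePt A j, y)).mulVec (diffX A i W j y) +
    vecF d K μs (W j y) (nodePt A j, y)

/-- `W` solves the semi-discrete equation at all interior nodes (for almost every `y`). -/
def IsSolution (A a b d : ℝ) {n m N : ℕ} (K : Pt n → ℝ → ℝ → ℝ) (μs : Pt n → ℝ)
    (W : VecFun n m N) : Prop :=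
  ∀ j : Node n m, IsInterior j → ∀ᵐ y ∂(volume.restrict (Ioo a b)), residual A d K μs W j y = 0

/-- The weighted cost functional `J_λ(W^h)`, with the Carleman weight `e^{λ y}`. -/
def costJ (A a b d : ℝ) {n m N : ℕ} (K : Pt n → ℝ → ℝ → ℝ) (μs : Pt n → ℝ) (lam : ℝ)
    (W : VecFun n m N) : ℝ :=
  normL2Sq a b (fun j y s => residual A d K μs W j y s * Real.exp (lam * y))

/-- `W` minimizes `J` on the set `B`. -/
def IsMinimizer {n m N : ℕ} (J : VecFun n m N → ℝ) (B : Set (VecFun n m N))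
    (W : VecFun n m N) : Prop := W ∈ B ∧ ∀ V ∈ B, J W ≤ J V

/-- `L`, as a function on `H_{N,0}^{1,h}(Ω^h)`, is the Fréchet derivative of `J` at `W` (with
increments in `H_{N,0}^{1,h}(Ω^h)`): it is linear, bounded, and the remainder is `o(‖v‖)`. -/
structure IsFrechetDeriv (A a b : ℝ) {n m N : ℕ} (J : VecFun n m N → ℝ) (W : VecFun n m N)
    (L : VecFun n m N → ℝ) : Prop where
  add : ∀ u v, MemH10 A a b u → MemH10 A a b v → L (u + v) = L u + L v
  smul : ∀ (t : ℝ) (v), MemH10 A a b v → L (t • v) = t * L v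
  bounded : ∃ C : ℝ, ∀ v, MemH10 A a b v → |L v| ≤ C * normH1 A a b v
  littleO : ∀ ε > 0, ∃ η > 0, ∀ v, MemH10 A a b v → normH1 A a b v ≤ η →
    |J (W + v) - J W - L v| ≤ ε * normH1 A a b v

/-- `Λ ≥ 1` is such that for all `λ ≥ Λ` the functional `J_λ` is strictly convex on
`closure B(R, P^h)`, i.e.
`J_λ(W₂) - J_λ(W₁) - J_λ'(W₁)(W₂ - W₁) ≥ c e^{2λa} ‖W₂ - W₁‖²`,
where `Λ` and `c` serve for all grids with step `h ≥ h₀`, all boundary data and all coefficients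
`K`, `μ_s` with the bounds `κ`, `M`. -/
def IsConvexityThreshold (n N : ℕ) (A d a b h₀ κ M R Λ : ℝ) : Prop :=
  1 ≤ Λ ∧ ∃ c > 0, ∀ m : ℕ, 1 < m → h₀ ≤ step A m →
    ∀ (K : Pt n → ℝ → ℝ → ℝ) (μs : Pt n → ℝ),
      IsPhaseFunction A a b d κ K → IsScatteringCoeff A a b M μs →
    ∀ lam ≥ Λ, ∀ P : VecFun n m N, ∀ W₁ ∈ closedBallB A a b R P,
      ∃ L : VecFun n m N → ℝ, IsFrechetDeriv A a b (costJ A a b d K μs lam) W₁ L ∧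
        ∀ W₂ ∈ closedBallB A a b R P,
          c * Real.exp (2 * lam * a) * normH1 A a b (W₂ - W₁) ^ 2 ≤
            costJ A a b d K μs lam W₂ - costJ A a b d K μs lam W₁ - L (W₂ - W₁)

end

end RTE

/-! ### Gram–Schmidt basis and the matrix of its derivatives. -/

namespace RTE

/-! ### The orthonormal basis -/

section Basis

variable {d : ℝ}

/-! Principal part. The basis functions are Ψ_s = p_s e^α with deg p_s = s, so Ψ_s' = Ψ_s + p_s'
e^α, and the second summand is orthogonal to every Ψ_k with k ≥ s. Hence the matrix of the integrals
∫ Ψ_s' Ψ_k is upper triangular with unit diagonal (`integral_deriv_psi_mul_psi`). Since ∂_α ν_{n+1}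
/ ν_{n+1} is bounded by (A+d)/a, for large a the matrix D_N is a small perturbation of it and is
bounded below uniformly on the prism (`exists_matD_lower`). On a grid with h ≥ h₀ a central
difference of a function vanishing on the boundary is controlled by its nodal values
(`nsq_diffX_le`). With respect to increments in H^{1,h}_0 the equation therefore behaves like a
first order ordinary differential system in y, with everything except D_N v_y of order zero.

Convexity. The nonlinearity F is an integral over a square of an affine function of w times the
exponential of a linear one (`vecF_eq`), so its first order Taylor remainder is quadratic, uniformly
for bounded w; boundedness of W comes from the Sobolev inequality in y. For an increment v write l
for the linearized residual and ρ for its Taylor remainder. Then J(W+v) - J(W) - J'(W)v is the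
weighted integral of |l+ρ|² + 2 (residual of W)·ρ. The first term contains a multiple of |v_y|² up
to terms of order zero, which the Carleman estimate ∫ f² e^{2λy} ≤ λ⁻² ∫ f'² e^{2λy} absorbs
(`carleman`). In the second term the square of the residual is merely integrable, so |v|² e^{2λy}
must be small in the supremum; this is `carleman_sup`. The result is `exists_strong_convexity`, with
constants independent of λ apart from the factor e^{2λa}.

Minimization. Strong convexity makes minimizing sequences Cauchy, and H^{1,h}_0 is complete
(`exists_limit_memH10`), so a minimizer exists; it is unique. If W* is an exact solution, W* + (S -
S*) has the boundary data of the minimization problem, lies in the ball and has cost O(δ²)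
(`exists_cost_le`). Strong convexity turns this into a distance O(δ) to the minimizer, and C₃δ < α
keeps the minimizer off the boundary of the ball. -/

lemma psi_eq (d : ℝ) (s : ℕ) : psi d s = fun α => (α ^ s * Real.exp α -
      ∑ k : Fin s, (∫ β in (-d)..d, β ^ s * Real.exp β * psi d k.val β) * psi d k.val α) /
    Real.sqrt (∫ β in (-d)..d, (β ^ s * Real.exp β -
      ∑ k : Fin s, (∫ β in (-d)..d, β ^ s * Real.exp β * psi d k.val β) * psi d k.val β) ^ 2) := by
  rw [psi]

/-- A nonzero polynomial has finitely many roots, so the integrand is positive somewhere on the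
infinite set [-d, d]. This is the linear independence that keeps the Gram–Schmidt denominators
nonzero. -/
lemma integral_poly_exp_sq_pos (hd : 0 < d) {q : Polynomial ℝ} (hq : q ≠ 0) :
    0 < ∫ α in (-d)..d, (q.eval α * Real.exp α) ^ 2 := by
  have hcont : Continuous fun α : ℝ => (q.eval α * Real.exp α) ^ 2 := by fun_prop
  obtain ⟨c, hc, hcq⟩ : ∃ c ∈ Icc (-d) d, q.eval c ≠ 0 := by
    by_contra! h
    refine hq (Polynomial.eq_zero_of_infinite_isRoot q ?_)
    exact (Icc_infinite (by linarith : -d < d)).mono fun x hx => h x hx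
  refine intervalIntegral.integral_pos (by linarith) hcont.continuousOn
    (fun x _ => sq_nonneg _) ⟨c, hc, ?_⟩
  have := Real.exp_pos c
  positivity

/-- The basis functions are polynomials of exact degree `s` times the exponential, and they are
orthonormal. -/
lemma psi_spec (hd : 0 < d) (s : ℕ) :
    (∃ p : Polynomial ℝ, p.degree = s ∧ psi d s = fun α => p.eval α * Real.exp α) ∧
    (∫ α in (-d)..d, psi d s α ^ 2 = 1) ∧
    (∀ k < s, ∫ α in (-d)..d, psi d s α * psi d k α = 0) ∧
    (∃ c : ℕ → ℝ, ∀ α, α ^ s * Real.exp α = ∑ k ∈ Finset.range (s + 1), c k * psi d k α) := by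
  induction s using Nat.strong_induction_on with
  | _ s ih =>
    choose! p hp using fun k hk => (ih k hk).1
    set c : ℕ → ℝ := fun k => ∫ β in (-d)..d, β ^ s * Real.exp β * psi d k β with hc
    set r : Polynomial ℝ := ∑ k ∈ Finset.range s, Polynomial.C (c k) * p k with hr
    set q : Polynomial ℝ := Polynomial.X ^ s - r with hqd
    have hrdeg : r.degree < s := by
      refine lt_of_le_of_lt (Polynomial.degree_sum_le _ _) ?_
      refine (Finset.sup_lt_iff (WithBot.bot_lt_coe s)).2 fun k hk => ?_
      have hk' := Finset.mem_range.1 hk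
      by_cases h0 : c k = 0
      · simp only [h0, map_zero, zero_mul, Polynomial.degree_zero]
        exact WithBot.bot_lt_coe s
      rw [Polynomial.degree_C_mul h0, (hp k hk').1]
      exact Nat.cast_lt.2 hk'
    have hqdeg : q.degree = s := by
      rw [hqd, Polynomial.degree_sub_eq_left_of_degree_lt] <;> simp [hrdeg]
    have hq0 : q ≠ 0 := by
      intro h; rw [h] at hqdeg; simp at hqdeg
    have hg : ∀ α, α ^ s * Real.exp α - ∑ k ∈ Finset.range s, c k * psi d k α =
        q.eval α * Real.exp α := by
      intro α
      simp only [hqd, hr, Polynomial.eval_sub, Polynomial.eval_pow, Polynomial.eval_X,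
        Polynomial.eval_finsetSum, Polynomial.eval_mul, Polynomial.eval_C, sub_mul,
        Finset.sum_mul]
      congr 1
      refine Finset.sum_congr rfl fun k hk => ?_
      rw [(hp k (Finset.mem_range.1 hk)).2]; ring
    set σ := Real.sqrt (∫ α in (-d)..d, (q.eval α * Real.exp α) ^ 2) with hσ
    have hσpos : 0 < σ := Real.sqrt_pos.2 (integral_poly_exp_sq_pos hd hq0)
    have hσ2 : σ ^ 2 = ∫ α in (-d)..d, (q.eval α * Real.exp α) ^ 2 :=
      Real.sq_sqrt (integral_poly_exp_sq_pos hd hq0).le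
    have hpsi : ∀ α, psi d s α = q.eval α * Real.exp α / σ := by
      intro α
      rw [psi_eq]
      have hF : ∀ β, ∑ k : Fin s, (∫ β in (-d)..d, β ^ s * Real.exp β * psi d k.val β) *
          psi d k.val β = ∑ k ∈ Finset.range s, c k * psi d k β := fun β =>
        Fin.sum_univ_eq_sum_range (fun k => c k * psi d k β) s
      simp only [hF]
      rw [hσ, ← hg α]
      congr 2
      refine intervalIntegral.integral_congr fun β _ => ?_
      rw [← hg β]
    have hpc : ∀ k < s, Continuous (psi d k) := by
      intro k hk; rw [(hp k hk).2]; fun_prop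
    refine ⟨⟨Polynomial.C (1 / σ) * q, ?_, ?_⟩, ?_, ?_, ?_⟩
    · rw [Polynomial.degree_C_mul (by positivity), hqdeg]
    · ext α; rw [hpsi]; simp; ring
    · simp only [hpsi, div_pow]
      rw [intervalIntegral.integral_div, ← hσ2]
      field_simp
    · intro l hl
      have horth : ∀ k < s, ∫ α in (-d)..d, psi d k α * psi d l α = if k = l then 1 else 0 := by
        intro k hk
        rcases lt_trichotomy k l with h | h | h
        · rw [if_neg h.ne, ← (ih l hl).2.2.1 k h]
          exact intervalIntegral.integral_congr fun α _ => mul_comm _ _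
        · subst h; rw [if_pos rfl, ← (ih k hk).2.1]
          exact intervalIntegral.integral_congr fun α _ => (sq _).symm
        · rw [if_neg h.ne', (ih k hk).2.2.1 l h]
      have h1 : ∀ α, psi d s α * psi d l α = (1 / σ) * (α ^ s * Real.exp α * psi d l α -
          ∑ k ∈ Finset.range s, c k * (psi d k α * psi d l α)) := by
        intro α
        rw [hpsi, ← hg]
        simp only [← mul_assoc, ← Finset.sum_mul]; ring
      simp only [h1]
      have hl' := hpc l hl
      have hi : ∀ k ∈ Finset.range s, IntervalIntegrable
          (fun α => c k * (psi d k α * psi d l α)) volume (-d) d := fun k hk =>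
        (continuous_const.mul ((hpc k (Finset.mem_range.1 hk)).mul hl')).intervalIntegrable _ _
      rw [intervalIntegral.integral_const_mul, intervalIntegral.integral_sub,
        intervalIntegral.integral_finsetSum hi]
      · simp only [intervalIntegral.integral_const_mul]
        rw [Finset.sum_congr rfl fun k hk => by rw [horth k (Finset.mem_range.1 hk)]]
        simp [hl, hc]
      · exact Continuous.intervalIntegrable (by fun_prop) _ _
      · simpa only [Finset.sum_fn] using IntervalIntegrable.sum _ hi
    -- The recursion σ Ψ_s = α^s e^α - ∑ c_k Ψ_k is solved for the monomial; the coefficient of Ψ_s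
    -- is the normalizing factor σ.
    · refine ⟨fun k => if k = s then σ else c k, fun α => ?_⟩
      simp only []
      rw [Finset.sum_range_succ, if_pos rfl, hpsi, ← hg]
      rw [Finset.sum_congr rfl fun k hk => by rw [if_neg (Finset.mem_range.1 hk).ne]]
      field_simp
      ring

lemma psi_contDiff (hd : 0 < d) (s : ℕ) : ContDiff ℝ 2 (psi d s) := by
  obtain ⟨p, -, hp⟩ := (psi_spec hd s).1
  rw [hp]
  have h : ContDiff ℝ 2 fun α => p.eval α := by simpa using p.contDiff_aeval (𝕜 := ℝ) 2
  exact h.mul Real.contDiff_exp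

lemma psi_continuous (hd : 0 < d) (s : ℕ) : Continuous (psi d s) := (psi_contDiff hd s).continuous

lemma psi_differentiable (hd : 0 < d) (s : ℕ) : Differentiable ℝ (psi d s) :=
  (psi_contDiff hd s).differentiable (by norm_num)

lemma psi_deriv_continuous (hd : 0 < d) (s : ℕ) : Continuous (deriv (psi d s)) :=
  (psi_contDiff hd s).continuous_deriv (by norm_num)

/-- Each α^l e^α with l < k is a combination of Ψ_0, …, Ψ_l, all orthogonal to Ψ_k. -/
lemma integral_poly_exp_mul_psi (hd : 0 < d) {k : ℕ} (q : Polynomial ℝ) (hq : q.degree < k) :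
    ∫ α in (-d)..d, q.eval α * Real.exp α * psi d k α = 0 := by
  have hmon : ∀ l < k, ∫ α in (-d)..d, α ^ l * Real.exp α * psi d k α = 0 := by
    intro l hl
    obtain ⟨c, hc⟩ := (psi_spec hd l).2.2.2
    simp only [hc, Finset.sum_mul]
    rw [intervalIntegral.integral_finsetSum]
    · refine Finset.sum_eq_zero fun i hi => ?_
      have : ∫ α in (-d)..d, psi d i α * psi d k α = 0 := by
        rw [← (psi_spec hd k).2.2.1 i (by have := Finset.mem_range.1 hi; omega)]
        exact intervalIntegral.integral_congr fun α _ => mul_comm _ _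
      simp only [mul_assoc, intervalIntegral.integral_const_mul, this, mul_zero]
    · intro i _
      exact ((continuous_const.mul (psi_continuous hd i)).mul
        (psi_continuous hd k)).intervalIntegrable _ _
  have hsum : ∀ α, q.eval α * Real.exp α * psi d k α =
      ∑ l ∈ Finset.range k, q.coeff l * (α ^ l * Real.exp α * psi d k α) := by
    intro α
    by_cases hq0 : q = 0
    · simp [hq0]
    · rw [Polynomial.eval_eq_sum_range' (n := k) ((Polynomial.natDegree_lt_iff_degree_lt hq0).2 hq)]
      simp only [Finset.sum_mul]
      exact Finset.sum_congr rfl fun l _ => by ring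
  simp only [hsum]
  have := psi_continuous hd k
  rw [intervalIntegral.integral_finsetSum]
  · refine Finset.sum_eq_zero fun l hl => ?_
    rw [intervalIntegral.integral_const_mul, hmon l (Finset.mem_range.1 hl), mul_zero]
  · intro l _
    exact Continuous.intervalIntegrable (by fun_prop) _ _

/-- The Gram matrix of the basis and its derivatives is upper triangular with unit diagonal. -/
lemma integral_deriv_psi_mul_psi (hd : 0 < d) {s k : ℕ} (hsk : s ≤ k) :
    ∫ α in (-d)..d, deriv (psi d s) α * psi d k α = if s = k then 1 else 0 := by
  obtain ⟨p, hpd, hp⟩ := (psi_spec hd s).1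
  -- Differentiation of p e^α reproduces Ψ_s and leaves p' e^α, whose degree is below s ≤ k, so that
  -- Ψ_k annihilates it.
  have hder : ∀ α, deriv (psi d s) α = psi d s α + p.derivative.eval α * Real.exp α := by
    intro α
    rw [hp]
    have := ((p.hasDerivAt α).mul (Real.hasDerivAt_exp α)).deriv
    simp only [Pi.mul_def] at this
    rw [this]; ring
  have hdeg : p.derivative.degree < k := by
    have hp0 : p ≠ 0 := by intro h; simp [h] at hpd
    refine lt_of_lt_of_le (Polynomial.degree_derivative_lt hp0) ?_
    rw [hpd]; exact_mod_cast hsk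
  simp only [hder, add_mul]
  have h1 := psi_continuous hd k
  have h2 := psi_continuous hd s
  rw [intervalIntegral.integral_add (Continuous.intervalIntegrable (by fun_prop) _ _)
    (Continuous.intervalIntegrable (by fun_prop) _ _), integral_poly_exp_mul_psi hd _ hdeg,
    add_zero]
  split_ifs with h
  · subst h; rw [← (psi_spec hd s).2.1]
    exact intervalIntegral.integral_congr fun α _ => (sq _).symm
  · rw [← (psi_spec hd k).2.2.1 s (lt_of_le_of_ne hsk h)]
    exact intervalIntegral.integral_congr fun α _ => mul_comm _ _

/-- The matrix `∫ Ψ_s' Ψ_k`. -/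
noncomputable def gramDeriv (d : ℝ) (N : ℕ) : Matrix (Fin N) (Fin N) ℝ :=
  Matrix.of fun k s => ∫ α in (-d)..d, deriv (psi d s.val) α * psi d k.val α

/-- The factor e^α in the basis is what puts ones on the diagonal; for orthonormal polynomials the
same matrix would be strictly triangular, hence singular. -/
lemma isUnit_det_gramDeriv (hd : 0 < d) (N : ℕ) : IsUnit (gramDeriv d N).det := by
  have : (gramDeriv d N).det = 1 := by
    rw [Matrix.det_of_isUpperTriangular]
    · refine Finset.prod_eq_one fun i _ => ?_
      simp [gramDeriv, integral_deriv_psi_mul_psi hd le_rfl]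
    · intro k s hks
      have h : s.val < k.val := hks
      simp [gramDeriv, integral_deriv_psi_mul_psi hd h.le, h.ne]
  rw [this]; exact isUnit_one

end Basis

end RTE

/-! ### Coefficient matrices: lower bound for D_N, upper bounds, measurability. -/

namespace RTE

/-! ### Sums of squares -/

section SumSq

variable {N : ℕ}

/-- The square of the Euclidean length. -/
def nsq (v : Fin N → ℝ) : ℝ := ∑ s, v s ^ 2

lemma nsq_nonneg (v : Fin N → ℝ) : 0 ≤ nsq v := Finset.sum_nonneg fun _ _ => sq_nonneg _

lemma sq_le_nsq (v : Fin N → ℝ) (s : Fin N) : v s ^ 2 ≤ nsq v :=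
  Finset.single_le_sum (f := fun s => v s ^ 2) (fun _ _ => sq_nonneg _) (Finset.mem_univ s)

lemma nsq_le_of_abs_le {v : Fin N → ℝ} {β : ℝ} (h : ∀ s, |v s| ≤ β) : nsq v ≤ N * β ^ 2 := by
  calc nsq v ≤ ∑ _s : Fin N, β ^ 2 :=
        Finset.sum_le_sum fun s _ => sq_le_sq' (abs_le.1 (h s)).1 (abs_le.1 (h s)).2
    _ = N * β ^ 2 := by simp

lemma nsq_add_le (u v : Fin N → ℝ) : nsq (u + v) ≤ 2 * nsq u + 2 * nsq v := by
  simp only [nsq, Finset.mul_sum, ← Finset.sum_add_distrib]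
  exact Finset.sum_le_sum fun s _ => by
    simp only [Pi.add_apply]; nlinarith [sq_nonneg (u s - v s)]

lemma nsq_neg (u : Fin N → ℝ) : nsq (-u) = nsq u := by simp [nsq]

lemma nsq_sum_le {n : ℕ} (q : Fin n → Fin N → ℝ) : nsq (∑ i, q i) ≤ n * ∑ i, nsq (q i) := by
  simp only [nsq, Finset.sum_apply]
  rw [Finset.sum_comm, Finset.mul_sum]
  refine Finset.sum_le_sum fun s _ => ?_
  simpa using sq_sum_le_card_mul_sum_sq (s := Finset.univ) (f := fun i => q i s)

lemma nsq_mulVec_le {B : Matrix (Fin N) (Fin N) ℝ} {β : ℝ} (hB : ∀ k s, |B k s| ≤ β)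
    (v : Fin N → ℝ) : nsq (B.mulVec v) ≤ N ^ 2 * β ^ 2 * nsq v := by
  have h1 : ∀ k, (B.mulVec v k) ^ 2 ≤ N * β ^ 2 * nsq v := by
    intro k
    calc (B.mulVec v k) ^ 2 = (∑ s, B k s * v s) ^ 2 := rfl
      _ ≤ (∑ s, B k s ^ 2) * ∑ s, v s ^ 2 := Finset.sum_mul_sq_le_sq_mul_sq _ _ _
      _ ≤ N * β ^ 2 * nsq v :=
        mul_le_mul_of_nonneg_right (nsq_le_of_abs_le (hB k)) (nsq_nonneg v)
  calc nsq (B.mulVec v) ≤ ∑ _k : Fin N, N * β ^ 2 * nsq v := Finset.sum_le_sum fun k _ => h1 k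
    _ = _ := by simp; ring

/-- A perturbation of an invertible matrix is bounded below. -/
lemma nsq_le_nsq_add_mulVec {G E : Matrix (Fin N) (Fin N) ℝ} (hG : IsUnit G.det) {β ε : ℝ}
    (hβ : ∀ k s, |G⁻¹ k s| ≤ β) (hE : ∀ k s, |E k s| ≤ ε)
    (hε : 4 * N ^ 4 * β ^ 2 * ε ^ 2 ≤ 1) (v : Fin N → ℝ) :
    nsq v ≤ 4 * N ^ 2 * β ^ 2 * nsq ((G + E).mulVec v) := by
  have h1 : nsq v ≤ N ^ 2 * β ^ 2 * nsq (G.mulVec v) := by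
    have := nsq_mulVec_le hβ (G.mulVec v)
    rwa [Matrix.mulVec_mulVec, Matrix.nonsing_inv_mul _ hG, Matrix.one_mulVec] at this
  have h2 : nsq (G.mulVec v) ≤ 2 * nsq ((G + E).mulVec v) + 2 * nsq (E.mulVec v) := by
    have h := nsq_add_le ((G + E).mulVec v) (-E.mulVec v)
    rw [nsq_neg, Matrix.add_mulVec, add_neg_cancel_right] at h
    rwa [Matrix.add_mulVec]
  have h3 := nsq_mulVec_le hE v
  have h4 : (0 : ℝ) ≤ N ^ 2 * β ^ 2 := by positivity
  -- Combined, |v|² ≤ N²β² (2|(G+E)v|² + 2N²ε²|v|²). By the smallness condition the last term is at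
  -- most |v|²/2 and moves to the left side.
  have h5 := mul_le_mul_of_nonneg_left (h2.trans (add_le_add_right
    (mul_le_mul_of_nonneg_left h3 (by norm_num : (0 : ℝ) ≤ 2)) _)) h4
  have h6 := mul_le_mul_of_nonneg_right hε (nsq_nonneg v)
  nlinarith

end SumSq

/-! ### Measurability of parametric integrals -/

/-- D_N, A_i and F are integrals depending on y, and square integrability of the residual needs only
their measurability. Joint continuity on the open strip gives it through Fubini, without any uniform
bound on the integrand. -/
lemma aestronglyMeasurable_parametric {Z : Type*} [TopologicalSpace Z] [SecondCountableTopology Z]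
    [MeasurableSpace Z] [OpensMeasurableSpace Z] {ρ : Measure Z} [SFinite ρ] {s : Set Z}
    (hs : MeasurableSet s) {a b : ℝ} {f : ℝ → Z → ℝ}
    (hf : ContinuousOn (fun q : ℝ × Z => f q.1 q.2) (Ioo a b ×ˢ s)) :
    AEStronglyMeasurable (fun y => ∫ z in s, f y z ∂ρ) (volume.restrict (Ioo a b)) := by
  have h : AEStronglyMeasurable (fun q : ℝ × Z => f q.1 q.2)
      ((volume.restrict (Ioo a b)).prod (ρ.restrict s)) := by
    rw [Measure.prod_restrict]
    exact hf.aestronglyMeasurable (measurableSet_Ioo.prod hs)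
  exact h.integral_prod_right'

lemma aestronglyMeasurable_parametric_interval {a b d : ℝ} (hd : 0 < d) {f : ℝ → ℝ → ℝ}
    (hf : ContinuousOn (fun q : ℝ × ℝ => f q.1 q.2) (Ioo a b ×ˢ Icc (-d) d)) :
    AEStronglyMeasurable (fun y => ∫ z in (-d)..d, f y z) (volume.restrict (Ioo a b)) := by
  simp only [intervalIntegral.integral_of_le (by linarith : -d ≤ d)]
  exact aestronglyMeasurable_parametric measurableSet_Ioc
    (hf.mono (prod_mono_right Ioc_subset_Icc_self))

/-! ### The direction field -/

section Direction

variable {n : ℕ} {A a b d : ℝ}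

/-- The derivative of `-relX` with respect to `α`. -/
def relX' {n : ℕ} (i : Fin n) : ℝ := if i.val = 0 then 1 else 0

/-- The first coordinate of `x - x_α` if `n ≥ 1`. -/
def relX₁ {n : ℕ} (x : Pt n) (α : ℝ) : ℝ := ∑ i, relX' i * relX x α i

lemma hasDerivAt_relX (x : Pt n) (α : ℝ) (i : Fin n) :
    HasDerivAt (fun α => relX x α i) (-relX' i) α := by
  unfold relX relX'
  split_ifs with h
  · simpa using (hasDerivAt_id α).const_sub (x.1 i)
  · simpa using hasDerivAt_const α (x.1 i)

lemma continuous_relX (i : Fin n) : Continuous fun q : Pt n × ℝ => relX q.1 q.2 i := by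
  unfold relX
  split_ifs <;> fun_prop

lemma continuous_srcDist : Continuous fun q : Pt n × ℝ => srcDist q.1 q.2 := by
  unfold srcDist
  have := continuous_relX (n := n)
  fun_prop

lemma continuous_relX₁ : Continuous fun q : Pt n × ℝ => relX₁ q.1 q.2 := by
  unfold relX₁
  have := continuous_relX (n := n)
  fun_prop

lemma le_srcDist (x : Pt n) (α : ℝ) : x.2 ≤ srcDist x α := by
  refine Real.le_sqrt_of_sq_le ?_
  have : 0 ≤ ∑ i, relX x α i ^ 2 := Finset.sum_nonneg fun _ _ => sq_nonneg _
  linarith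

lemma srcDist_pos {x : Pt n} (hx : 0 < x.2) (α : ℝ) : 0 < srcDist x α :=
  hx.trans_le (le_srcDist x α)

lemma hasDerivAt_srcDist {x : Pt n} (hx : 0 < x.2) (α : ℝ) :
    HasDerivAt (fun α => srcDist x α) (-relX₁ x α / srcDist x α) α := by
  have h1 : HasDerivAt (fun α => (∑ i, relX x α i ^ 2) + x.2 ^ 2) (-2 * relX₁ x α) α := by
    have := (HasDerivAt.fun_sum (u := Finset.univ) fun i _ =>
      (hasDerivAt_relX x α i).pow 2).add_const (x.2 ^ 2)
    refine this.congr_deriv ?_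
    rw [relX₁, Finset.mul_sum]
    refine Finset.sum_congr rfl fun i _ => ?_
    push_cast; ring
  have h2 : (∑ i, relX x α i ^ 2) + x.2 ^ 2 ≠ 0 := by
    have : 0 ≤ ∑ i, relX x α i ^ 2 := Finset.sum_nonneg fun _ _ => sq_nonneg _
    positivity
  have := srcDist_pos hx α
  refine (h1.sqrt h2).congr_deriv ?_
  rw [show √((∑ i, relX x α i ^ 2) + x.2 ^ 2) = srcDist x α from rfl]
  field_simp

/-- With r = |x - x_α| one has ν_{n+1} = y/r and ∂_α r = -(x₁ - α)/r, so the quotient is the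
logarithmic derivative of 1/r. It decays as a grows, which is the source of the smallness of D_N -
M_N. -/
lemma deriv_nuY_div {x : Pt n} (hx : 0 < x.2) (α : ℝ) :
    deriv (fun α' => nuY x α') α / nuY x α = relX₁ x α / srcDist x α ^ 2 := by
  have hs := srcDist_pos hx α
  have h : HasDerivAt (fun α' => nuY x α') (x.2 * relX₁ x α / srcDist x α ^ 3) α := by
    refine ((hasDerivAt_const α x.2).div (hasDerivAt_srcDist hx α) hs.ne').congr_deriv ?_
    field_simp
    ring
  rw [h.deriv, nuY]
  field_simp

lemma nuX_div_nuY {x : Pt n} (hx : 0 < x.2) (α : ℝ) (i : Fin n) :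
    nuX x α i / nuY x α = relX x α i / x.2 := by
  have hs := srcDist_pos hx α
  rw [nuX, nuY]
  field_simp

lemma deriv_nuX_div {x : Pt n} (hx : 0 < x.2) (α : ℝ) (i : Fin n) :
    deriv (fun α' => nuX x α' i) α / nuY x α =
      (-relX' i + relX x α i * relX₁ x α / srcDist x α ^ 2) / x.2 := by
  have hs := srcDist_pos hx α
  have h : HasDerivAt (fun α' => nuX x α' i)
      (-relX' i / srcDist x α + relX x α i * relX₁ x α / srcDist x α ^ 3) α := by
    refine ((hasDerivAt_relX x α i).div (hasDerivAt_srcDist hx α) hs.ne').congr_deriv ?_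
    field_simp
    ring
  rw [h.deriv, nuY]
  field_simp

lemma abs_relX_le {x : Pt n} (hx : x ∈ closedPrism n A a b) {α : ℝ} (hα : α ∈ Icc (-d) d)
    (hd : 0 < d) (i : Fin n) : |relX x α i| ≤ A + d := by
  have h1 := hx.1 i
  unfold relX
  rw [abs_le]
  split_ifs <;> constructor <;> linarith [hα.1, hα.2]

lemma abs_relX₁_le (hA : 0 < A) {x : Pt n} (hx : x ∈ closedPrism n A a b) {α : ℝ}
    (hα : α ∈ Icc (-d) d) (hd : 0 < d) : |relX₁ x α| ≤ A + d := by
  unfold relX₁ relX'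
  rcases Nat.eq_zero_or_pos n with rfl | hn
  · simp; linarith
  · have : ∀ i : Fin n, (i.val = 0) = (i = ⟨0, hn⟩) := fun i => by simp [Fin.ext_iff]
    simp only [this, ite_mul, one_mul, zero_mul, Finset.sum_ite_eq', Finset.mem_univ, if_true]
    exact abs_relX_le hx hα hd _

lemma abs_relX'_le (i : Fin n) : |relX' i| ≤ 1 := by
  unfold relX'; split_ifs <;> simp

end Direction

/-! ### Bounds for the coefficient matrices -/

section Coefficients

variable {n N : ℕ} {A a b d : ℝ}

lemma exists_bound_psi (hd : 0 < d) (N : ℕ) : ∃ C : ℝ, 0 ≤ C ∧ ∀ s : Fin N, ∀ α ∈ Icc (-d) d,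
    |psi d s α| ≤ C ∧ |deriv (psi d s) α| ≤ C := by
  have h : ∀ s : Fin N, ∃ C : ℝ, 0 ≤ C ∧ ∀ α ∈ Icc (-d) d,
      |psi d s α| ≤ C ∧ |deriv (psi d s) α| ≤ C := by
    intro s
    obtain ⟨C, hC⟩ := isCompact_Icc.exists_bound_of_continuousOn (s := Icc (-d) d)
      (psi_continuous hd s).continuousOn
    obtain ⟨C', hC'⟩ := isCompact_Icc.exists_bound_of_continuousOn (s := Icc (-d) d)
      (psi_deriv_continuous hd s).continuousOn
    refine ⟨max 0 (max C C'), le_max_left _ _, fun α hα => ⟨?_, ?_⟩⟩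
    · exact (hC α hα).trans ((le_max_left _ _).trans (le_max_right _ _))
    · exact (hC' α hα).trans ((le_max_right _ _).trans (le_max_right _ _))
  choose C hC0 hC using h
  refine ⟨∑ s, C s, Finset.sum_nonneg fun s _ => hC0 s, fun s α hα => ?_⟩
  have := Finset.single_le_sum (fun s _ => hC0 s) (Finset.mem_univ s)
  exact ⟨((hC s α hα).1).trans this, ((hC s α hα).2).trans this⟩

/-- From 2|uv| ≤ u² + v² and the normalization. It keeps supremum bounds of the basis out of the
estimate of D_N - M_N. -/
lemma integral_abs_psi_mul_le (hd : 0 < d) (s k : ℕ) :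
    ∫ α in (-d)..d, |psi d s α * psi d k α| ≤ 1 := by
  have h1 := psi_continuous hd s
  have h2 := psi_continuous hd k
  calc ∫ α in (-d)..d, |psi d s α * psi d k α|
      ≤ ∫ α in (-d)..d, (psi d s α ^ 2 / 2 + psi d k α ^ 2 / 2) := by
        refine intervalIntegral.integral_mono_on (by linarith)
          (Continuous.intervalIntegrable (by fun_prop) _ _)
          (Continuous.intervalIntegrable (by fun_prop) _ _) fun α _ => ?_
        rw [abs_le]
        constructor <;> nlinarith [sq_nonneg (psi d s α - psi d k α),
          sq_nonneg (psi d s α + psi d k α)]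
    _ = 1 := by
        rw [intervalIntegral.integral_add (Continuous.intervalIntegrable (by fun_prop) _ _)
          (Continuous.intervalIntegrable (by fun_prop) _ _), intervalIntegral.integral_div,
          intervalIntegral.integral_div, (psi_spec hd s).2.1, (psi_spec hd k).2.1]
        norm_num

/-- The matrix `D_N - M_N`. -/
noncomputable def matE (d : ℝ) (N : ℕ) {n : ℕ} (x : Pt n) : Matrix (Fin N) (Fin N) ℝ :=
  Matrix.of fun k s => ∫ α in (-d)..d, relX₁ x α / srcDist x α ^ 2 * (psi d s α * psi d k α)

lemma matD_eq {x : Pt n} (hx : 0 < x.2) : matD d N x = gramDeriv d N + matE d N x := by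
  ext k s
  simp only [matD, gramDeriv, matE, Matrix.of_apply, Matrix.add_apply, deriv_nuY_div hx, mul_assoc]

lemma continuousOn_ratio (p : Fin n → ℝ) (ha : 0 < a) : ContinuousOn
    (fun q : ℝ × ℝ => relX₁ (p, q.1) q.2 / srcDist (p, q.1) q.2 ^ 2) (Ioo a b ×ˢ Icc (-d) d) := by
  have h1 := continuous_relX₁ (n := n)
  have h2 := continuous_srcDist (n := n)
  have h : Continuous fun q : ℝ × ℝ => ((p, q.1), q.2) := by fun_prop
  refine (h1.comp h).continuousOn.div ((h2.comp h).pow 2).continuousOn fun q hq => ?_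
  exact pow_ne_zero 2 (srcDist_pos (x := (p, q.1)) (ha.trans hq.1.1) q.2).ne'

lemma abs_ratio_le (hA : 0 < A) (hd : 0 < d) (ha : 1 ≤ a) {x : Pt n} (hx : x ∈ closedPrism n A a b)
    {α : ℝ} (hα : α ∈ Icc (-d) d) : |relX₁ x α / srcDist x α ^ 2| ≤ (A + d) / a := by
  have h1 := abs_relX₁_le hA hx hα hd
  have h2 : a ≤ srcDist x α := hx.2.1.trans (le_srcDist x α)
  have h3 : a ≤ srcDist x α ^ 2 := by nlinarith
  rw [abs_div, abs_of_nonneg (sq_nonneg (srcDist x α))]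
  gcongr

lemma abs_matE_le (hA : 0 < A) (hd : 0 < d) (ha : 1 ≤ a) {x : Pt n} (hx : x ∈ closedPrism n A a b)
    (k s : Fin N) : |matE d N x k s| ≤ (A + d) / a := by
  have h1 := psi_continuous hd s
  have h2 := psi_continuous hd k
  have h0 : 0 ≤ (A + d) / a := by positivity
  calc |matE d N x k s| ≤ ∫ α in (-d)..d, (A + d) / a * |psi d s α * psi d k α| := by
        rw [matE, Matrix.of_apply, ← Real.norm_eq_abs]
        refine intervalIntegral.norm_integral_le_of_norm_le (by linarith) ?_
          (Continuous.intervalIntegrable (by fun_prop) _ _)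
        refine Filter.Eventually.of_forall fun α hα => ?_
        rw [norm_mul, Real.norm_eq_abs, Real.norm_eq_abs]
        exact mul_le_mul_of_nonneg_right (abs_ratio_le hA hd ha hx (Ioc_subset_Icc_self hα))
          (abs_nonneg _)
    _ ≤ (A + d) / a * 1 := by
        rw [intervalIntegral.integral_const_mul]
        exact mul_le_mul_of_nonneg_left (integral_abs_psi_mul_le hd s k) h0
    _ = _ := mul_one _

lemma exists_abs_matrix_le (B : Matrix (Fin N) (Fin N) ℝ) : ∃ β : ℝ, 0 ≤ β ∧ ∀ k s, |B k s| ≤ β := by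
  refine ⟨∑ k, ∑ s, |B k s|, by positivity, fun k s => ?_⟩
  exact (Finset.single_le_sum (f := fun s => |B k s|) (fun _ _ => abs_nonneg _)
    (Finset.mem_univ s)).trans (Finset.single_le_sum (f := fun k => ∑ s, |B k s|)
    (fun _ _ => by positivity) (Finset.mem_univ k))

/-- For `a ≥ a₀` the matrix `D_N` is bounded below, uniformly in the number of horizontal
variables. -/
lemma exists_matD_lower (hA : 0 < A) (hd : 0 < d) (N : ℕ) : ∃ a₀ > 1, ∃ c > 0,
    ∀ (n : ℕ) (a b : ℝ), a₀ ≤ a → ∀ x ∈ closedPrism n A a b, ∀ v : Fin N → ℝ,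
      c * nsq v ≤ nsq ((matD d N x).mulVec v) := by
  obtain ⟨β, hβ0, hβ⟩ := exists_abs_matrix_le (gramDeriv d N)⁻¹
  -- The second summand of a₀ enforces 2N²β(A+d)/a ≤ 1, the square root of the smallness condition
  -- with ε = (A+d)/a; the first one gives a₀ > 1. The 1 added in the denominator of c keeps it
  -- positive when β or N vanishes.
  refine ⟨2 + 2 * N ^ 2 * β * (A + d), ?_, 1 / (4 * N ^ 2 * β ^ 2 + 1), by positivity, ?_⟩
  · have : 0 ≤ 2 * N ^ 2 * β * (A + d) := by positivity
    linarith
  intro n a b ha x hx v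
  have h0 : 0 ≤ 2 * N ^ 2 * β * (A + d) := by positivity
  have ha1 : 1 ≤ a := by linarith
  have hx2 : 0 < x.2 := lt_of_lt_of_le (by linarith) hx.2.1
  rw [matD_eq hx2]
  have hle : 2 * N ^ 2 * β * (A + d) / a ≤ 1 := by
    rw [div_le_one (by linarith)]; linarith
  have hε : 4 * N ^ 4 * β ^ 2 * ((A + d) / a) ^ 2 ≤ 1 := by
    have : 4 * N ^ 4 * β ^ 2 * ((A + d) / a) ^ 2 = (2 * N ^ 2 * β * (A + d) / a) ^ 2 := by ring
    rw [this]
    exact pow_le_one₀ (by positivity) hle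
  have := nsq_le_nsq_add_mulVec (isUnit_det_gramDeriv hd N) hβ (abs_matE_le hA hd ha1 hx) hε v
  have h5 := nsq_nonneg ((gramDeriv d N + matE d N x).mulVec v)
  rw [div_mul_eq_mul_div, one_mul, div_le_iff₀ (by positivity)]
  linarith

/-- A lower bound gives injectivity, which suffices for a square matrix. -/
lemma isUnit_of_nsq_lower {B : Matrix (Fin N) (Fin N) ℝ} {c : ℝ} (hc : 0 < c)
    (h : ∀ v, c * nsq v ≤ nsq (B.mulVec v)) : IsUnit B := by
  rw [← Matrix.mulVec_injective_iff_isUnit]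
  intro u v huv
  have h1 := h (u - v)
  rw [Matrix.mulVec_sub, sub_eq_zero.2 huv] at h1
  have h2 : nsq (u - v) ≤ 0 := by
    have : nsq (0 : Fin N → ℝ) = 0 := by simp [nsq]
    rw [this] at h1
    nlinarith [nsq_nonneg (u - v)]
  ext s
  have h3 := (sq_le_nsq (u - v) s).trans h2
  have h4 : (u - v) s = 0 := by nlinarith [sq_nonneg ((u - v) s)]
  simpa [sub_eq_zero] using h4

lemma exists_abs_matD_le (hA : 0 < A) (hd : 0 < d) (ha : 1 ≤ a) (N : ℕ) : ∃ β : ℝ, 0 ≤ β ∧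
    ∀ (n : ℕ) (b : ℝ), ∀ x ∈ closedPrism n A a b, ∀ k s, |matD d N x k s| ≤ β := by
  obtain ⟨β, hβ0, hβ⟩ := exists_abs_matrix_le (gramDeriv d N)
  refine ⟨β + (A + d) / a, by positivity, fun n b x hx k s => ?_⟩
  rw [matD_eq (lt_of_lt_of_le (by linarith) hx.2.1), Matrix.add_apply]
  exact (abs_add_le _ _).trans (add_le_add (hβ k s) (abs_matE_le hA hd ha hx k s))

lemma matA_apply {x : Pt n} (hx : 0 < x.2) (i : Fin n) (k s : Fin N) :
    matA d N i x k s = ∫ α in (-d)..d, (relX x α i / x.2 * deriv (psi d s) α +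
      (-relX' i + relX x α i * (relX₁ x α / srcDist x α ^ 2)) / x.2 * psi d s α) * psi d k α := by
  simp only [matA, Matrix.of_apply, nuX_div_nuY hx, deriv_nuX_div hx, mul_div_assoc]

lemma exists_abs_matA_le (hA : 0 < A) (hd : 0 < d) (ha : 1 ≤ a) (N : ℕ) : ∃ β : ℝ, 0 ≤ β ∧
    ∀ (n : ℕ) (b : ℝ), ∀ x ∈ closedPrism n A a b, ∀ i k s, |matA d N i x k s| ≤ β := by
  obtain ⟨C, hC0, hC⟩ := exists_bound_psi hd N
  refine ⟨((A + d) * C + (1 + (A + d) * ((A + d) / a)) * C) * C * |d - -d|, by positivity,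
    fun n b x hx i k s => ?_⟩
  have hx2 : 1 ≤ x.2 := ha.trans hx.2.1
  rw [matA_apply (by linarith), ← Real.norm_eq_abs]
  refine intervalIntegral.norm_integral_le_of_norm_le_const fun α hα => ?_
  rw [uIoc_of_le (by linarith)] at hα
  have hα' := Ioc_subset_Icc_self hα
  have h1 := abs_relX_le hx hα' hd i
  have h2 := abs_ratio_le hA hd ha hx hα'
  -- Since y ≥ a ≥ 1, division by y = x.2 can only decrease absolute values.
  have hdiv : ∀ t r : ℝ, |t| ≤ r → |t / x.2| ≤ r := by
    intro t r ht
    rw [abs_div, abs_of_nonneg (by linarith : 0 ≤ x.2)]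
    exact (div_le_self (abs_nonneg _) hx2).trans ht
  have h3 : |(-relX' i + relX x α i * (relX₁ x α / srcDist x α ^ 2)) / x.2| ≤
      1 + (A + d) * ((A + d) / a) := by
    refine hdiv _ _ ((abs_add_le _ _).trans (add_le_add ?_ ?_))
    · rw [abs_neg]; exact abs_relX'_le i
    · rw [abs_mul]; gcongr
  rw [Real.norm_eq_abs, abs_mul]
  refine mul_le_mul ((abs_add_le _ _).trans ?_) (hC k α hα').1 (abs_nonneg _) (by positivity)
  rw [abs_mul, abs_mul]
  refine add_le_add (mul_le_mul (hdiv _ _ h1) (hC s α hα').2 (abs_nonneg _) (by positivity))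
    (mul_le_mul h3 (hC s α hα').1 (abs_nonneg _) (by positivity))

lemma aestronglyMeasurable_matD (hd : 0 < d) (ha : 0 < a) (p : Fin n → ℝ) (k s : Fin N) :
    AEStronglyMeasurable (fun y => matD d N (p, y) k s) (volume.restrict (Ioo a b)) := by
  have h1 := psi_continuous hd s
  have h2 := psi_continuous hd k
  have h : AEStronglyMeasurable (fun y => gramDeriv d N k s + matE d N (p, y) k s)
      (volume.restrict (Ioo a b)) := by
    refine aestronglyMeasurable_const.add ?_
    simp only [matE, Matrix.of_apply]
    refine aestronglyMeasurable_parametric_interval hd ((continuousOn_ratio p ha).mul ?_)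
    exact Continuous.continuousOn (by fun_prop)
  refine h.congr ?_
  filter_upwards [ae_restrict_mem measurableSet_Ioo] with y hy
  rw [matD_eq (ha.trans hy.1), Matrix.add_apply]

lemma aestronglyMeasurable_matA (hd : 0 < d) (ha : 0 < a) (p : Fin n → ℝ) (i : Fin n)
    (k s : Fin N) :
    AEStronglyMeasurable (fun y => matA d N i (p, y) k s) (volume.restrict (Ioo a b)) := by
  have h1 := psi_continuous hd s
  have h2 := psi_continuous hd k
  have h3 := psi_deriv_continuous hd s
  have hr := continuousOn_ratio (b := b) (d := d) p ha
  have hX : Continuous fun q : ℝ × ℝ => relX (p, q.1) q.2 i :=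
    (continuous_relX i).comp (by fun_prop : Continuous fun q : ℝ × ℝ => ((p, q.1), q.2))
  have hy : ∀ q ∈ Ioo a b ×ˢ Icc (-d) d, (q : ℝ × ℝ).1 ≠ 0 := fun q hq => (ha.trans hq.1.1).ne'
  have h : AEStronglyMeasurable (fun y => ∫ α in (-d)..d,
      (relX (p, y) α i / y * deriv (psi d s) α +
        (-relX' i + relX (p, y) α i * (relX₁ (p, y) α / srcDist (p, y) α ^ 2)) / y *
          psi d s α) * psi d k α) (volume.restrict (Ioo a b)) := by
    refine aestronglyMeasurable_parametric_interval hd ?_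
    refine ContinuousOn.mul (ContinuousOn.add (ContinuousOn.mul (hX.continuousOn.div
      continuous_fst.continuousOn hy) (Continuous.continuousOn (by fun_prop)))
      (ContinuousOn.mul (ContinuousOn.div ?_ continuous_fst.continuousOn hy)
      (Continuous.continuousOn (by fun_prop)))) (Continuous.continuousOn (by fun_prop))
    exact continuousOn_const.add (hX.continuousOn.mul hr)
  refine h.congr ?_
  filter_upwards [ae_restrict_mem measurableSet_Ioo] with y hy
  rw [matA_apply (ha.trans hy.1)]

end Coefficients

end RTE

/-! ### The nonlinear term F: integral representation and Taylor expansion in w. -/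

namespace RTE

/-! ### Integrals of exponentials of linear forms -/

lemma abs_exp_sub_one_le (x : ℝ) : |Real.exp x - 1| ≤ |x| * Real.exp |x| := by
  have h := Complex.norm_exp_sub_sum_le_norm_mul_exp (x : ℂ) 1
  simp only [Finset.sum_range_one, pow_zero, Nat.factorial_zero, Nat.cast_one, div_one, pow_one,
    Complex.norm_real, Real.norm_eq_abs] at h
  rw [← Complex.ofReal_exp, ← Complex.ofReal_one, ← Complex.ofReal_sub, Complex.norm_real,
    Real.norm_eq_abs] at h
  exact h

lemma abs_exp_sub_one_sub_le (x : ℝ) : |Real.exp x - 1 - x| ≤ x ^ 2 * Real.exp |x| := by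
  have h := Complex.norm_exp_sub_sum_le_norm_mul_exp (x : ℂ) 2
  simp only [Finset.sum_range_succ, Finset.sum_range_zero, pow_zero, Nat.factorial_zero,
    Nat.cast_one, div_one, pow_one, zero_add, Nat.factorial_one,
    Complex.norm_real, Real.norm_eq_abs, sq_abs] at h
  rw [← Complex.ofReal_exp, ← Complex.ofReal_one, ← Complex.ofReal_add, ← Complex.ofReal_sub,
    Complex.norm_real, Real.norm_eq_abs] at h
  rwa [sub_sub]

lemma abs_setIntegral_le {Z : Type*} [MeasurableSpace Z] {σ : Measure Z} {S : Set Z}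
    (hS : σ S < ⊤) {f : Z → ℝ} {C : ℝ} (h : ∀ z ∈ S, |f z| ≤ C) :
    |∫ z in S, f z ∂σ| ≤ C * σ.real S :=
  norm_setIntegral_le_of_norm_le_const (f := f) hS h

section ExpForm

variable {N : ℕ} {Z : Type*} {g₀ : Z → ℝ} {g e : Fin N → Z → ℝ} {B ρ : ℝ} {w v : Fin N → ℝ}

/-- The function `(g₀ + ∑ w_s g_s) exp (∑ w_s e_s)`. -/
noncomputable def expForm (g₀ : Z → ℝ) (g e : Fin N → Z → ℝ) (w : Fin N → ℝ) (z : Z) : ℝ :=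
  (g₀ z + ∑ s, w s * g s z) * Real.exp (∑ s, w s * e s z)

/-- The derivative of `expForm` with respect to `w` in the direction `v`. -/
noncomputable def expFormDeriv (g₀ : Z → ℝ) (g e : Fin N → Z → ℝ) (w v : Fin N → ℝ) (z : Z) : ℝ :=
  (∑ s, v s * g s z + (g₀ z + ∑ s, w s * g s z) * ∑ s, v s * e s z) *
    Real.exp (∑ s, w s * e s z)

lemma abs_sum_mul_le {f : Fin N → ℝ} (hf : ∀ s, |f s| ≤ B) (v : Fin N → ℝ) :
    |∑ s, v s * f s| ≤ B * ∑ s, |v s| := by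
  rw [Finset.mul_sum]
  refine (Finset.abs_sum_le_sum_abs _ _).trans (Finset.sum_le_sum fun s _ => ?_)
  rw [abs_mul, mul_comm]
  exact mul_le_mul_of_nonneg_right (hf s) (abs_nonneg _)

lemma sum_abs_le (hv : ∀ s, |v s| ≤ ρ) : ∑ s, |v s| ≤ N * ρ := by
  simpa using Finset.sum_le_sum (s := Finset.univ) fun s _ => hv s

lemma sum_abs_sq_le (v : Fin N → ℝ) : (∑ s, |v s|) ^ 2 ≤ N * nsq v := by
  simpa [nsq] using sq_sum_le_card_mul_sum_sq (s := Finset.univ) (f := fun s => |v s|)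

/-- With G the affine factor and E the exponential at w, and γ, ε the increments of the affine
factor and of the exponent, the value at w + v is (G + γ) E e^ε. Hence the Taylor remainder is E (G
(e^ε - 1 - ε) + γ (e^ε - 1)), and both products are quadratic in ∑|v_s|. The bounds |w_s|, |v_s| ≤ ρ
make all exponentials uniform. -/
lemma expForm_bounds (hB : 0 ≤ B) (hρ : 0 ≤ ρ) {z : Z} (h₀ : |g₀ z| ≤ B) (hg : ∀ s, |g s z| ≤ B)
    (he : ∀ s, |e s z| ≤ B) (hw : ∀ s, |w s| ≤ ρ) (hv : ∀ s, |v s| ≤ ρ) :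
    |expForm g₀ g e w z| ≤ (B + B * (N * ρ)) * Real.exp (B * (N * ρ)) ∧
    |expFormDeriv g₀ g e w v z| ≤
      (B + (B + B * (N * ρ)) * B) * Real.exp (B * (N * ρ)) * ∑ s, |v s| ∧
    |expForm g₀ g e (w + v) z - expForm g₀ g e w z - expFormDeriv g₀ g e w v z| ≤
      (B + B * (N * ρ) + 1) * B ^ 2 * Real.exp (B * (N * ρ)) * Real.exp (B * (N * ρ)) *
        (∑ s, |v s|) ^ 2 := by
  set T := ∑ s, |v s| with hT
  have hT0 : 0 ≤ T := Finset.sum_nonneg fun _ _ => abs_nonneg _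
  have hTρ : T ≤ N * ρ := sum_abs_le hv
  set L := B * (N * ρ) with hL
  have hL0 : 0 ≤ L := by positivity
  set G := g₀ z + ∑ s, w s * g s z with hG
  set γ := ∑ s, v s * g s z with hγ
  set ε := ∑ s, v s * e s z with hε
  set E := Real.exp (∑ s, w s * e s z) with hE
  have hE0 : 0 < E := Real.exp_pos _
  have hwL : ∀ f : Fin N → ℝ, (∀ s, |f s| ≤ B) → |∑ s, w s * f s| ≤ L := fun f hf =>
    (abs_sum_mul_le hf w).trans (mul_le_mul_of_nonneg_left (sum_abs_le hw) hB)
  have hGb : |G| ≤ B + L := (abs_add_le _ _).trans (add_le_add h₀ (hwL _ hg))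
  have hEb : E ≤ Real.exp L := Real.exp_le_exp.2 ((le_abs_self _).trans (hwL _ he))
  have hγb : |γ| ≤ B * T := abs_sum_mul_le hg v
  have hεb : |ε| ≤ B * T := abs_sum_mul_le he v
  have hεL : |ε| ≤ L := hεb.trans (mul_le_mul_of_nonneg_left hTρ hB)
  have hXL : Real.exp |ε| ≤ Real.exp L := Real.exp_le_exp.2 hεL
  refine ⟨?_, ?_, ?_⟩
  · rw [expForm, abs_mul, abs_of_pos hE0]
    exact mul_le_mul hGb hEb hE0.le (by positivity)
  · rw [expFormDeriv, abs_mul, abs_of_pos hE0]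
    have h1 : |γ + G * ε| ≤ B * T + (B + L) * (B * T) := by
      refine (abs_add_le _ _).trans (add_le_add hγb ?_)
      rw [abs_mul]; gcongr
    calc |γ + G * ε| * E ≤ (B * T + (B + L) * (B * T)) * Real.exp L := by gcongr
      _ = _ := by ring
  · have hwv : expForm g₀ g e (w + v) z = (G + γ) * (E * Real.exp ε) := by
      simp only [expForm, Pi.add_apply, add_mul, Finset.sum_add_distrib, Real.exp_add]
      rw [hG, hγ, hE, hε]; ring
    have hid : expForm g₀ g e (w + v) z - expForm g₀ g e w z - expFormDeriv g₀ g e w v z =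
        E * (G * (Real.exp ε - 1 - ε) + γ * (Real.exp ε - 1)) := by
      rw [hwv, expForm, expFormDeriv]; ring
    have h2 : |Real.exp ε - 1 - ε| ≤ (B * T) ^ 2 * Real.exp L := by
      refine (abs_exp_sub_one_sub_le ε).trans ?_
      rw [← sq_abs ε]; gcongr
    have h3 : |Real.exp ε - 1| ≤ B * T * Real.exp L := by
      refine (abs_exp_sub_one_le ε).trans ?_
      gcongr
    rw [hid, abs_mul, abs_of_pos hE0]
    have h4 : |G * (Real.exp ε - 1 - ε) + γ * (Real.exp ε - 1)| ≤
        (B + L) * ((B * T) ^ 2 * Real.exp L) + B * T * (B * T * Real.exp L) := by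
      refine (abs_add_le _ _).trans (add_le_add ?_ ?_) <;> rw [abs_mul] <;> gcongr
    calc E * _ ≤ Real.exp L * _ := mul_le_mul hEb h4 (abs_nonneg _) (by positivity)
      _ = _ := by ring

lemma expFormDeriv_add (w u v : Fin N → ℝ) (z : Z) : expFormDeriv g₀ g e w (u + v) z =
    expFormDeriv g₀ g e w u z + expFormDeriv g₀ g e w v z := by
  simp only [expFormDeriv, Pi.add_apply, add_mul, Finset.sum_add_distrib]; ring

lemma expFormDeriv_smul (t : ℝ) (w v : Fin N → ℝ) (z : Z) : expFormDeriv g₀ g e w (t • v) z =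
    t * expFormDeriv g₀ g e w v z := by
  simp only [expFormDeriv, Pi.smul_apply, smul_eq_mul, mul_assoc, ← Finset.mul_sum]; ring

variable [TopologicalSpace Z] [MeasurableSpace Z] [OpensMeasurableSpace Z] {σ : Measure Z}
  [IsFiniteMeasureOnCompacts σ] {S : Set Z}

lemma continuousOn_expForm {Y : Type*} [TopologicalSpace Y] {U : Set Y} {g₀ : Y → ℝ}
    {g e : Fin N → Y → ℝ} {w : Y → Fin N → ℝ} (h₀ : ContinuousOn g₀ U)
    (hg : ∀ s, ContinuousOn (g s) U)
    (he : ∀ s, ContinuousOn (e s) U) (hw : ∀ s, ContinuousOn (fun y => w y s) U) :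
    ContinuousOn (fun y => expForm g₀ g e (w y) y) U := by
  unfold expForm
  fun_prop

lemma continuousOn_expFormDeriv {Y : Type*} [TopologicalSpace Y] {U : Set Y} {g₀ : Y → ℝ}
    {g e : Fin N → Y → ℝ} {w v : Y → Fin N → ℝ} (h₀ : ContinuousOn g₀ U)
    (hg : ∀ s, ContinuousOn (g s) U) (he : ∀ s, ContinuousOn (e s) U)
    (hw : ∀ s, ContinuousOn (fun y => w y s) U) (hv : ∀ s, ContinuousOn (fun y => v y s) U) :
    ContinuousOn (fun y => expFormDeriv g₀ g e (w y) (v y) y) U := by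
  unfold expFormDeriv
  fun_prop

lemma integrableOn_expForm [T2Space Z] (hS : IsCompact S) (h₀ : ContinuousOn g₀ S)
    (hg : ∀ s, ContinuousOn (g s) S) (he : ∀ s, ContinuousOn (e s) S) (w : Fin N → ℝ) :
    IntegrableOn (expForm g₀ g e w) S σ :=
  (continuousOn_expForm (w := fun _ => w) h₀ hg he fun _ => continuousOn_const).integrableOn_compact
    hS

lemma integrableOn_expFormDeriv [T2Space Z] (hS : IsCompact S) (h₀ : ContinuousOn g₀ S)
    (hg : ∀ s, ContinuousOn (g s) S) (he : ∀ s, ContinuousOn (e s) S) (w v : Fin N → ℝ) :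
    IntegrableOn (expFormDeriv g₀ g e w v) S σ :=
  (continuousOn_expFormDeriv (w := fun _ => w) (v := fun _ => v) h₀ hg he
    (fun _ => continuousOn_const) fun _ => continuousOn_const).integrableOn_compact hS

/-- The constant of the Taylor expansion of `∫ expForm`. -/
noncomputable def expFormConst (N : ℕ) (B ρ V : ℝ) : ℝ :=
  ((B + B * (N * ρ)) * Real.exp (B * (N * ρ)) * V) ^ 2 +
  ((B + (B + B * (N * ρ)) * B) * Real.exp (B * (N * ρ)) * V) ^ 2 * N +
  ((B + B * (N * ρ) + 1) * B ^ 2 * Real.exp (B * (N * ρ)) * Real.exp (B * (N * ρ)) * V) ^ 2 * N ^ 2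

/-- The pointwise bounds are integrated over the compact S and squared, with (∑|v_s|)² ≤ N|v|². The
constant is a sum of three nonnegative terms, each of which serves one of the estimates. -/
lemma integral_expForm_bounds [T2Space Z] (hS : IsCompact S) (h₀ : ContinuousOn g₀ S)
    (hg : ∀ s, ContinuousOn (g s) S) (he : ∀ s, ContinuousOn (e s) S) (hB : 0 ≤ B) (hρ : 0 ≤ ρ)
    (b₀ : ∀ z ∈ S, |g₀ z| ≤ B) (bg : ∀ s, ∀ z ∈ S, |g s z| ≤ B) (be : ∀ s, ∀ z ∈ S, |e s z| ≤ B)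
    (hw : ∀ s, |w s| ≤ ρ) (hv : ∀ s, |v s| ≤ ρ) :
    (∫ z in S, expForm g₀ g e w z ∂σ) ^ 2 ≤ expFormConst N B ρ (σ.real S) ∧
    (∫ z in S, expFormDeriv g₀ g e w v z ∂σ) ^ 2 ≤ expFormConst N B ρ (σ.real S) * nsq v ∧
    ((∫ z in S, expForm g₀ g e (w + v) z ∂σ) - (∫ z in S, expForm g₀ g e w z ∂σ) -
      ∫ z in S, expFormDeriv g₀ g e w v z ∂σ) ^ 2 ≤
        expFormConst N B ρ (σ.real S) * nsq v ^ 2 := by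
  have hmain := fun z (hz : z ∈ S) => expForm_bounds (w := w) (v := v) hB hρ (b₀ z hz)
    (fun s => bg s z hz) (fun s => be s z hz) hw hv
  have hfin : σ S < ⊤ := hS.measure_lt_top
  have hT := sum_abs_sq_le v
  have hn := nsq_nonneg v
  set T := ∑ s, |v s|
  have hT2 : (T ^ 2) ^ 2 ≤ N ^ 2 * nsq v ^ 2 := by
    calc (T ^ 2) ^ 2 ≤ (N * nsq v) ^ 2 := by gcongr
      _ = _ := by ring
  set V := σ.real S
  set L := B * (N * ρ)
  refine ⟨?_, ?_, ?_⟩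
  · have h := abs_setIntegral_le hfin fun z hz => (hmain z hz).1
    calc _ ≤ ((B + L) * Real.exp L * V) ^ 2 := by rw [← sq_abs]; gcongr
      _ ≤ _ := by
        unfold expFormConst
        have : ∀ x y z : ℝ, 0 ≤ y → 0 ≤ z → x ≤ x + y + z := fun x y z hy hz => by linarith
        exact this _ _ _ (by positivity) (by positivity)
  · have h := abs_setIntegral_le hfin fun z hz => (hmain z hz).2.1
    calc _ ≤ ((B + (B + L) * B) * Real.exp L * T * V) ^ 2 := by rw [← sq_abs]; gcongr
      _ = ((B + (B + L) * B) * Real.exp L * V) ^ 2 * T ^ 2 := by ring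
      _ ≤ ((B + (B + L) * B) * Real.exp L * V) ^ 2 * (N * nsq v) := by gcongr
      _ = ((B + (B + L) * B) * Real.exp L * V) ^ 2 * N * nsq v := by ring
      _ ≤ _ := by
        unfold expFormConst
        have : ∀ x y z : ℝ, 0 ≤ x → 0 ≤ z → y ≤ x + y + z := fun x y z hy hz => by linarith
        exact mul_le_mul_of_nonneg_right (this _ _ _ (by positivity) (by positivity)) hn
  · rw [← integral_sub (integrableOn_expForm hS h₀ hg he _) (integrableOn_expForm hS h₀ hg he _),
      ← integral_sub ((integrableOn_expForm hS h₀ hg he _).fun_sub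
        (integrableOn_expForm hS h₀ hg he _)) (integrableOn_expFormDeriv hS h₀ hg he _ _)]
    have h := abs_setIntegral_le hfin fun z hz => (hmain z hz).2.2
    set c := (B + L + 1) * B ^ 2 * Real.exp L * Real.exp L
    calc _ ≤ (c * T ^ 2 * V) ^ 2 := by rw [← sq_abs]; gcongr
      _ = (c * V) ^ 2 * (T ^ 2) ^ 2 := by ring
      _ ≤ (c * V) ^ 2 * (N ^ 2 * nsq v ^ 2) := by gcongr
      _ = (c * V) ^ 2 * N ^ 2 * nsq v ^ 2 := by ring
      _ ≤ _ := by
        unfold expFormConst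
        have : ∀ x y z : ℝ, 0 ≤ x → 0 ≤ y → z ≤ x + y + z := fun x y z hy hz => by linarith
        exact mul_le_mul_of_nonneg_right (this _ _ _ (by positivity) (by positivity)) (sq_nonneg _)

end ExpForm

/-! ### The nonlinear term as an integral of exponentials -/

section Nonlinear

variable {n N : ℕ} {A a b d κ M : ℝ} {K : Pt n → ℝ → ℝ → ℝ} {μs : Pt n → ℝ}

/-- The domain of the phase function. -/
def phaseDomain (n : ℕ) (A a b d : ℝ) : Set (Pt n × ℝ × ℝ) :=
  closedPrism n A a b ×ˢ Icc (-d) d ×ˢ Icc (-d) d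

/-- The square `[-d, d]²`. -/
def sqDom (d : ℝ) : Set (ℝ × ℝ) := Icc (-d) d ×ˢ Icc (-d) d

lemma isCompact_sqDom (d : ℝ) : IsCompact (sqDom d) := isCompact_Icc.prod isCompact_Icc

lemma measurableSet_sqDom (d : ℝ) : MeasurableSet (sqDom d) :=
  measurableSet_Icc.prod measurableSet_Icc

/-- K is smooth only on a closed set, so its derivative is taken within that set; unique
differentiability, inherited from nondegenerate intervals, makes this derivative continuous up to
the boundary. -/
lemma uniqueDiffOn_phaseDomain (hA : 0 < A) (hab : a < b) (hd : 0 < d) :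
    UniqueDiffOn ℝ (phaseDomain n A a b d) := by
  have h : closedPrism n A a b = (univ.pi fun _ : Fin n => Icc (-A) A) ×ˢ Icc a b := by
    ext x; simp only [closedPrism, mem_ofPred_eq, mem_prod, mem_univ_pi, mem_Icc]
  rw [phaseDomain, h]
  have h1 : UniqueDiffOn ℝ (Icc (-d) d) := uniqueDiffOn_Icc (by linarith)
  exact ((UniqueDiffOn.univ_pi fun _ => uniqueDiffOn_Icc (by linarith)).prod
    (uniqueDiffOn_Icc hab)).prod (h1.prod h1)

/-- The derivative of the phase function with respect to `α`. -/
noncomputable def phaseDeriv (A a b d : ℝ) {n : ℕ} (K : Pt n → ℝ → ℝ → ℝ) (q : Pt n × ℝ × ℝ) : ℝ :=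
  fderivWithin ℝ (fun q : Pt n × ℝ × ℝ => K q.1 q.2.1 q.2.2) (phaseDomain n A a b d) q (0, 1, 0)

lemma IsPhaseFunction.continuousOn (hK : IsPhaseFunction A a b d κ K) :
    ContinuousOn (fun q : Pt n × ℝ × ℝ => K q.1 q.2.1 q.2.2) (phaseDomain n A a b d) :=
  hK.smooth.continuousOn

lemma IsPhaseFunction.continuousOn_deriv (hK : IsPhaseFunction A a b d κ K) (hA : 0 < A)
    (hab : a < b) (hd : 0 < d) :
    ContinuousOn (phaseDeriv A a b d K) (phaseDomain n A a b d) :=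
  (hK.smooth.continuousOn_fderivWithin (uniqueDiffOn_phaseDomain hA hab hd)
    (by norm_num)).clm_apply continuousOn_const

lemma IsPhaseFunction.abs_deriv_le (hK : IsPhaseFunction A a b d κ K) {q : Pt n × ℝ × ℝ}
    (hq : q ∈ phaseDomain n A a b d) : |phaseDeriv A a b d K q| ≤ κ := by
  have h := (fderivWithin ℝ (fun q : Pt n × ℝ × ℝ => K q.1 q.2.1 q.2.2)
    (phaseDomain n A a b d) q).le_of_opNorm_le (hK.bound_fderiv q hq) (0, 1, 0)
  have h1 : ‖((0, 1, 0) : Pt n × ℝ × ℝ)‖ = 1 := by simp [Prod.norm_def]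
  rwa [h1, mul_one] at h

/-- For α in the open interval, [-d, d] is a neighbourhood of α, so the derivative within the domain
along the α-segment is an ordinary one, even when x or β lies on the boundary. -/
lemma IsPhaseFunction.hasDerivAt (hK : IsPhaseFunction A a b d κ K) {x : Pt n}
    (hx : x ∈ closedPrism n A a b) {α β : ℝ} (hα : α ∈ Ioo (-d) d) (hβ : β ∈ Icc (-d) d) :
    HasDerivAt (fun α => K x α β) (phaseDeriv A a b d K (x, α, β)) α := by
  have h1 : HasFDerivWithinAt (fun q : Pt n × ℝ × ℝ => K q.1 q.2.1 q.2.2)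
      (fderivWithin ℝ (fun q : Pt n × ℝ × ℝ => K q.1 q.2.1 q.2.2) (phaseDomain n A a b d)
        (x, α, β)) (phaseDomain n A a b d) (x, α, β) :=
    ((hK.smooth.differentiableOn (by norm_num)) (x, α, β)
      ⟨hx, Ioo_subset_Icc_self hα, hβ⟩).hasFDerivWithinAt
  have h2 : HasDerivWithinAt (fun α : ℝ => ((x, α, β) : Pt n × ℝ × ℝ)) (0, 1, 0)
      (Icc (-d) d) α :=
    ((hasDerivAt_const α x).prodMk ((hasDerivAt_id α).prodMk
      (hasDerivAt_const α β))).hasDerivWithinAt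
  have h3 : MapsTo (fun α : ℝ => ((x, α, β) : Pt n × ℝ × ℝ)) (Icc (-d) d)
      (phaseDomain n A a b d) := fun α' hα' => ⟨hx, hα', hβ⟩
  exact (h1.comp_hasDerivWithinAt α h2 h3).hasDerivAt
    (Icc_mem_nhds hα.1 hα.2)

lemma hasDerivAt_fourierSum (hd : 0 < d) (w : Fin N → ℝ) (α : ℝ) :
    HasDerivAt (fourierSum d w) (∑ s, w s * deriv (psi d s) α) α := by
  unfold fourierSum
  exact HasDerivAt.fun_sum fun s _ => (psi_differentiable hd s α).hasDerivAt.const_mul (w s)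

lemma continuous_fourierSum (hd : 0 < d) (w : Fin N → ℝ) : Continuous (fourierSum d w) := by
  unfold fourierSum
  have := psi_continuous hd
  fun_prop

lemma IsPhaseFunction.continuousOn_slice (hK : IsPhaseFunction A a b d κ K) {x : Pt n}
    (hx : x ∈ closedPrism n A a b) {α : ℝ} (hα : α ∈ Icc (-d) d) :
    ContinuousOn (fun β => K x α β) (Icc (-d) d) :=
  hK.continuousOn.comp (f := fun β : ℝ => ((x, α, β) : Pt n × ℝ × ℝ))
    (Continuous.continuousOn (by fun_prop)) fun _ hβ => ⟨hx, hα, hβ⟩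

lemma IsPhaseFunction.continuousOn_deriv_slice (hK : IsPhaseFunction A a b d κ K) (hA : 0 < A)
    (hab : a < b) (hd : 0 < d) {x : Pt n} (hx : x ∈ closedPrism n A a b) {α : ℝ}
    (hα : α ∈ Icc (-d) d) :
    ContinuousOn (fun β => phaseDeriv A a b d K (x, α, β)) (Icc (-d) d) :=
  (hK.continuousOn_deriv hA hab hd).comp (f := fun β : ℝ => ((x, α, β) : Pt n × ℝ × ℝ))
    (Continuous.continuousOn (by fun_prop)) fun _ hβ => ⟨hx, hα, hβ⟩

/-- Differentiation under the integral sign, dominated by κ e^{w(β)}. -/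
lemma hasDerivAt_scattering (hK : IsPhaseFunction A a b d κ K) (hA : 0 < A) (hab : a < b)
    (hd : 0 < d) (w : Fin N → ℝ) {x : Pt n} (hx : x ∈ closedPrism n A a b) {α : ℝ}
    (hα : α ∈ Ioo (-d) d) :
    HasDerivAt (fun α => ∫ β in (-d)..d, K x α β * Real.exp (fourierSum d w β))
      (∫ β in (-d)..d, phaseDeriv A a b d K (x, α, β) * Real.exp (fourierSum d w β)) α := by
  have hc : Continuous fun β => Real.exp (fourierSum d w β) :=
    Real.continuous_exp.comp (continuous_fourierSum hd w)
  have hI : Ioc (-d) d ⊆ Icc (-d) d := Ioc_subset_Icc_self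
  have hu : uIoc (-d) d = Ioc (-d) d := uIoc_of_le (by linarith)
  have hui : uIcc (-d) d = Icc (-d) d := uIcc_of_le (by linarith)
  refine (intervalIntegral.hasDerivAt_integral_of_dominated_loc_of_deriv_le
    (F := fun α β => K x α β * Real.exp (fourierSum d w β))
    (F' := fun α β => phaseDeriv A a b d K (x, α, β) * Real.exp (fourierSum d w β))
    (bound := fun β => κ * Real.exp (fourierSum d w β)) (Ioo_mem_nhds hα.1 hα.2)
    ?_ ?_ ?_ ?_ ?_ ?_).2
  · filter_upwards [Ioo_mem_nhds hα.1 hα.2] with α' hα'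
    rw [hu]
    exact ((hK.continuousOn_slice hx (Ioo_subset_Icc_self hα')).mul hc.continuousOn).mono hI
      |>.aestronglyMeasurable measurableSet_Ioc
  · refine ContinuousOn.intervalIntegrable ?_
    rw [hui]
    exact (hK.continuousOn_slice hx (Ioo_subset_Icc_self hα)).mul hc.continuousOn
  · rw [hu]
    exact ((hK.continuousOn_deriv_slice hA hab hd hx (Ioo_subset_Icc_self hα)).mul
      hc.continuousOn).mono hI |>.aestronglyMeasurable measurableSet_Ioc
  · refine Filter.Eventually.of_forall fun β hβ α' hα' => ?_
    rw [hu] at hβ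
    rw [norm_mul, Real.norm_eq_abs, Real.norm_eq_abs, Real.abs_exp]
    exact mul_le_mul_of_nonneg_right (hK.abs_deriv_le ⟨hx, Ioo_subset_Icc_self hα', hI hβ⟩)
      (Real.exp_pos _).le
  · exact (continuous_const.mul hc).intervalIntegrable _ _
  · refine Filter.Eventually.of_forall fun β hβ α' hα' => ?_
    rw [hu] at hβ
    exact (hK.hasDerivAt hx hα' (hI hβ)).mul_const _

/-- The factor `-(μ_s / ν_{n+1}) Ψ_k`. -/
noncomputable def scatFactor (d : ℝ) {n : ℕ} (μs : Pt n → ℝ) (k : ℕ) (x : Pt n) (α : ℝ) : ℝ :=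
  -(μs x / nuY x α * psi d k α)

/-- The coefficient of order zero in the integral representation of the nonlinear term. -/
noncomputable def nlG₀ (A a b d : ℝ) {n : ℕ} (K : Pt n → ℝ → ℝ → ℝ) (μs : Pt n → ℝ) (k : ℕ)
    (q : Pt n × ℝ × ℝ) : ℝ := scatFactor d μs k q.1 q.2.1 * phaseDeriv A a b d K q

/-- The coefficients of order one in the integral representation of the nonlinear term. -/
noncomputable def nlG (d : ℝ) {n : ℕ} (K : Pt n → ℝ → ℝ → ℝ) (μs : Pt n → ℝ) (k s : ℕ)
    (q : Pt n × ℝ × ℝ) : ℝ :=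
  -(scatFactor d μs k q.1 q.2.1 * deriv (psi d s) q.2.1 * K q.1 q.2.1 q.2.2)

/-- The exponents in the integral representation of the nonlinear term. -/
noncomputable def nlE (d : ℝ) {n : ℕ} (s : ℕ) (q : Pt n × ℝ × ℝ) : ℝ := psi d s q.2.2 - psi d s q.2.1

lemma continuousOn_scatFactor (hμ : IsScatteringCoeff A a b M μs) (ha : 0 < a) (hd : 0 < d)
    (k : ℕ) : ContinuousOn (fun q : Pt n × ℝ × ℝ => scatFactor d μs k q.1 q.2.1)
      (phaseDomain n A a b d) := by
  have h1 := hμ.smooth.continuous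
  have h2 := psi_continuous hd k
  have h3 : Continuous fun q : Pt n × ℝ × ℝ => srcDist q.1 q.2.1 :=
    continuous_srcDist.comp (by fun_prop : Continuous fun q : Pt n × ℝ × ℝ => (q.1, q.2.1))
  have h4 : ContinuousOn (fun q : Pt n × ℝ × ℝ => nuY q.1 q.2.1) (phaseDomain n A a b d) :=
    ContinuousOn.div (Continuous.continuousOn (by fun_prop)) h3.continuousOn
      fun q hq => (srcDist_pos (ha.trans_le hq.1.2.1) _).ne'
  unfold scatFactor
  refine ((ContinuousOn.div (Continuous.continuousOn (by fun_prop)) h4 fun q hq => ?_).mul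
    (Continuous.continuousOn (by fun_prop))).neg
  have h5 := ha.trans_le hq.1.2.1
  exact (div_pos h5 (srcDist_pos h5 _)).ne'

lemma continuousOn_nlG₀ (hK : IsPhaseFunction A a b d κ K) (hμ : IsScatteringCoeff A a b M μs)
    (hA : 0 < A) (ha : 0 < a) (hab : a < b) (hd : 0 < d) (k : ℕ) :
    ContinuousOn (nlG₀ A a b d K μs k) (phaseDomain n A a b d) :=
  (continuousOn_scatFactor hμ ha hd k).mul (hK.continuousOn_deriv hA hab hd)

lemma continuousOn_nlG (hK : IsPhaseFunction A a b d κ K) (hμ : IsScatteringCoeff A a b M μs)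
    (ha : 0 < a) (hd : 0 < d) (k s : ℕ) :
    ContinuousOn (nlG d K μs k s) (phaseDomain n A a b d) :=
  (((continuousOn_scatFactor hμ ha hd k).mul ((psi_deriv_continuous hd s).comp
    (by fun_prop : Continuous fun q : Pt n × ℝ × ℝ => q.2.1)).continuousOn).mul
      hK.continuousOn).neg

lemma continuous_nlE (hd : 0 < d) (s : ℕ) : Continuous (nlE d (n := n) s) := by
  have := psi_continuous hd s
  unfold nlE
  fun_prop

/-- The directional derivative of `vecF` with respect to `w`. -/
noncomputable def vecF' (A a b d : ℝ) {n N : ℕ} (K : Pt n → ℝ → ℝ → ℝ) (μs : Pt n → ℝ) (w v : Fin N → ℝ)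
    (x : Pt n) : Fin N → ℝ := fun k =>
  ∫ z in sqDom d, expFormDeriv (fun z => nlG₀ A a b d K μs k (x, z))
    (fun s z => nlG d K μs k s (x, z)) (fun s z => nlE d s (x, z)) w v z

/-- The product rule turns the differentiated bracket into the integral over β of (∂_αK - w'(α) K)
e^{w(β) - w(α)}: affine in w times the exponential of a linear form. This form makes the expansion
in w a pointwise matter. -/
lemma vecF_eq (hK : IsPhaseFunction A a b d κ K) (hμ : IsScatteringCoeff A a b M μs)
    (hA : 0 < A) (ha : 0 < a) (hab : a < b) (hd : 0 < d) (w : Fin N → ℝ) {x : Pt n}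
    (hx : x ∈ closedPrism n A a b) (k : Fin N) :
    vecF d K μs w x k = ∫ z in sqDom d, expForm (fun z => nlG₀ A a b d K μs k (x, z))
      (fun s z => nlG d K μs k s (x, z)) (fun s z => nlE d s (x, z)) w z := by
  have hsub : MapsTo (fun z : ℝ × ℝ => (x, z)) (sqDom d) (phaseDomain n A a b d) :=
    fun z hz => ⟨hx, hz⟩
  have hcz : ContinuousOn (fun z : ℝ × ℝ => (x, z)) (sqDom d) :=
    Continuous.continuousOn (by fun_prop)
  have hint : IntegrableOn (expForm (fun z => nlG₀ A a b d K μs k (x, z))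
      (fun s z => nlG d K μs k s (x, z)) (fun s z => nlE d s (x, z)) w) (sqDom d) volume :=
    integrableOn_expForm (isCompact_sqDom d)
    ((continuousOn_nlG₀ hK hμ hA ha hab hd k).comp hcz hsub)
    (fun s : Fin N => (continuousOn_nlG hK hμ ha hd k s).comp hcz hsub)
    (fun s : Fin N => (continuous_nlE (n := n) hd s).continuousOn.comp hcz
      (mapsTo_univ _ _)) w
  rw [sqDom, Measure.volume_eq_prod] at hint ⊢
  -- The integral over α is moved to the open interval: at the null set α = ±d the ordinary
  -- derivative in F need not agree with the derivative within the domain.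
  rw [setIntegral_prod _ hint, vecF, intervalIntegral.integral_of_le (by linarith),
    ← integral_neg, integral_Icc_eq_integral_Ioo, integral_Ioc_eq_integral_Ioo]
  refine setIntegral_congr_fun measurableSet_Ioo fun α hα => ?_
  have hder : deriv (fun α' => Real.exp (-fourierSum d w α') *
      ∫ β in (-d)..d, K x α' β * Real.exp (fourierSum d w β)) α =
      ∫ β in (-d)..d, (phaseDeriv A a b d K (x, α, β) -
        (∑ s, w s * deriv (psi d s) α) * K x α β) *
          Real.exp (fourierSum d w β - fourierSum d w α) := by
    have h := ((hasDerivAt_fourierSum hd w α).neg.exp.mul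
      (hasDerivAt_scattering hK hA hab hd w hx hα)).deriv
    have hα' := Ioo_subset_Icc_self hα
    have hc : Continuous fun β => Real.exp (fourierSum d w β) :=
      Real.continuous_exp.comp (continuous_fourierSum hd w)
    have hui : uIcc (-d) d = Icc (-d) d := uIcc_of_le (by linarith)
    have hi1 : IntervalIntegrable (fun β => K x α β * Real.exp (fourierSum d w β)) volume
        (-d) d := by
      refine ContinuousOn.intervalIntegrable ?_
      rw [hui]; exact (hK.continuousOn_slice hx hα').mul hc.continuousOn
    have hi2 : IntervalIntegrable (fun β => phaseDeriv A a b d K (x, α, β) *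
        Real.exp (fourierSum d w β)) volume (-d) d := by
      refine ContinuousOn.intervalIntegrable ?_
      rw [hui]; exact (hK.continuousOn_deriv_slice hA hab hd hx hα').mul hc.continuousOn
    refine h.trans ?_
    rw [← intervalIntegral.integral_const_mul, ← intervalIntegral.integral_const_mul,
      ← intervalIntegral.integral_add (hi1.const_mul _) (hi2.const_mul _)]
    refine intervalIntegral.integral_congr fun β _ => ?_
    simp only [Pi.neg_apply, sub_eq_add_neg, Real.exp_add]
    ring
  simp only [hder]
  rw [intervalIntegral.integral_of_le (by linarith), ← integral_Icc_eq_integral_Ioc,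
    show ∀ p q r : ℝ, -(p * q * r) = -(p * r) * q by intros; ring, ← integral_const_mul]
  refine setIntegral_congr_fun measurableSet_Icc fun β _ => ?_
  simp only [expForm, nlG₀, nlG, nlE, scatFactor, fourierSum]
  have h1 : ∀ t : ℝ, ∑ s : Fin N, w s * -(-(t * psi d k α) * deriv (psi d s) α * K x α β) =
      t * psi d k α * (K x α β * ∑ s : Fin N, w s * deriv (psi d s) α) := by
    intro t
    simp only [Finset.mul_sum]
    exact Finset.sum_congr rfl fun s _ => by ring
  have h2 : ∑ s : Fin N, w s * (psi d s β - psi d s α) =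
      ∑ s : Fin N, w s * psi d s β - ∑ s : Fin N, w s * psi d s α := by
    simp only [mul_sub, Finset.sum_sub_distrib]
  rw [h1, h2]
  ring

lemma mapsTo_sqDom {x : Pt n} (hx : x ∈ closedPrism n A a b) :
    MapsTo (fun z : ℝ × ℝ => (x, z)) (sqDom d) (phaseDomain n A a b d) := fun _ hz => ⟨hx, hz⟩

lemma vecF'_add (hK : IsPhaseFunction A a b d κ K) (hμ : IsScatteringCoeff A a b M μs)
    (hA : 0 < A) (ha : 0 < a) (hab : a < b) (hd : 0 < d) (w u v : Fin N → ℝ) {x : Pt n}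
    (hx : x ∈ closedPrism n A a b) :
    vecF' A a b d K μs w (u + v) x = vecF' A a b d K μs w u x + vecF' A a b d K μs w v x := by
  have hcz : ContinuousOn (fun z : ℝ × ℝ => (x, z)) (sqDom d) :=
    Continuous.continuousOn (by fun_prop)
  ext k
  have hint : ∀ v : Fin N → ℝ, IntegrableOn (expFormDeriv (fun z => nlG₀ A a b d K μs k (x, z))
      (fun s z => nlG d K μs k s (x, z)) (fun s z => nlE d s (x, z)) w v) (sqDom d) volume :=
    fun v => integrableOn_expFormDeriv (isCompact_sqDom d)
    ((continuousOn_nlG₀ hK hμ hA ha hab hd k).comp hcz (mapsTo_sqDom hx))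
    (fun s : Fin N => (continuousOn_nlG hK hμ ha hd k s).comp hcz (mapsTo_sqDom hx))
    (fun s : Fin N => (continuous_nlE (n := n) hd s).continuousOn.comp hcz
      (mapsTo_univ _ _)) w v
  simp only [vecF', Pi.add_apply, expFormDeriv_add]
  exact integral_add (hint u) (hint v)

lemma vecF'_smul (t : ℝ) (w v : Fin N → ℝ) (x : Pt n) :
    vecF' A a b d K μs w (t • v) x = t • vecF' A a b d K μs w v x := by
  ext k
  simp only [vecF', Pi.smul_apply, expFormDeriv_smul, integral_const_mul, smul_eq_mul]

lemma srcDist_le (hd : 0 < d) (ha : 0 < a) {x : Pt n} (hx : x ∈ closedPrism n A a b) {α : ℝ}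
    (hα : α ∈ Icc (-d) d) : srcDist x α ≤ Real.sqrt (n * (A + d) ^ 2 + b ^ 2) := by
  refine Real.sqrt_le_sqrt (add_le_add ?_ ?_)
  · calc ∑ i, relX x α i ^ 2 ≤ ∑ _i : Fin n, (A + d) ^ 2 := Finset.sum_le_sum fun i _ => by
          rw [← sq_abs]
          exact pow_le_pow_left₀ (abs_nonneg _) (abs_relX_le hx hα hd i) 2
      _ = _ := by simp
  · exact pow_le_pow_left₀ (ha.le.trans hx.2.1) hx.2.2 2

/-- The nonlinear term and its derivative are bounded, and the remainder of the first order
Taylor expansion is quadratic, uniformly in the coefficients. -/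
lemma exists_vecF_bounds (hA : 0 < A) (ha : 1 ≤ a) (hab : a < b) (hd : 0 < d) (n N : ℕ)
    (κ M : ℝ) {ρ : ℝ} (hρ : 0 ≤ ρ) : ∃ C : ℝ, 0 ≤ C ∧
    ∀ (K : Pt n → ℝ → ℝ → ℝ) (μs : Pt n → ℝ), IsPhaseFunction A a b d κ K →
      IsScatteringCoeff A a b M μs → ∀ x ∈ closedPrism n A a b, ∀ w v : Fin N → ℝ,
      (∀ s, |w s| ≤ ρ) → (∀ s, |v s| ≤ ρ) →
      nsq (vecF d K μs w x) ≤ C ∧ nsq (vecF' A a b d K μs w v x) ≤ C * nsq v ∧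
      nsq (vecF d K μs (w + v) x - vecF d K μs w x - vecF' A a b d K μs w v x) ≤
        C * nsq v ^ 2 := by
  obtain ⟨C, hC0, hC⟩ := exists_bound_psi hd N
  set D := Real.sqrt (n * (A + d) ^ 2 + b ^ 2) with hD
  have hD0 : 0 ≤ D := Real.sqrt_nonneg _
  -- |μ_s/ν_{n+1}| = |μ_s| |x - x_α|/y ≤ |M| D because y ≥ 1. The sum B then dominates the zero
  -- order coefficient, the first order coefficients and the exponents at once; |M| and |κ| appear
  -- because M and κ carry no sign condition.
  set SB := |M| * D * C with hSB
  set B := SB * |κ| + SB * C * |κ| + 2 * C with hB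
  have hB0 : 0 ≤ B := by positivity
  set C₁ := expFormConst N B ρ ((volume : Measure (ℝ × ℝ)).real (sqDom d)) with hC₁
  have hC₁0 : 0 ≤ C₁ := by rw [hC₁, expFormConst]; positivity
  refine ⟨N * C₁, by positivity, fun K μs hK hμ x hx w v hw hv => ?_⟩
  have ha0 : 0 < a := by linarith
  have hx2 : 1 ≤ x.2 := ha.trans hx.2.1
  have hcz : ContinuousOn (fun z : ℝ × ℝ => (x, z)) (sqDom d) :=
    Continuous.continuousOn (by fun_prop)
  have hSF : ∀ k : Fin N, ∀ α ∈ Icc (-d) d, |scatFactor d μs k x α| ≤ SB := by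
    intro k α hα
    have h1 : 0 < srcDist x α := srcDist_pos (by linarith) α
    have h2 : μs x / nuY x α = μs x * (srcDist x α / x.2) := by
      rw [nuY]; field_simp
    have h3 : |μs x| ≤ |M| := by
      rw [abs_of_nonneg (hμ.nonneg x)]; exact (hμ.bound x).trans (le_abs_self M)
    have h4 : |srcDist x α / x.2| ≤ D := by
      rw [abs_of_pos (by positivity)]
      exact (div_le_self h1.le hx2).trans (srcDist_le hd ha0 hx hα)
    rw [scatFactor, abs_neg, h2, abs_mul, abs_mul, hSB]
    exact mul_le_mul (mul_le_mul h3 h4 (abs_nonneg _) (abs_nonneg _)) (hC k α hα).1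
      (abs_nonneg _) (by positivity)
  have hbounds : ∀ k : Fin N, _ := fun k : Fin N =>
    integral_expForm_bounds (σ := (volume : Measure (ℝ × ℝ))) (w := w) (v := v) (B := B) (ρ := ρ)
      (g₀ := fun z => nlG₀ A a b d K μs k (x, z)) (g := fun s z => nlG d K μs k s (x, z))
      (e := fun s z => nlE d s (x, z)) (isCompact_sqDom d)
      ((continuousOn_nlG₀ hK hμ hA ha0 hab hd k).comp hcz (mapsTo_sqDom hx))
      (fun s : Fin N => (continuousOn_nlG hK hμ ha0 hd k s).comp hcz (mapsTo_sqDom hx))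
      (fun s : Fin N => (continuous_nlE (n := n) hd s).continuousOn.comp hcz (mapsTo_univ _ _))
      hB0 hρ
      (fun z hz => by
        have h : |nlG₀ A a b d K μs k (x, z)| ≤ SB * |κ| := by
          rw [nlG₀, abs_mul]
          exact mul_le_mul (hSF k _ hz.1)
            ((hK.abs_deriv_le (mapsTo_sqDom hx hz)).trans (le_abs_self κ)) (abs_nonneg _)
            (by positivity)
        have : 0 ≤ SB * C * |κ| + 2 * C := by positivity
        linarith)
      (fun s z hz => by
        have h : |nlG d K μs k s (x, z)| ≤ SB * C * |κ| := by
          rw [nlG, abs_neg, abs_mul, abs_mul]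
          exact mul_le_mul (mul_le_mul (hSF k _ hz.1) (hC s _ hz.1).2 (abs_nonneg _)
            (by positivity)) ((hK.bound _ (mapsTo_sqDom hx hz)).trans (le_abs_self κ))
            (abs_nonneg _) (by positivity)
        have : 0 ≤ SB * |κ| + 2 * C := by positivity
        linarith)
      (fun s z hz => by
        have h : |nlE d s (x, z)| ≤ C + C :=
          (abs_sub _ _).trans (add_le_add (hC s _ hz.2).1 (hC s _ hz.1).1)
        have : 0 ≤ SB * |κ| + SB * C * |κ| := by positivity
        linarith)
      hw hv
  have hsum : ∀ (u : Fin N → ℝ) (r : ℝ), (∀ k, u k ^ 2 ≤ r) → nsq u ≤ N * r := fun u r h => by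
    simpa [nsq] using Finset.sum_le_sum (s := Finset.univ) fun k _ => h k
  refine ⟨hsum _ _ fun k => ?_, ?_, ?_⟩
  · rw [vecF_eq hK hμ hA ha0 hab hd w hx]
    exact (hbounds k).1
  · rw [mul_assoc]
    exact hsum _ _ fun k => (hbounds k).2.1
  · rw [mul_assoc]
    refine hsum _ _ fun k => ?_
    simp only [Pi.sub_apply]
    rw [vecF_eq hK hμ hA ha0 hab hd w hx, vecF_eq hK hμ hA ha0 hab hd (w + v) hx]
    exact (hbounds k).2.2

lemma continuousOn_pair (p : Fin n → ℝ) :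
    ContinuousOn (fun q : ℝ × ℝ × ℝ => (((p, q.1), q.2) : Pt n × ℝ × ℝ)) (Ioo a b ×ˢ sqDom d) :=
  Continuous.continuousOn (by fun_prop)

lemma aestronglyMeasurable_vecF (hK : IsPhaseFunction A a b d κ K)
    (hμ : IsScatteringCoeff A a b M μs) (hA : 0 < A) (ha : 0 < a) (hab : a < b) (hd : 0 < d)
    {p : Fin n → ℝ} (hp : ∀ y ∈ Ioo a b, (p, y) ∈ closedPrism n A a b) {W : ℝ → Fin N → ℝ}
    (hW : ∀ s, ContinuousOn (fun y => W y s) (Ioo a b)) (k : Fin N) :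
    AEStronglyMeasurable (fun y => vecF d K μs (W y) (p, y) k) (volume.restrict (Ioo a b)) := by
  have hmaps : MapsTo (fun q : ℝ × ℝ × ℝ => (((p, q.1), q.2) : Pt n × ℝ × ℝ))
      (Ioo a b ×ˢ sqDom d) (phaseDomain n A a b d) := fun q hq => ⟨hp _ hq.1, hq.2⟩
  have h := aestronglyMeasurable_parametric (ρ := (volume : Measure (ℝ × ℝ))) (a := a) (b := b)
    (measurableSet_sqDom d)
    (f := fun y z => expForm (fun z => nlG₀ A a b d K μs k ((p, y), z))
      (fun s z => nlG d K μs k s ((p, y), z)) (fun s z => nlE d s ((p, y), z)) (W y) z)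
    (continuousOn_expForm (w := fun q : ℝ × ℝ × ℝ => W q.1)
      (g₀ := fun q : ℝ × ℝ × ℝ => nlG₀ A a b d K μs k ((p, q.1), q.2))
      (g := fun s (q : ℝ × ℝ × ℝ) => nlG d K μs k s ((p, q.1), q.2))
      (e := fun s (q : ℝ × ℝ × ℝ) => nlE d s ((p, q.1), q.2))
      ((continuousOn_nlG₀ hK hμ hA ha hab hd k).comp (continuousOn_pair p) hmaps)
      (fun s => (continuousOn_nlG hK hμ ha hd k s).comp (continuousOn_pair p) hmaps)
      (fun s => (continuous_nlE hd s).continuousOn.comp (continuousOn_pair p) (mapsTo_univ _ _))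
      (fun s => (hW s).comp continuous_fst.continuousOn fun q hq => hq.1))
  refine h.congr ?_
  filter_upwards [ae_restrict_mem measurableSet_Ioo] with y hy
  rw [vecF_eq hK hμ hA ha hab hd (W y) (hp y hy)]

lemma aestronglyMeasurable_vecF' (hK : IsPhaseFunction A a b d κ K)
    (hμ : IsScatteringCoeff A a b M μs) (hA : 0 < A) (ha : 0 < a) (hab : a < b) (hd : 0 < d)
    {p : Fin n → ℝ} (hp : ∀ y ∈ Ioo a b, (p, y) ∈ closedPrism n A a b) {W V : ℝ → Fin N → ℝ}
    (hW : ∀ s, ContinuousOn (fun y => W y s) (Ioo a b))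
    (hV : ∀ s, ContinuousOn (fun y => V y s) (Ioo a b)) (k : Fin N) :
    AEStronglyMeasurable (fun y => vecF' A a b d K μs (W y) (V y) (p, y) k)
      (volume.restrict (Ioo a b)) := by
  have hmaps : MapsTo (fun q : ℝ × ℝ × ℝ => (((p, q.1), q.2) : Pt n × ℝ × ℝ))
      (Ioo a b ×ˢ sqDom d) (phaseDomain n A a b d) := fun q hq => ⟨hp _ hq.1, hq.2⟩
  exact aestronglyMeasurable_parametric (ρ := (volume : Measure (ℝ × ℝ))) (a := a) (b := b)
    (measurableSet_sqDom d)
    (f := fun y z => expFormDeriv (fun z => nlG₀ A a b d K μs k ((p, y), z))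
      (fun s z => nlG d K μs k s ((p, y), z)) (fun s z => nlE d s ((p, y), z)) (W y) (V y) z)
    (continuousOn_expFormDeriv (w := fun q : ℝ × ℝ × ℝ => W q.1) (v := fun q => V q.1)
      (g₀ := fun q : ℝ × ℝ × ℝ => nlG₀ A a b d K μs k ((p, q.1), q.2))
      (g := fun s (q : ℝ × ℝ × ℝ) => nlG d K μs k s ((p, q.1), q.2))
      (e := fun s (q : ℝ × ℝ × ℝ) => nlE d s ((p, q.1), q.2))
      ((continuousOn_nlG₀ hK hμ hA ha hab hd k).comp (continuousOn_pair p) hmaps)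
      (fun s => (continuousOn_nlG hK hμ ha hd k s).comp (continuousOn_pair p) hmaps)
      (fun s => (continuous_nlE hd s).continuousOn.comp (continuousOn_pair p) (mapsTo_univ _ _))
      (fun s => (hW s).comp continuous_fst.continuousOn fun q hq => hq.1)
      (fun s => (hV s).comp continuous_fst.continuousOn fun q hq => hq.1))

end Nonlinear

end RTE

/-! ### Sobolev and Carleman inequalities in the single variable y. -/

namespace RTE

/-! ### Absolutely continuous functions with square integrable derivative on an interval -/

section Interval

variable {a b lam : ℝ} {f g : ℝ → ℝ}

lemma intervalIntegral_eq_Ioo (hab : a ≤ b) (f : ℝ → ℝ) :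
    ∫ y in a..b, f y = ∫ y in Ioo a b, f y := by
  rw [intervalIntegral.integral_of_le hab, integral_Ioc_eq_integral_Ioo]

lemma intervalIntegrable_iff_Ioo (hab : a ≤ b) :
    IntervalIntegrable f volume a b ↔ IntegrableOn f (Ioo a b) := by
  rw [intervalIntegrable_iff_integrableOn_Ioc_of_le hab, integrableOn_Ioc_iff_integrableOn_Ioo]

/-- The Cauchy–Schwarz inequality against 1, obtained from the nonnegativity of the variance of g.
-/
lemma sq_integral_le (hab : a < b) (hg : MemLp g 2 (volume.restrict (Ioo a b))) :
    (∫ y in Ioo a b, g y) ^ 2 ≤ (b - a) * ∫ y in Ioo a b, g y ^ 2 := by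
  have hgi : Integrable g (volume.restrict (Ioo a b)) := hg.integrable (by norm_num)
  have hg2 := hg.integrable_sq
  set I := ∫ y in Ioo a b, g y
  have hba : 0 < b - a := by linarith
  have h1 : ∫ y in Ioo a b, (g y - I / (b - a)) ^ 2 =
      (∫ y in Ioo a b, g y ^ 2) - 2 * (I / (b - a)) * I + (b - a) * (I / (b - a)) ^ 2 := by
    have h2 : ∀ y, (g y - I / (b - a)) ^ 2 =
        (g y ^ 2 - 2 * (I / (b - a)) * g y) + (I / (b - a)) ^ 2 := fun y => by ring
    simp only [h2]
    have hi : Integrable (fun y => g y ^ 2 - 2 * (I / (b - a)) * g y)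
        (volume.restrict (Ioo a b)) := hg2.sub (hgi.const_mul _)
    rw [integral_add hi (integrable_const _),
      integral_sub hg2 (hgi.const_mul _), integral_const_mul]
    simp [max_eq_left hba.le, I]
  have h2 : 0 ≤ ∫ y in Ioo a b, (g y - I / (b - a)) ^ 2 := integral_nonneg fun _ => sq_nonneg _
  rw [h1] at h2
  have h3 : (∫ y in Ioo a b, g y ^ 2) - 2 * (I / (b - a)) * I + (b - a) * (I / (b - a)) ^ 2 =
      (∫ y in Ioo a b, g y ^ 2) - I ^ 2 / (b - a) := by
    field_simp; ring
  rw [h3, sub_nonneg, div_le_iff₀ hba] at h2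
  linarith

lemma ac_sub_eq (hf : AbsolutelyContinuousOnInterval f a b) {y z : ℝ}
    (hy : y ∈ Icc a b) (hz : z ∈ Icc a b) : f y - f z = ∫ t in z..y, deriv f t := by
  refine ((hf.mono ?_).integral_deriv_eq_sub).symm
  rw [uIcc_of_le (hy.1.trans hy.2)]
  exact (convex_Icc a b).ordConnected.uIcc_subset hz hy

lemma sq_sub_le (hab : a < b) (hf : AbsolutelyContinuousOnInterval f a b)
    (hf' : MemLp (deriv f) 2 (volume.restrict (Ioo a b))) {y z : ℝ} (hy : y ∈ Icc a b)
    (hz : z ∈ Icc a b) : (f y - f z) ^ 2 ≤ (b - a) * ∫ t in Ioo a b, deriv f t ^ 2 := by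
  have habs : MemLp (fun t => |deriv f t|) 2 (volume.restrict (Ioo a b)) := hf'.norm
  have hsq := sq_integral_le hab habs
  simp only [sq_abs] at hsq
  refine le_trans ?_ hsq
  rw [← sq_abs]
  refine pow_le_pow_left₀ (abs_nonneg _) ?_ 2
  rw [ac_sub_eq hf hy hz]
  have h1 := intervalIntegral.norm_integral_le_integral_norm_uIoc (f := deriv f) (a := z) (b := y)
    (μ := volume)
  refine h1.trans ?_
  have hsub : uIoc z y ⊆ Ioc a b := fun t ht => by
    have h2 := uIoc_subset_uIcc ht
    have h3 := (convex_Icc a b).ordConnected.uIcc_subset hz hy h2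
    refine ⟨lt_of_le_of_lt (le_min hz.1 hy.1) ht.1, h3.2⟩
  rw [← integral_Ioc_eq_integral_Ioo]
  refine setIntegral_mono_set ?_ (Filter.Eventually.of_forall fun _ => abs_nonneg _)
    hsub.eventuallyLE
  rw [integrableOn_Ioc_iff_integrableOn_Ioo]
  exact habs.integrable (by norm_num)

lemma sq_le_of_zero_left (hab : a < b) (hf : AbsolutelyContinuousOnInterval f a b)
    (hf' : MemLp (deriv f) 2 (volume.restrict (Ioo a b))) (h0 : f a = 0) {y : ℝ}
    (hy : y ∈ Icc a b) : f y ^ 2 ≤ (b - a) * ∫ t in Ioo a b, deriv f t ^ 2 := by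
  simpa [h0] using sq_sub_le hab hf hf' hy (left_mem_Icc.2 hab.le)

lemma ac_memLp (hab : a < b) (hf : AbsolutelyContinuousOnInterval f a b) :
    MemLp f 2 (volume.restrict (Ioo a b)) := by
  obtain ⟨C, hC⟩ := hf.exists_bound
  have hc := hf.continuousOn
  rw [uIcc_of_le hab.le] at hC hc
  refine MemLp.of_bound ((hc.mono Ioo_subset_Icc_self).aestronglyMeasurable measurableSet_Ioo) C ?_
  filter_upwards [ae_restrict_mem measurableSet_Ioo] with y hy
  exact hC y (Ioo_subset_Icc_self hy)

/-- The one-dimensional Sobolev inequality. -/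
lemma sq_le_sobolev (hab : a < b) (hf : AbsolutelyContinuousOnInterval f a b)
    (hf' : MemLp (deriv f) 2 (volume.restrict (Ioo a b))) {y : ℝ} (hy : y ∈ Icc a b) :
    f y ^ 2 ≤ 2 / (b - a) * (∫ t in Ioo a b, f t ^ 2) +
      2 * (b - a) * ∫ t in Ioo a b, deriv f t ^ 2 := by
  have hba : 0 < b - a := by linarith
  set D := ∫ t in Ioo a b, deriv f t ^ 2
  have hfi := (ac_memLp hab hf).integrable_sq
  -- The inequality f(y)² ≤ 2 f(z)² + 2 (f(y) - f(z))² is averaged over z.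
  have h1 : ∫ _z in Ioo a b, f y ^ 2 ≤ ∫ z in Ioo a b, (2 * f z ^ 2 + 2 * ((b - a) * D)) := by
    refine setIntegral_mono_on (integrable_const _) ((hfi.const_mul 2).add (integrable_const _))
      measurableSet_Ioo fun z hz => ?_
    have h2 := sq_sub_le hab hf hf' hy (Ioo_subset_Icc_self hz)
    nlinarith [sq_nonneg (f y - 2 * f z)]
  rw [integral_add (hfi.const_mul 2) (integrable_const _), integral_const_mul] at h1
  simp only [integral_const, MeasurableSet.univ, measureReal_restrict_apply, univ_inter,
    Real.volume_real_Ioo_of_le hab.le, smul_eq_mul] at h1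
  have h2 : f y ^ 2 ≤ (2 * (∫ t in Ioo a b, f t ^ 2) + (b - a) * (2 * ((b - a) * D))) / (b - a) := by
    rw [le_div_iff₀ hba]; linarith
  refine h2.trans (le_of_eq ?_)
  field_simp

lemma integrable_mul_exp (hg : IntegrableOn g (Ioo a b)) (lam : ℝ) :
    IntegrableOn (fun y => g y * Real.exp (2 * lam * y)) (Ioo a b) := by
  have hc : Continuous fun y : ℝ => Real.exp (2 * lam * y) := by fun_prop
  obtain ⟨C, hC⟩ := (isCompact_Icc (a := a) (b := b)).exists_bound_of_continuousOn hc.continuousOn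
  refine Integrable.mul_bdd (c := C) hg hc.aestronglyMeasurable ?_
  filter_upwards [ae_restrict_mem measurableSet_Ioo] with y hy
  exact hC y (Ioo_subset_Icc_self hy)

/-- The integrand is the almost everywhere derivative of the absolutely continuous function f²
e^{2λt}. The endpoint y = b yields the integral Carleman estimate, an arbitrary y the pointwise one.
-/
lemma ac_integral_sq_exp (hab : a < b) (hf : AbsolutelyContinuousOnInterval f a b)
    (lam : ℝ) {y : ℝ} (hy : y ∈ Icc a b) (h0 : f a = 0) :
    IntegrableOn (fun t => (2 * f t * deriv f t + 2 * lam * f t ^ 2) * Real.exp (2 * lam * t))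
      (Ioo a b) ∧
    ∫ t in Ioo a y, (2 * f t * deriv f t + 2 * lam * f t ^ 2) * Real.exp (2 * lam * t) =
      f y ^ 2 * Real.exp (2 * lam * y) := by
  have hexp : ∀ t, HasDerivAt (fun t => Real.exp (2 * lam * t))
      (2 * lam * Real.exp (2 * lam * t)) t := fun t => by
    simpa [mul_comm] using ((hasDerivAt_id t).const_mul (2 * lam)).exp
  have hae := hf.ae_differentiableAt
  have hd := hf.intervalIntegrable_deriv
  rw [intervalIntegrable_iff_Ioo hab.le] at hd
  obtain ⟨C, hC⟩ := hf.exists_bound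
  have hfc := hf.continuousOn
  rw [uIcc_of_le hab.le] at hC hfc hae
  constructor
  · refine integrable_mul_exp (Integrable.add ?_ ?_) lam
    · refine Integrable.bdd_mul (c := 2 * C) hd ?_ ?_
      · exact ((hfc.mono Ioo_subset_Icc_self).aestronglyMeasurable measurableSet_Ioo).const_mul 2
      · filter_upwards [ae_restrict_mem measurableSet_Ioo] with t ht
        rw [norm_mul, Real.norm_ofNat]
        exact mul_le_mul_of_nonneg_left (hC t (Ioo_subset_Icc_self ht)) (by norm_num)
    · exact (ac_memLp hab hf).integrable_sq.const_mul _
  · have hsub : uIcc a y ⊆ uIcc a b := by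
      rw [uIcc_of_le hab.le, uIcc_of_le hy.1]; exact Icc_subset_Icc_right hy.2
    have hf1 := hf.mono hsub
    have he1 : AbsolutelyContinuousOnInterval (fun t => Real.exp (2 * lam * t)) a y := by
      refine ContDiffOn.absolutelyContinuousOnInterval (ContDiff.contDiffOn ?_)
      fun_prop
    have h := (hf1.mul hf1).integral_deriv_mul_eq_sub he1
    simp only [Pi.mul_apply, h0, mul_zero, zero_mul, sub_zero] at h
    rw [sq, ← h, intervalIntegral_eq_Ioo hy.1]
    refine setIntegral_congr_ae measurableSet_Ioo ?_
    filter_upwards [hae] with t ht hty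
    have hdt := (ht ⟨hty.1.le, hty.2.le.trans hy.2⟩).hasDerivAt
    rw [(hdt.mul hdt).deriv, (hexp t).deriv]
    ring

/-- The Carleman estimate for the operator `d/dy` with the weight `e^{2λy}`. -/
lemma carleman (hab : a < b) (hf : AbsolutelyContinuousOnInterval f a b)
    (hf' : MemLp (deriv f) 2 (volume.restrict (Ioo a b))) (h0 : f a = 0) (h1 : f b = 0)
    (hlam : 0 < lam) :
    lam ^ 2 * (∫ t in Ioo a b, f t ^ 2 * Real.exp (2 * lam * t)) ≤
      ∫ t in Ioo a b, deriv f t ^ 2 * Real.exp (2 * lam * t) := by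
  obtain ⟨hi, h2⟩ := ac_integral_sq_exp hab hf lam (right_mem_Icc.2 hab.le) h0
  have hI1 := integrable_mul_exp (ac_memLp hab hf).integrable_sq lam
  have hI2 := integrable_mul_exp hf'.integrable_sq lam
  have h3 : ∫ t in Ioo a b, (lam * (f t ^ 2 * Real.exp (2 * lam * t)) -
      1 / lam * (deriv f t ^ 2 * Real.exp (2 * lam * t))) ≤ 0 := by
    have : ∫ t in Ioo a b, (2 * f t * deriv f t + 2 * lam * f t ^ 2) * Real.exp (2 * lam * t) = 0 := by
      rw [h2, h1]; simp
    rw [← this]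
    refine integral_mono ((hI1.const_mul _).sub (hI2.const_mul _)) hi fun t => ?_
    -- The difference of the two sides is the square (λf + f')²/λ, while the weighted integral of
    -- the right side vanishes by the boundary conditions.
    have h4 : lam * f t ^ 2 - 1 / lam * deriv f t ^ 2 ≤ 2 * f t * deriv f t + 2 * lam * f t ^ 2 := by
      have h5 : 0 ≤ (lam * f t + deriv f t) ^ 2 / lam := by positivity
      have h6 : (lam * f t + deriv f t) ^ 2 / lam =
        lam * f t ^ 2 + 2 * f t * deriv f t + 1 / lam * deriv f t ^ 2 := by field_simp; ring
      linarith
    have := mul_le_mul_of_nonneg_right h4 (Real.exp_pos (2 * lam * t)).le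
    simp only []
    linarith
  rw [integral_sub (hI1.const_mul _) (hI2.const_mul _), integral_const_mul, integral_const_mul,
    sub_nonpos] at h3
  have := mul_le_mul_of_nonneg_left h3 hlam.le
  calc _ = lam * (lam * ∫ t in Ioo a b, f t ^ 2 * Real.exp (2 * lam * t)) := by ring
    _ ≤ _ := this
    _ = _ := by field_simp

/-- f(y)² e^{2λy} is the integral of its own derivative from a to y, and that derivative is at most
(3λf² + f'²/λ) e^{2λt}; the integral estimate converts 3λ∫f² into (3/λ)∫f'². The gain 1/λ survives
in the supremum, so a factor multiplying f² need only be integrable. -/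
lemma carleman_sup (hab : a < b) (hf : AbsolutelyContinuousOnInterval f a b)
    (hf' : MemLp (deriv f) 2 (volume.restrict (Ioo a b))) (h0 : f a = 0) (h1 : f b = 0)
    (hlam : 0 < lam) {y : ℝ} (hy : y ∈ Icc a b) :
    f y ^ 2 * Real.exp (2 * lam * y) ≤
      4 / lam * ∫ t in Ioo a b, deriv f t ^ 2 * Real.exp (2 * lam * t) := by
  obtain ⟨hi, h2⟩ := ac_integral_sq_exp hab hf lam hy h0
  have hI1 := integrable_mul_exp (ac_memLp hab hf).integrable_sq lam
  have hI2 := integrable_mul_exp hf'.integrable_sq lam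
  have hsub : Ioo a y ⊆ Ioo a b := Ioo_subset_Ioo_right hy.2
  have hJ : IntegrableOn (fun t => 3 * lam * (f t ^ 2 * Real.exp (2 * lam * t)) +
      1 / lam * (deriv f t ^ 2 * Real.exp (2 * lam * t))) (Ioo a b) :=
    (hI1.const_mul _).add (hI2.const_mul _)
  have h3 : f y ^ 2 * Real.exp (2 * lam * y) ≤
      ∫ t in Ioo a b, (3 * lam * (f t ^ 2 * Real.exp (2 * lam * t)) +
        1 / lam * (deriv f t ^ 2 * Real.exp (2 * lam * t))) := by
    rw [← h2]
    refine (setIntegral_mono (hi.mono_set hsub) (hJ.mono_set hsub) fun t => ?_).trans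
      (setIntegral_mono_set hJ (Filter.Eventually.of_forall fun t => ?_) hsub.eventuallyLE)
    · have h4 : 2 * f t * deriv f t + 2 * lam * f t ^ 2 ≤
          3 * lam * f t ^ 2 + 1 / lam * deriv f t ^ 2 := by
        have h5 : 0 ≤ (lam * f t - deriv f t) ^ 2 / lam := by positivity
        have h6 : (lam * f t - deriv f t) ^ 2 / lam =
          lam * f t ^ 2 - 2 * f t * deriv f t + 1 / lam * deriv f t ^ 2 := by field_simp; ring
        linarith
      have := mul_le_mul_of_nonneg_right h4 (Real.exp_pos (2 * lam * t)).le
      simp only []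
      linarith
    · have := Real.exp_pos (2 * lam * t)
      simp only [Pi.zero_apply]
      positivity
  rw [integral_add (hI1.const_mul _) (hI2.const_mul _), integral_const_mul, integral_const_mul] at h3
  have h4 := carleman hab hf hf' h0 h1 hlam
  set X := ∫ t in Ioo a b, f t ^ 2 * Real.exp (2 * lam * t)
  set Y := ∫ t in Ioo a b, deriv f t ^ 2 * Real.exp (2 * lam * t)
  have h5 : 3 * lam * X ≤ 3 / lam * Y := by
    rw [div_mul_eq_mul_div, le_div_iff₀ hlam]; nlinarith
  calc _ ≤ _ := h3
    _ ≤ 3 / lam * Y + 1 / lam * Y := by linarith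
    _ = _ := by ring

end Interval

end RTE

/-! ### The semi-discrete Sobolev space and its zero-boundary subspace. -/

namespace RTE

/-! ### The space `H^{1,h}` -/

section Space

variable {n m N : ℕ} {A a b h₀ : ℝ} {Q Q' v : VecFun n m N} {j : Node n m}

lemma nsq_add_le_scaled (u v : Fin N → ℝ) {t : ℝ} (ht : 0 < t) :
    nsq (u + v) ≤ (1 + t) * nsq u + (1 + t⁻¹) * nsq v := by
  simp only [nsq, Finset.mul_sum, ← Finset.sum_add_distrib]
  refine Finset.sum_le_sum fun s _ => ?_
  have h1 : 0 ≤ (t * u s - v s) ^ 2 * t⁻¹ := by positivity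
  have h2 : (t * u s - v s) ^ 2 * t⁻¹ = t * u s ^ 2 - 2 * (u s * v s) + t⁻¹ * v s ^ 2 := by
    field_simp; ring
  simp only [Pi.add_apply]
  nlinarith

lemma nsq_smul (t : ℝ) (v : Fin N → ℝ) : nsq (t • v) = t ^ 2 * nsq v := by
  simp only [nsq, Pi.smul_apply, smul_eq_mul, mul_pow, Finset.mul_sum]

/-- The optimal parameter is t = y/x. Shifting x and y by s > 0 and letting s → 0 covers the cases
where one of them vanishes. This yields the triangle inequality for `normH1` from a termwise Young
inequality. -/
lemma le_add_sq_of_scaled {X x y : ℝ} (hx : 0 ≤ x) (hy : 0 ≤ y)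
    (h : ∀ t > 0, X ≤ (1 + t) * x ^ 2 + (1 + t⁻¹) * y ^ 2) : X ≤ (x + y) ^ 2 := by
  refine le_of_forall_pos_le_add fun ε hε => ?_
  have hlim : Filter.Tendsto (fun s : ℝ => (x + s + (y + s)) ^ 2) (nhdsWithin 0 (Ioi 0))
      (nhds ((x + 0 + (y + 0)) ^ 2)) := by
    refine (Continuous.tendsto ?_ 0).mono_left nhdsWithin_le_nhds
    fun_prop
  have hle : ∀ᶠ s in nhdsWithin (0 : ℝ) (Ioi 0), X ≤ (x + s + (y + s)) ^ 2 := by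
    filter_upwards [self_mem_nhdsWithin] with s (hs : 0 < s)
    have hxs : 0 < x + s := by linarith
    have hys : 0 < y + s := by linarith
    have h1 := h ((y + s) / (x + s)) (by positivity)
    have h2 : x ^ 2 ≤ (x + s) ^ 2 := by nlinarith
    have h3 : y ^ 2 ≤ (y + s) ^ 2 := by nlinarith
    calc X ≤ _ := h1
      _ ≤ (1 + (y + s) / (x + s)) * (x + s) ^ 2 + (1 + ((y + s) / (x + s))⁻¹) * (y + s) ^ 2 := by
        gcongr
      _ = _ := by field_simp; ring
  have := ge_of_tendsto hlim hle
  simp only [add_zero] at this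
  linarith

lemma mem_interiorNodes : j ∈ interiorNodes n m ↔ IsInterior j := by
  simp [interiorNodes]

lemma MemH1.ac (hQ : MemH1 A a b Q) (hj : IsInterior j) (s : Fin N) :
    AbsolutelyContinuousOnInterval (fun y => Q j y s) a b := (hQ j hj s).1

lemma MemH1.memLp_diffY (hQ : MemH1 A a b Q) (hj : IsInterior j) (s : Fin N) :
    MemLp (fun y => diffY Q j y s) 2 (volume.restrict (Ioo a b)) := (hQ j hj s).2.1

lemma MemH1.memLp_diffX (hQ : MemH1 A a b Q) (hj : IsInterior j) (i : Fin n) (s : Fin N) :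
    MemLp (fun y => diffX A i Q j y s) 2 (volume.restrict (Ioo a b)) := (hQ j hj s).2.2 i

lemma MemH1.memLp (hab : a < b) (hQ : MemH1 A a b Q) (hj : IsInterior j) (s : Fin N) :
    MemLp (fun y => Q j y s) 2 (volume.restrict (Ioo a b)) := ac_memLp hab (hQ.ac hj s)

lemma MemH1.continuousOn (hab : a < b) (hQ : MemH1 A a b Q) (hj : IsInterior j) (s : Fin N) :
    ContinuousOn (fun y => Q j y s) (Icc a b) := by
  simpa [uIcc_of_le hab.le] using (hQ.ac hj s).continuousOn

lemma diffX_add (i : Fin n) (j : Node n m) (y : ℝ) :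
    diffX A i (Q + Q') j y = diffX A i Q j y + diffX A i Q' j y := by
  ext s; simp only [diffX, Pi.add_apply]; ring

lemma diffX_smul (t : ℝ) (i : Fin n) (j : Node n m) (y : ℝ) :
    diffX A i (t • Q) j y = t • diffX A i Q j y := by
  ext s; simp only [diffX, Pi.smul_apply, smul_eq_mul]; ring

lemma diffY_smul (t : ℝ) (j : Node n m) (y : ℝ) : diffY (t • Q) j y = t • diffY Q j y := by
  ext s; simp only [diffY, Pi.smul_apply, smul_eq_mul]; exact deriv_const_mul_field t

/-- Absolutely continuous functions are differentiable only almost everywhere, so additivity of ∂_y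
fails on a null set in general; scalar multiples cause no such loss. -/
lemma MemH1.ae_diffY_add (hab : a < b) (hQ : MemH1 A a b Q) (hQ' : MemH1 A a b Q')
    (hj : IsInterior j) : ∀ᵐ y ∂volume.restrict (Ioo a b),
      diffY (Q + Q') j y = diffY Q j y + diffY Q' j y := by
  have h1 := ae_all_iff.2 fun s => (hQ.ac hj s).ae_differentiableAt
  have h2 := ae_all_iff.2 fun s => (hQ'.ac hj s).ae_differentiableAt
  filter_upwards [ae_restrict_of_ae h1, ae_restrict_of_ae h2, ae_restrict_mem measurableSet_Ioo]
    with y h1 h2 hy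
  rw [uIcc_of_le hab.le] at h1 h2
  ext s
  exact deriv_add (h1 s (Ioo_subset_Icc_self hy)) (h2 s (Ioo_subset_Icc_self hy))

lemma MemH1.add (hab : a < b) (hQ : MemH1 A a b Q) (hQ' : MemH1 A a b Q') :
    MemH1 A a b (Q + Q') := by
  intro j hj s
  refine ⟨(hQ.ac hj s).add (hQ'.ac hj s), ?_, fun i => ?_⟩
  · refine ((hQ.memLp_diffY hj s).add (hQ'.memLp_diffY hj s)).ae_eq ?_
    filter_upwards [hQ.ae_diffY_add hab hQ' hj] with y hy
    rw [hy]; rfl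
  · simp only [diffX_add]
    exact (hQ.memLp_diffX hj i s).add (hQ'.memLp_diffX hj i s)

lemma MemH1.smul (t : ℝ) (hQ : MemH1 A a b Q) : MemH1 A a b (t • Q) := by
  intro j hj s
  refine ⟨(hQ.ac hj s).const_smul t, ?_, fun i => ?_⟩
  · simp only [diffY_smul]
    exact (hQ.memLp_diffY hj s).const_smul t
  · simp only [diffX_smul]
    exact (hQ.memLp_diffX hj i s).const_smul t

lemma MemH1.sub (hab : a < b) (hQ : MemH1 A a b Q) (hQ' : MemH1 A a b Q') :
    MemH1 A a b (Q - Q') := by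
  have h := hQ.add hab (hQ'.smul (-1))
  rwa [neg_one_smul, ← sub_eq_add_neg] at h

lemma EqOnBoundary.sub {P P' : VecFun n m N} (h : EqOnBoundary a b Q P)
    (h' : EqOnBoundary a b Q' P') : EqOnBoundary a b (Q - Q') (P - P') := fun j y hy hb => by
  simp only [Pi.sub_apply, h j y hy hb, h' j y hy hb]

lemma EqOnBoundary.add {P P' : VecFun n m N} (h : EqOnBoundary a b Q P)
    (h' : EqOnBoundary a b Q' P') : EqOnBoundary a b (Q + Q') (P + P') := fun j y hy hb => by
  simp only [Pi.add_apply, h j y hy hb, h' j y hy hb]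

lemma EqOnBoundary.smul {P : VecFun n m N} (t : ℝ) (h : EqOnBoundary a b Q P) :
    EqOnBoundary a b (t • Q) (t • P) := fun j y hy hb => by
  simp only [Pi.smul_apply, h j y hy hb]

lemma memH10_sub (hab : a < b) {P : VecFun n m N} (hQ : MemH1 A a b Q) (hQ' : MemH1 A a b Q')
    (h : EqOnBoundary a b Q P) (h' : EqOnBoundary a b Q' P) : MemH10 A a b (Q - Q') :=
  ⟨hQ.sub hab hQ', by simpa using h.sub h'⟩

/-- The density of the squared norm. -/
noncomputable def dens (A : ℝ) (Q : VecFun n m N) (j : Node n m) (i : Fin n) (y : ℝ) : ℝ :=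
  nsq (Q j y) + nsq (diffX A i Q j y) + nsq (diffY Q j y)

lemma dens_nonneg (Q : VecFun n m N) (j : Node n m) (i : Fin n) (y : ℝ) : 0 ≤ dens A Q j i y :=
  add_nonneg (add_nonneg (nsq_nonneg _) (nsq_nonneg _)) (nsq_nonneg _)

lemma integrable_nsq {f : ℝ → Fin N → ℝ}
    (hf : ∀ s, MemLp (fun y => f y s) 2 (volume.restrict (Ioo a b))) :
    IntegrableOn (fun y => nsq (f y)) (Ioo a b) := by
  unfold nsq
  exact integrable_finsetSum _ fun s _ => (hf s).integrable_sq

lemma MemH1.integrable_val (hab : a < b) (hQ : MemH1 A a b Q) (hj : IsInterior j) :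
    IntegrableOn (fun y => nsq (Q j y)) (Ioo a b) := integrable_nsq fun s => hQ.memLp hab hj s

lemma MemH1.integrable_diffX (hQ : MemH1 A a b Q) (hj : IsInterior j) (i : Fin n) :
    IntegrableOn (fun y => nsq (diffX A i Q j y)) (Ioo a b) :=
  integrable_nsq fun s => hQ.memLp_diffX hj i s

lemma MemH1.integrable_diffY (hQ : MemH1 A a b Q) (hj : IsInterior j) :
    IntegrableOn (fun y => nsq (diffY Q j y)) (Ioo a b) := integrable_nsq fun s => hQ.memLp_diffY hj s

lemma MemH1.integrable_dens (hab : a < b) (hQ : MemH1 A a b Q) (hj : IsInterior j) (i : Fin n) :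
    IntegrableOn (dens A Q j i) (Ioo a b) :=
  ((hQ.integrable_val hab hj).add (hQ.integrable_diffX hj i)).add (hQ.integrable_diffY hj)

lemma normH1_eq (hab : a < b) (Q : VecFun n m N) : normH1 A a b Q =
    Real.sqrt (∑ j ∈ interiorNodes n m, ∑ i : Fin n, ∫ y in Ioo a b, dens A Q j i y) := by
  simp only [normH1, dens, nsq, intervalIntegral_eq_Ioo hab.le, Finset.sum_add_distrib]

lemma normH1_nonneg (Q : VecFun n m N) : 0 ≤ normH1 A a b Q := Real.sqrt_nonneg _

lemma normH1_sq (hab : a < b) (Q : VecFun n m N) : normH1 A a b Q ^ 2 =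
    ∑ j ∈ interiorNodes n m, ∑ i : Fin n, ∫ y in Ioo a b, dens A Q j i y := by
  rw [normH1_eq hab, Real.sq_sqrt]
  exact Finset.sum_nonneg fun j _ => Finset.sum_nonneg fun i _ =>
    integral_nonneg fun y => dens_nonneg Q j i y

lemma normH1_add_le (hab : a < b) (hQ : MemH1 A a b Q) (hQ' : MemH1 A a b Q') :
    normH1 A a b (Q + Q') ≤ normH1 A a b Q + normH1 A a b Q' := by
  refine le_of_sq_le_sq ?_ (add_nonneg (normH1_nonneg _) (normH1_nonneg _))
  refine le_add_sq_of_scaled (normH1_nonneg _) (normH1_nonneg _) fun t ht => ?_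
  simp only [normH1_sq hab, Finset.mul_sum, ← Finset.sum_add_distrib, ← integral_const_mul]
  refine Finset.sum_le_sum fun j hj => Finset.sum_le_sum fun i _ => ?_
  rw [mem_interiorNodes] at hj
  rw [← integral_add ((hQ.integrable_dens hab hj i).const_mul _)
    ((hQ'.integrable_dens hab hj i).const_mul _)]
  refine integral_mono_ae ((hQ.add hab hQ').integrable_dens hab hj i)
    (((hQ.integrable_dens hab hj i).const_mul _).add
    ((hQ'.integrable_dens hab hj i).const_mul _)) ?_
  filter_upwards [hQ.ae_diffY_add hab hQ' hj] with y hy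
  simp only [dens, hy, diffX_add, Pi.add_apply]
  have h1 := nsq_add_le_scaled (Q j y) (Q' j y) ht
  have h2 := nsq_add_le_scaled (diffX A i Q j y) (diffX A i Q' j y) ht
  have h3 := nsq_add_le_scaled (diffY Q j y) (diffY Q' j y) ht
  linarith

lemma normH1_smul (hab : a < b) (t : ℝ) (Q : VecFun n m N) :
    normH1 A a b (t • Q) = |t| * normH1 A a b Q := by
  have h : normH1 A a b (t • Q) ^ 2 = (|t| * normH1 A a b Q) ^ 2 := by
    rw [mul_pow, sq_abs, normH1_sq hab, normH1_sq hab]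
    simp only [dens, diffX_smul, diffY_smul, Pi.smul_apply, nsq_smul, ← mul_add,
      integral_const_mul, Finset.mul_sum]
  exact (pow_left_inj₀ (normH1_nonneg _) (mul_nonneg (abs_nonneg _) (normH1_nonneg _))
    two_ne_zero).1 h

lemma normH1_neg (hab : a < b) (Q : VecFun n m N) : normH1 A a b (-Q) = normH1 A a b Q := by
  have := normH1_smul (A := A) hab (-1) Q
  simpa using this

lemma normH1_sub_comm (hab : a < b) (Q Q' : VecFun n m N) :
    normH1 A a b (Q - Q') = normH1 A a b (Q' - Q) := by
  rw [← neg_sub, normH1_neg hab]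

lemma MemH1.integral_dens_le (hab : a < b) (hj : IsInterior j)
    (i : Fin n) : ∫ y in Ioo a b, dens A Q j i y ≤ normH1 A a b Q ^ 2 := by
  rw [normH1_sq hab]
  have h0 : ∀ j i, 0 ≤ ∫ y in Ioo a b, dens A Q j i y := fun j i =>
    integral_nonneg fun y => dens_nonneg Q j i y
  exact (Finset.single_le_sum (f := fun i => ∫ y in Ioo a b, dens A Q j i y)
    (fun i _ => h0 j i) (Finset.mem_univ i)).trans
    (Finset.single_le_sum (f := fun j => ∑ i, ∫ y in Ioo a b, dens A Q j i y)
      (fun j _ => Finset.sum_nonneg fun i _ => h0 j i) (mem_interiorNodes.2 hj))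

/-- The norm repeats the terms without direction once for each i, so n ≥ 1 is needed for it to
control the values of Q. -/
lemma MemH1.integral_val_le (hab : a < b) (hQ : MemH1 A a b Q) (hn : 1 ≤ n) (hj : IsInterior j) :
    ∫ y in Ioo a b, nsq (Q j y) ≤ normH1 A a b Q ^ 2 :=
  (integral_mono (hQ.integrable_val hab hj) (hQ.integrable_dens hab hj ⟨0, hn⟩) fun y => by
    simp only [dens]
    linarith [nsq_nonneg (diffX A ⟨0, hn⟩ Q j y), nsq_nonneg (diffY Q j y)]).trans
    (MemH1.integral_dens_le hab hj _)

lemma MemH1.integral_diffX_le (hab : a < b) (hQ : MemH1 A a b Q) (hj : IsInterior j) (i : Fin n) :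
    ∫ y in Ioo a b, nsq (diffX A i Q j y) ≤ normH1 A a b Q ^ 2 :=
  (integral_mono (hQ.integrable_diffX hj i) (hQ.integrable_dens hab hj i) fun y => by
    simp only [dens]
    linarith [nsq_nonneg (Q j y), nsq_nonneg (diffY Q j y)]).trans
    (MemH1.integral_dens_le hab hj _)

lemma MemH1.integral_diffY_le (hab : a < b) (hQ : MemH1 A a b Q) (hn : 1 ≤ n)
    (hj : IsInterior j) : ∫ y in Ioo a b, nsq (diffY Q j y) ≤ normH1 A a b Q ^ 2 :=
  (integral_mono (hQ.integrable_diffY hj) (hQ.integrable_dens hab hj ⟨0, hn⟩) fun y => by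
    simp only [dens]
    linarith [nsq_nonneg (Q j y), nsq_nonneg (diffX A ⟨0, hn⟩ Q j y)]).trans
    (MemH1.integral_dens_le hab hj _)

/-- The Sobolev inequality at an interior node. -/
lemma MemH1.nsq_le (hab : a < b) (hQ : MemH1 A a b Q) (hn : 1 ≤ n) (hj : IsInterior j) {y : ℝ}
    (hy : y ∈ Icc a b) :
    nsq (Q j y) ≤ (2 / (b - a) + 2 * (b - a)) * normH1 A a b Q ^ 2 := by
  have hba : 0 < b - a := by linarith
  have h1 : nsq (Q j y) ≤ 2 / (b - a) * (∫ t in Ioo a b, nsq (Q j t)) +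
      2 * (b - a) * ∫ t in Ioo a b, nsq (diffY Q j t) := by
    simp only [nsq]
    rw [integral_finsetSum _ fun s _ => (hQ.memLp hab hj s).integrable_sq,
      integral_finsetSum _ fun s _ => (hQ.memLp_diffY hj s).integrable_sq,
      Finset.mul_sum, Finset.mul_sum, ← Finset.sum_add_distrib]
    exact Finset.sum_le_sum fun s _ => sq_le_sobolev hab (hQ.ac hj s) (hQ.memLp_diffY hj s) hy
  have h2 := hQ.integral_val_le hab hn hj
  have h3 := hQ.integral_diffY_le hab hn hj
  calc _ ≤ _ := h1
    _ ≤ 2 / (b - a) * normH1 A a b Q ^ 2 + 2 * (b - a) * normH1 A a b Q ^ 2 := by gcongr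
    _ = _ := by ring

/-! ### Functions vanishing on the boundary -/

/-- The sum of squares over all interior nodes. -/
noncomputable def totSq (v : VecFun n m N) (y : ℝ) : ℝ := ∑ j ∈ interiorNodes n m, nsq (v j y)

lemma totSq_nonneg (v : VecFun n m N) (y : ℝ) : 0 ≤ totSq v y :=
  Finset.sum_nonneg fun _ _ => nsq_nonneg _

/-- The squared norm of the `y`-derivative. -/
noncomputable def derivSq (a b : ℝ) (v : VecFun n m N) : ℝ :=
  ∑ j ∈ interiorNodes n m, ∫ y in Ioo a b, nsq (diffY v j y)

/-- Boundary nodes contribute zero, so the sum over interior nodes also controls those neighbours of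
an interior node that lie on the boundary. -/
lemma nsq_le_totSq (hv : EqOnBoundary a b v 0) {y : ℝ} (hy : y ∈ Icc a b) (j : Node n m) :
    nsq (v j y) ≤ totSq v y := by
  by_cases hj : IsInterior j
  · exact Finset.single_le_sum (f := fun j => nsq (v j y)) (fun _ _ => nsq_nonneg _)
      (mem_interiorNodes.2 hj)
  · rw [hv j y hy (Or.inl hj)]
    simpa [nsq] using totSq_nonneg v y

/-- A difference quotient with step at least h₀ is a bounded operator on nodal values. This turns
A_i v_{x_i} into a term of order zero, which a Carleman estimate in y alone can absorb. Cyclic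
wrap-around of j i ± 1 does no harm, since the previous bound holds at every node. -/
lemma nsq_diffX_le (hh₀ : 0 < h₀) (hh : h₀ ≤ step A m) (hv : EqOnBoundary a b v 0) {y : ℝ}
    (hy : y ∈ Icc a b) (j : Node n m) (i : Fin n) :
    nsq (diffX A i v j y) ≤ 1 / h₀ ^ 2 * totSq v y := by
  have hs : 0 < step A m := hh₀.trans_le hh
  set u := v (Function.update j i (j i + 1)) y
  set w := v (Function.update j i (j i - 1)) y
  have h1 : diffX A i v j y = (1 / (2 * step A m)) • (u + -w) := by
    ext s
    simp only [diffX, u, w, Pi.smul_apply, Pi.add_apply, Pi.neg_apply, smul_eq_mul]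
    ring
  have h2 : nsq (u + -w) ≤ 4 * totSq v y := by
    have := nsq_add_le u (-w)
    rw [nsq_neg] at this
    linarith [nsq_le_totSq hv hy (Function.update j i (j i + 1)),
      nsq_le_totSq hv hy (Function.update j i (j i - 1))]
  rw [h1, nsq_smul]
  have h3 := totSq_nonneg v y
  calc (1 / (2 * step A m)) ^ 2 * nsq (u + -w) ≤ (1 / (2 * step A m)) ^ 2 * (4 * totSq v y) := by
        gcongr
    _ = 1 / step A m ^ 2 * totSq v y := by field_simp; ring
    _ ≤ _ := by gcongr

lemma MemH10.nsq_le_deriv (hab : a < b) (hv : MemH10 A a b v) (hj : IsInterior j) {y : ℝ}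
    (hy : y ∈ Icc a b) : nsq (v j y) ≤ (b - a) * ∫ t in Ioo a b, nsq (diffY v j t) := by
  simp only [nsq]
  rw [integral_finsetSum _ fun s _ => (hv.1.memLp_diffY hj s).integrable_sq, Finset.mul_sum]
  refine Finset.sum_le_sum fun s _ => sq_le_of_zero_left hab (hv.1.ac hj s) (hv.1.memLp_diffY hj s)
    ?_ hy
  rw [hv.2 j a (left_mem_Icc.2 hab.le) (Or.inr (Or.inl rfl))]; rfl

lemma MemH10.totSq_le (hab : a < b) (hv : MemH10 A a b v) {y : ℝ} (hy : y ∈ Icc a b) :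
    totSq v y ≤ (b - a) * derivSq a b v := by
  rw [totSq, derivSq, Finset.mul_sum]
  exact Finset.sum_le_sum fun j hj => hv.nsq_le_deriv hab (mem_interiorNodes.1 hj) hy

lemma derivSq_nonneg (v : VecFun n m N) : 0 ≤ derivSq a b v :=
  Finset.sum_nonneg fun _ _ => integral_nonneg fun _ => nsq_nonneg _

/-- h ≥ h₀ means m ≤ 2A/h₀; sums over nodes thus cost a factor that does not depend on the grid. -/
lemma card_interiorNodes_le (hh₀ : 0 < h₀) (hm : 1 < m) (hh : h₀ ≤ step A m) :
    ((interiorNodes n m).card : ℝ) ≤ (2 * A / h₀ + 1) ^ n := by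
  have h1 : (interiorNodes n m).card ≤ (m + 1) ^ n := by
    refine (Finset.card_le_univ _).trans (le_of_eq ?_)
    simp
  have hm0 : (0 : ℝ) < m := by exact_mod_cast (by omega : 0 < m)
  have h2 : (m : ℝ) ≤ 2 * A / h₀ := by
    rw [le_div_iff₀ hh₀]
    rw [step, le_div_iff₀ hm0] at hh
    linarith
  calc ((interiorNodes n m).card : ℝ) ≤ ((m + 1) ^ n : ℕ) := by exact_mod_cast h1
    _ = ((m : ℝ) + 1) ^ n := by push_cast; ring
    _ ≤ _ := by gcongr

/-- On functions vanishing on the boundary the norm is controlled by the `y`-derivative. -/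
lemma MemH10.normH1_sq_le (hab : a < b) (hh₀ : 0 < h₀) (hm : 1 < m)
    (hh : h₀ ≤ step A m) (hv : MemH10 A a b v) :
    normH1 A a b v ^ 2 ≤ ((2 * A / h₀ + 1) ^ n * n * ((b - a) ^ 2 * (1 + 1 / h₀ ^ 2)) + n) *
      derivSq a b v := by
  have hba : 0 < b - a := by linarith
  set D := derivSq a b v with hD
  have hD0 : 0 ≤ D := derivSq_nonneg v
  have h1 : ∀ j ∈ interiorNodes n m, ∀ i : Fin n, ∫ y in Ioo a b, dens A v j i y ≤
      (b - a) ^ 2 * (1 + 1 / h₀ ^ 2) * D + ∫ y in Ioo a b, nsq (diffY v j y) := by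
    intro j hj i
    rw [mem_interiorNodes] at hj
    have h2 : ∫ y in Ioo a b, dens A v j i y ≤
        ∫ y in Ioo a b, ((b - a) * (1 + 1 / h₀ ^ 2) * D + nsq (diffY v j y)) := by
      refine setIntegral_mono_on (hv.1.integrable_dens hab hj i)
        ((integrable_const _).add (hv.1.integrable_diffY hj)) measurableSet_Ioo fun y hy => ?_
      have hy' := Ioo_subset_Icc_self hy
      have h3 := nsq_le_totSq hv.2 hy' j
      have h4 := nsq_diffX_le hh₀ hh hv.2 hy' j i
      have h5 := hv.totSq_le hab hy'
      have h6 : (1 + 1 / h₀ ^ 2) * totSq v y ≤ (1 + 1 / h₀ ^ 2) * ((b - a) * D) := by gcongr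
      simp only [dens]
      linarith
    rw [integral_add (integrable_const _) (hv.1.integrable_diffY hj)] at h2
    simp only [integral_const, MeasurableSet.univ, measureReal_restrict_apply, univ_inter,
      Real.volume_real_Ioo_of_le hab.le, smul_eq_mul] at h2
    linarith
  have hcard := card_interiorNodes_le (n := n) hh₀ hm hh
  calc normH1 A a b v ^ 2 ≤ ∑ j ∈ interiorNodes n m, ∑ _i : Fin n,
        ((b - a) ^ 2 * (1 + 1 / h₀ ^ 2) * D + ∫ y in Ioo a b, nsq (diffY v j y)) := by
        rw [normH1_sq hab]
        exact Finset.sum_le_sum fun j hj => Finset.sum_le_sum fun i _ => h1 j hj i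
    _ = (interiorNodes n m).card * n * ((b - a) ^ 2 * (1 + 1 / h₀ ^ 2)) * D + n * D := by
        simp only [Finset.sum_const, Finset.card_univ, Fintype.card_fin, nsmul_eq_mul,
          mul_add, Finset.sum_add_distrib, ← Finset.mul_sum, hD, derivSq]
        ring
    _ ≤ (2 * A / h₀ + 1) ^ n * n * ((b - a) ^ 2 * (1 + 1 / h₀ ^ 2)) * D + n * D := by gcongr
    _ = _ := by ring

end Space

end RTE

/-! ### Linearization of the residual and its pointwise bounds. -/

namespace RTE

/-! ### Expansion of the residual -/

section Residual

variable {n m N : ℕ} {A a b d κ M : ℝ} {K : Pt n → ℝ → ℝ → ℝ} {μs : Pt n → ℝ}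
  {W v : VecFun n m N} {j : Node n m}

lemma nodePt_mem (hA : 0 < A) (hm : 1 < m) (j : Node n m) {y : ℝ} (hy : y ∈ Icc a b) :
    (nodePt A j, y) ∈ closedPrism n A a b := by
  refine ⟨fun i => ?_, hy.1, hy.2⟩
  have hm0 : (0 : ℝ) < m := by exact_mod_cast (by omega : 0 < m)
  have h1 : ((j i).val : ℝ) ≤ m := by exact_mod_cast Nat.lt_succ_iff.1 (j i).isLt
  have h2 : (0 : ℝ) ≤ (j i).val := by positivity
  have h3 : (m : ℝ) * step A m = 2 * A := by rw [step]; field_simp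
  have h4 : 0 ≤ step A m := by rw [step]; positivity
  simp only [nodePt]
  constructor <;> nlinarith

/-- The linearization of the residual at `W`. -/
noncomputable def linOp (A a b d : ℝ) (K : Pt n → ℝ → ℝ → ℝ) (μs : Pt n → ℝ) (W v : VecFun n m N) :
    VecFun n m N := fun j y =>
  (matD d N (nodePt A j, y)).mulVec (diffY v j y) +
    ∑ i, (matA d N i (nodePt A j, y)).mulVec (diffX A i v j y) +
    vecF' A a b d K μs (W j y) (v j y) (nodePt A j, y)

/-- The remainder of the linearization of the residual at `W`. -/
noncomputable def remOp (A a b d : ℝ) (K : Pt n → ℝ → ℝ → ℝ) (μs : Pt n → ℝ) (W v : VecFun n m N) :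
    VecFun n m N := fun j y =>
  vecF d K μs (W j y + v j y) (nodePt A j, y) - vecF d K μs (W j y) (nodePt A j, y) -
    vecF' A a b d K μs (W j y) (v j y) (nodePt A j, y)

/-- The principal part is linear in W, so the remainder involves only the values of v and none of
its derivatives or differences. -/
lemma residual_add {y : ℝ} (h : diffY (W + v) j y = diffY W j y + diffY v j y) :
    residual A d K μs (W + v) j y =
      residual A d K μs W j y + (linOp A a b d K μs W v j y + remOp A a b d K μs W v j y) := by
  simp only [residual, linOp, remOp, h, diffX_add, Matrix.mulVec_add, Finset.sum_add_distrib,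
    Pi.add_apply]
  abel

/-- The first order energy density summed over all directions. -/
noncomputable def energy (A : ℝ) (v : VecFun n m N) (j : Node n m) (y : ℝ) : ℝ :=
  nsq (diffY v j y) + ((∑ i, nsq (diffX A i v j y)) + nsq (v j y))

lemma energy_nonneg (A : ℝ) (v : VecFun n m N) (j : Node n m) (y : ℝ) : 0 ≤ energy A v j y :=
  add_nonneg (nsq_nonneg _) (add_nonneg (Finset.sum_nonneg fun _ _ => nsq_nonneg _) (nsq_nonneg _))

/-- Pointwise bounds for the expansion of the residual. -/
lemma exists_expansion_bounds (hA : 0 < A) (ha : 1 ≤ a) (hab : a < b) (hd : 0 < d) (n N : ℕ)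
    (κ M : ℝ) {c₀ : ℝ}
    (hD : ∀ x ∈ closedPrism n A a b, ∀ v : Fin N → ℝ, c₀ * nsq v ≤ nsq ((matD d N x).mulVec v))
    {ρ : ℝ} (hρ : 0 ≤ ρ) : ∃ C : ℝ, 0 ≤ C ∧
    ∀ (m : ℕ) (K : Pt n → ℝ → ℝ → ℝ) (μs : Pt n → ℝ), 1 < m → IsPhaseFunction A a b d κ K →
      IsScatteringCoeff A a b M μs → ∀ (W v : VecFun n m N) (j : Node n m), ∀ y ∈ Ioo a b,
      (∀ s, |W j y s| ≤ ρ) → (∀ s, |v j y s| ≤ ρ) →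
      nsq (residual A d K μs W j y) ≤ C * (energy A W j y + 1) ∧
      nsq (linOp A a b d K μs W v j y) ≤ C * energy A v j y ∧
      nsq (remOp A a b d K μs W v j y) ≤ C * nsq (v j y) ^ 2 ∧
      nsq (linOp A a b d K μs W v j y + remOp A a b d K μs W v j y) ≤ C * energy A v j y ∧
      c₀ / 2 * nsq (diffY v j y) - C * ((∑ i, nsq (diffX A i v j y)) + nsq (v j y)) ≤
        nsq (linOp A a b d K μs W v j y + remOp A a b d K μs W v j y) := by
  obtain ⟨βD, hβD0, hβD⟩ := exists_abs_matD_le hA hd ha N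
  obtain ⟨βA, hβA0, hβA⟩ := exists_abs_matA_le hA hd ha N
  obtain ⟨CF, hCF0, hCF⟩ := exists_vecF_bounds hA ha hab hd n N κ M hρ
  set cD := (N : ℝ) ^ 2 * βD ^ 2 with hcD
  set cA := (n : ℝ) * (N ^ 2 * βA ^ 2) with hcA
  set cR := 2 * CF + 2 * (CF * (N * ρ ^ 2)) with hcR
  have hcD0 : 0 ≤ cD := by positivity
  have hcA0 : 0 ≤ cA := by positivity
  have hcR0 : 0 ≤ cR := by positivity
  have hcRF : CF ≤ cR := by
    have : 0 ≤ CF * (N * ρ ^ 2) := by positivity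
    linarith
  refine ⟨4 * (cD + cA + cR), by positivity, fun m K μs hm hK hμ W v j y hy hW hv => ?_⟩
  have hx := nodePt_mem (a := a) (b := b) hA hm j (Ioo_subset_Icc_self hy)
  set x : Pt n := (nodePt A j, y) with hxdef
  have hDle : ∀ p : Fin N → ℝ, nsq ((matD d N x).mulVec p) ≤ cD * nsq p := fun p =>
    nsq_mulVec_le (hβD n b x hx) p
  have hAle : ∀ q : Fin n → Fin N → ℝ, nsq (∑ i, (matA d N i x).mulVec (q i)) ≤
      cA * ∑ i, nsq (q i) := by
    intro q
    refine (nsq_sum_le _).trans ?_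
    rw [hcA, mul_assoc, Finset.mul_sum (f := fun i => nsq (q i))]
    gcongr with i
    exact nsq_mulVec_le (hβA n b x hx i) (q i)
  obtain ⟨hF1, hF2, hF3⟩ := hCF K μs hK hμ x hx (W j y) (v j y) hW hv
  have hQW : 0 ≤ ∑ i, nsq (diffX A i W j y) := Finset.sum_nonneg fun _ _ => nsq_nonneg _
  have hQv : 0 ≤ ∑ i, nsq (diffX A i v j y) := Finset.sum_nonneg fun _ _ => nsq_nonneg _
  have hpW := nsq_nonneg (diffY W j y)
  have hpv := nsq_nonneg (diffY v j y)
  have hvv := nsq_nonneg (v j y)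
  have hWW := nsq_nonneg (W j y)
  have hvN : nsq (v j y) ≤ N * ρ ^ 2 := nsq_le_of_abs_le hv
  -- On the bounded set |v_s| ≤ ρ the quadratic remainder is also of first order in v, because |v|⁴
  -- ≤ Nρ²|v|².
  have hFr : nsq (vecF' A a b d K μs (W j y) (v j y) x + remOp A a b d K μs W v j y) ≤
      cR * nsq (v j y) := by
    refine (nsq_add_le _ _).trans ?_
    have h1 : CF * nsq (v j y) ^ 2 ≤ CF * (N * ρ ^ 2) * nsq (v j y) := by
      rw [sq, ← mul_assoc, mul_assoc CF (N * ρ ^ 2)]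
      rw [mul_assoc]
      gcongr
    have h2 : nsq (remOp A a b d K μs W v j y) ≤ CF * nsq (v j y) ^ 2 := hF3
    rw [hcR]
    linarith
  have hgen : ∀ X Y Z : Fin N → ℝ, nsq (X + Y + Z) ≤ 4 * nsq X + 4 * nsq Y + 2 * nsq Z := by
    intro X Y Z
    linarith [nsq_add_le (X + Y) Z, nsq_add_le X Y]
  have hDv := hDle (diffY v j y)
  have hAv := hAle fun i => diffX A i v j y
  have hlr : linOp A a b d K μs W v j y + remOp A a b d K μs W v j y =
      (matD d N x).mulVec (diffY v j y) + ∑ i, (matA d N i x).mulVec (diffX A i v j y) +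
        (vecF' A a b d K μs (W j y) (v j y) x + remOp A a b d K μs W v j y) := by
    rw [linOp, add_assoc]
  have hbound : ∀ p q r : ℝ, 0 ≤ p → 0 ≤ q → 0 ≤ r →
      4 * (cD * p) + 4 * (cA * q) + 2 * (cR * r) ≤ 4 * (cD + cA + cR) * (p + (q + r)) := by
    intro p q r hp hq hr
    have h1 := mul_nonneg hcD0 (add_nonneg hq hr)
    have h2 := mul_nonneg hcA0 (add_nonneg hp hr)
    have h3 := mul_nonneg hcR0 (add_nonneg hp (add_nonneg hq hr))
    have h4 := mul_nonneg hcR0 (add_nonneg hp hq)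
    nlinarith
  refine ⟨?_, ?_, ?_, ?_, ?_⟩
  · refine (hgen _ _ _).trans ?_
    have h1 := hDle (diffY W j y)
    have h2 := hAle fun i => diffX A i W j y
    have h3 := hbound _ _ 1 hpW hQW zero_le_one
    refine le_trans ?_ (h3.trans (mul_le_mul_of_nonneg_left ?_ (by positivity)))
    · linarith
    · rw [energy]; linarith
  · refine (hgen _ _ _).trans ?_
    have h3 := hbound _ _ _ hpv hQv hvv
    have h4 := mul_le_mul_of_nonneg_right hcRF hvv
    refine le_trans ?_ h3
    linarith
  · refine hF3.trans (mul_le_mul_of_nonneg_right ?_ (sq_nonneg _))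
    linarith
  · rw [hlr]
    refine (hgen _ _ _).trans ?_
    refine le_trans ?_ (hbound _ _ _ hpv hQv hvv)
    linarith
  · have h1 := hD x hx (diffY v j y)
    set l := linOp A a b d K μs W v j y + remOp A a b d K μs W v j y with hl
    set q := ∑ i, (matA d N i x).mulVec (diffX A i v j y)
    set r := vecF' A a b d K μs (W j y) (v j y) x + remOp A a b d K μs W v j y
    -- Solving for D_N v_y gives c₀|v_y|² ≤ |D_N v_y|² ≤ 2|l|² + 2|q + r|²; halving this produces
    -- the factor c₀/2.
    have h2 : (matD d N x).mulVec (diffY v j y) = l + -(q + r) := by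
      rw [hlr]; abel
    have h3 := nsq_add_le l (-(q + r))
    rw [← h2, nsq_neg] at h3
    have h4 := nsq_add_le q r
    have h5 : 2 * (cA * ∑ i, nsq (diffX A i v j y)) + 2 * (cR * nsq (v j y)) ≤
        4 * (cD + cA + cR) * ((∑ i, nsq (diffX A i v j y)) + nsq (v j y)) := by
      have := hbound 0 _ _ le_rfl hQv hvv
      have h6 : 0 ≤ cA * ∑ i, nsq (diffX A i v j y) := mul_nonneg hcA0 hQv
      simp only [mul_zero, zero_add] at this
      linarith
    linarith

/-- Here r is a residual, e a Taylor remainder and τ = |v|². The Cauchy–Schwarz inequality and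
2√C|r| ≤ |r|² + C separate the integrable factor |r|² + C from τ. -/
lemma abs_two_mul_sum_le {r e : Fin N → ℝ} {C τ : ℝ} (hC : 0 ≤ C) (hτ : 0 ≤ τ)
    (h : nsq e ≤ C * τ ^ 2) : |2 * ∑ s, r s * e s| ≤ (nsq r + C) * τ := by
  have h1 : (∑ s, r s * e s) ^ 2 ≤ nsq r * nsq e := Finset.sum_mul_sq_le_sq_mul_sq _ _ _
  have hr := nsq_nonneg r
  refine abs_le_of_sq_le_sq ?_ (by positivity)
  have h2 : nsq r * nsq e ≤ nsq r * (C * τ ^ 2) := by gcongr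
  have h3 : 4 * (nsq r * C) ≤ (nsq r + C) ^ 2 := by nlinarith [sq_nonneg (nsq r - C)]
  have h4 := mul_le_mul_of_nonneg_right h3 (sq_nonneg τ)
  nlinarith

lemma nsq_add_sub (r l : Fin N → ℝ) : nsq (r + l) - nsq r = nsq l + 2 * ∑ s, r s * l s := by
  simp only [nsq, Finset.mul_sum, ← Finset.sum_add_distrib, ← Finset.sum_sub_distrib, Pi.add_apply]
  exact Finset.sum_congr rfl fun s _ => by ring

/-! ### Square integrability of the residual -/

lemma memLp_of_nsq_le {f : ℝ → Fin N → ℝ} {g : ℝ → ℝ}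
    (hf : ∀ k, AEStronglyMeasurable (fun y => f y k) (volume.restrict (Ioo a b)))
    (hg : IntegrableOn g (Ioo a b)) (h : ∀ᵐ y ∂volume.restrict (Ioo a b), nsq (f y) ≤ g y)
    (k : Fin N) : MemLp (fun y => f y k) 2 (volume.restrict (Ioo a b)) := by
  rw [memLp_two_iff_integrable_sq (hf k)]
  refine Integrable.mono' hg ((hf k).pow 2) ?_
  filter_upwards [h] with y hy
  rw [Real.norm_eq_abs, abs_of_nonneg (sq_nonneg _)]
  exact (sq_le_nsq _ k).trans hy

lemma aestronglyMeasurable_mulVec {B : ℝ → Matrix (Fin N) (Fin N) ℝ} {u : ℝ → Fin N → ℝ}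
    (hB : ∀ k s, AEStronglyMeasurable (fun y => B y k s) (volume.restrict (Ioo a b)))
    (hu : ∀ s, AEStronglyMeasurable (fun y => u y s) (volume.restrict (Ioo a b))) (k : Fin N) :
    AEStronglyMeasurable (fun y => (B y).mulVec (u y) k) (volume.restrict (Ioo a b)) := by
  simp only [Matrix.mulVec, dotProduct]
  exact Finset.aestronglyMeasurable_fun_sum _ fun s _ => (hB k s).mul (hu s)

lemma MemH1.aesm_principal (hd : 0 < d) (ha : 0 < a) (hv : MemH1 A a b v) (hj : IsInterior j)
    (k : Fin N) :
    AEStronglyMeasurable (fun y => ((matD d N (nodePt A j, y)).mulVec (diffY v j y) +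
      ∑ i, (matA d N i (nodePt A j, y)).mulVec (diffX A i v j y)) k)
      (volume.restrict (Ioo a b)) := by
  simp only [Pi.add_apply, Finset.sum_apply]
  refine AEStronglyMeasurable.add ?_ (Finset.aestronglyMeasurable_fun_sum _ fun i _ => ?_)
  · exact aestronglyMeasurable_mulVec (fun k s => aestronglyMeasurable_matD hd ha _ k s)
      (fun s => (hv.memLp_diffY hj s).1) k
  · exact aestronglyMeasurable_mulVec (fun k s => aestronglyMeasurable_matA hd ha _ i k s)
      (fun s => (hv.memLp_diffX hj i s).1) k

lemma MemH1.aesm_residual (hA : 0 < A) (hd : 0 < d) (ha : 0 < a) (hab : a < b) (hm : 1 < m)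
    (hK : IsPhaseFunction A a b d κ K) (hμ : IsScatteringCoeff A a b M μs)
    (hW : MemH1 A a b W) (hj : IsInterior j) (k : Fin N) :
    AEStronglyMeasurable (fun y => residual A d K μs W j y k) (volume.restrict (Ioo a b)) :=
  (hW.aesm_principal hd ha hj k).add (aestronglyMeasurable_vecF hK hμ hA ha hab hd
    (fun _ hy => nodePt_mem hA hm j (Ioo_subset_Icc_self hy))
    (fun s => (hW.continuousOn hab hj s).mono Ioo_subset_Icc_self) k)

lemma MemH1.aesm_linOp (hA : 0 < A) (hd : 0 < d) (ha : 0 < a) (hab : a < b) (hm : 1 < m)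
    (hK : IsPhaseFunction A a b d κ K) (hμ : IsScatteringCoeff A a b M μs)
    (hW : MemH1 A a b W) (hv : MemH1 A a b v) (hj : IsInterior j) (k : Fin N) :
    AEStronglyMeasurable (fun y => linOp A a b d K μs W v j y k) (volume.restrict (Ioo a b)) :=
  (hv.aesm_principal hd ha hj k).add (aestronglyMeasurable_vecF' hK hμ hA ha hab hd
    (fun _ hy => nodePt_mem hA hm j (Ioo_subset_Icc_self hy))
    (fun s => (hW.continuousOn hab hj s).mono Ioo_subset_Icc_self)
    (fun s => (hv.continuousOn hab hj s).mono Ioo_subset_Icc_self) k)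

lemma MemH1.integrable_energy (hab : a < b) (hv : MemH1 A a b v) (hj : IsInterior j) :
    IntegrableOn (energy A v j) (Ioo a b) :=
  (hv.integrable_diffY hj).add ((integrable_finsetSum _ fun i _ => hv.integrable_diffX hj i).add
    (hv.integrable_val hab hj))

lemma MemH1.integral_energy_le (hab : a < b) (hn : 1 ≤ n) (hv : MemH1 A a b v)
    (hj : IsInterior j) : ∫ y in Ioo a b, energy A v j y ≤ (n + 2) * normH1 A a b v ^ 2 := by
  have hi : Integrable (fun y => ∑ i, nsq (diffX A i v j y)) (volume.restrict (Ioo a b)) :=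
    integrable_finsetSum _ fun i _ => hv.integrable_diffX hj i
  have h1 : ∫ y in Ioo a b, energy A v j y = (∫ y in Ioo a b, nsq (diffY v j y)) +
      ((∑ i, ∫ y in Ioo a b, nsq (diffX A i v j y)) + ∫ y in Ioo a b, nsq (v j y)) := by
    rw [← integral_finsetSum _ fun i _ => hv.integrable_diffX hj i,
      ← integral_add hi (hv.integrable_val hab hj)]
    exact integral_add (hv.integrable_diffY hj) (hi.add (hv.integrable_val hab hj))
  have h2 : ∑ i, ∫ y in Ioo a b, nsq (diffX A i v j y) ≤ n * normH1 A a b v ^ 2 := by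
    simpa using Finset.sum_le_sum (s := Finset.univ) fun i _ => hv.integral_diffX_le hab hj i
  rw [h1]
  linarith [hv.integral_diffY_le hab hn hj, hv.integral_val_le hab hn hj]

/-- The constant of the Sobolev inequality. -/
noncomputable def sobolevConst (a b : ℝ) : ℝ := Real.sqrt (2 / (b - a) + 2 * (b - a))

lemma sobolevConst_nonneg (a b : ℝ) : 0 ≤ sobolevConst a b := Real.sqrt_nonneg _

lemma MemH1.abs_le (hab : a < b) (hQ : MemH1 A a b W) (hn : 1 ≤ n) (hj : IsInterior j) {y R : ℝ}
    (hy : y ∈ Icc a b) (hR : normH1 A a b W ≤ R) (s : Fin N) :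
    |W j y s| ≤ sobolevConst a b * R := by
  have h0 := normH1_nonneg (A := A) (a := a) (b := b) W
  have hba : 0 < b - a := by linarith
  refine abs_le_of_sq_le_sq ?_ (mul_nonneg (sobolevConst_nonneg a b) (h0.trans hR))
  rw [mul_pow, sobolevConst, Real.sq_sqrt (by positivity)]
  refine (sq_le_nsq _ s).trans ((hQ.nsq_le hab hn hj hy).trans ?_)
  gcongr

end Residual

end RTE

/-! ### First order expansion and differentiability of the cost functional. -/

namespace RTE

/-! ### The expansion of the cost functional -/

section Cost

variable {n m N : ℕ} {A a b d κ M lam h₀ : ℝ} {K : Pt n → ℝ → ℝ → ℝ} {μs : Pt n → ℝ}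
  {W v : VecFun n m N} {j : Node n m}

/-- The assumptions on the parameters and on the coefficients of the problem. -/
structure Admissible (A a b d κ M : ℝ) {n : ℕ} (m : ℕ) (K : Pt n → ℝ → ℝ → ℝ) (μs : Pt n → ℝ) :
    Prop where
  hA : 0 < A
  hd : 0 < d
  ha : 1 ≤ a
  hab : a < b
  hn : 1 ≤ n
  hm : 1 < m
  hK : IsPhaseFunction A a b d κ K
  hμ : IsScatteringCoeff A a b M μs

lemma Admissible.ha0 (h : Admissible A a b d κ M m K μs) : 0 < a := zero_lt_one.trans_le h.ha

lemma costJ_eq (hab : a < b) (W : VecFun n m N) : costJ A a b d K μs lam W =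
    ∑ j ∈ interiorNodes n m, ∫ y in Ioo a b,
      nsq (residual A d K μs W j y) * Real.exp (2 * lam * y) := by
  simp only [costJ, normL2Sq, intervalIntegral_eq_Ioo hab.le, mul_pow, ← Finset.sum_mul, nsq,
    ← Real.exp_nat_mul, Nat.cast_ofNat, mul_assoc]

lemma costJ_nonneg (hab : a < b) (W : VecFun n m N) : 0 ≤ costJ A a b d K μs lam W := by
  rw [costJ_eq hab]
  exact Finset.sum_nonneg fun j _ => integral_nonneg fun y =>
    mul_nonneg (nsq_nonneg _) (Real.exp_pos _).le

/-- The derivative of the cost functional. -/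
noncomputable def costL (A a b d : ℝ) (K : Pt n → ℝ → ℝ → ℝ) (μs : Pt n → ℝ) (lam : ℝ)
    (W v : VecFun n m N) : ℝ :=
  ∑ j ∈ interiorNodes n m, ∫ y in Ioo a b,
    (2 * ∑ s, residual A d K μs W j y s * linOp A a b d K μs W v j y s) * Real.exp (2 * lam * y)

lemma Admissible.memLp_residual (h : Admissible A a b d κ M m K μs) (hW : MemH1 A a b W)
    (hj : IsInterior j) (k : Fin N) :
    MemLp (fun y => residual A d K μs W j y k) 2 (volume.restrict (Ioo a b)) := by
  have hρ : 0 ≤ sobolevConst a b * normH1 A a b W :=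
    mul_nonneg (sobolevConst_nonneg a b) (normH1_nonneg _)
  -- Only the upper bounds are needed, so the lower bound for D_N is supplied trivially with c₀ = 0.
  obtain ⟨C, hC0, hC⟩ := exists_expansion_bounds h.hA h.ha h.hab h.hd n N κ M (c₀ := 0)
    (fun x _ v => by rw [zero_mul]; exact nsq_nonneg _) hρ
  refine memLp_of_nsq_le (hW.aesm_residual h.hA h.hd h.ha0 h.hab h.hm h.hK h.hμ hj)
    (g := fun y => C * (energy A W j y + 1))
    (((hW.integrable_energy h.hab hj).add (integrable_const 1)).const_mul C) ?_ k
  filter_upwards [ae_restrict_mem measurableSet_Ioo] with y hy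
  exact (hC m K μs h.hm h.hK h.hμ W 0 j y hy
    (hW.abs_le h.hab h.hn hj (Ioo_subset_Icc_self hy) le_rfl) (fun s => by simpa using hρ)).1

lemma Admissible.memLp_linOp (h : Admissible A a b d κ M m K μs) (hW : MemH1 A a b W)
    (hv : MemH1 A a b v) (hj : IsInterior j) (k : Fin N) :
    MemLp (fun y => linOp A a b d K μs W v j y k) 2 (volume.restrict (Ioo a b)) := by
  have hS := sobolevConst_nonneg a b
  have hW0 := normH1_nonneg (A := A) (a := a) (b := b) W
  have hv0 := normH1_nonneg (A := A) (a := a) (b := b) v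
  have hρ : 0 ≤ sobolevConst a b * (normH1 A a b W + normH1 A a b v) := by positivity
  obtain ⟨C, hC0, hC⟩ := exists_expansion_bounds h.hA h.ha h.hab h.hd n N κ M (c₀ := 0)
    (fun x _ v => by rw [zero_mul]; exact nsq_nonneg _) hρ
  refine memLp_of_nsq_le (hW.aesm_linOp h.hA h.hd h.ha0 h.hab h.hm h.hK h.hμ hv hj)
    (g := fun y => C * energy A v j y) ((hv.integrable_energy h.hab hj).const_mul C) ?_ k
  filter_upwards [ae_restrict_mem measurableSet_Ioo] with y hy
  have hy' := Ioo_subset_Icc_self hy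
  exact (hC m K μs h.hm h.hK h.hμ W v j y hy (hW.abs_le h.hab h.hn hj hy' (by linarith))
    (hv.abs_le h.hab h.hn hj hy' (by linarith))).2.1

lemma Admissible.integrable_nsq_residual (h : Admissible A a b d κ M m K μs) (hW : MemH1 A a b W)
    (hj : IsInterior j) : IntegrableOn (fun y => nsq (residual A d K μs W j y)) (Ioo a b) :=
  integrable_nsq fun s => h.memLp_residual hW hj s

lemma Admissible.integrable_residual (h : Admissible A a b d κ M m K μs) (hW : MemH1 A a b W)
    (hj : IsInterior j) (lam : ℝ) :
    IntegrableOn (fun y => nsq (residual A d K μs W j y) * Real.exp (2 * lam * y)) (Ioo a b) :=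
  integrable_mul_exp (h.integrable_nsq_residual hW hj) lam

lemma Admissible.integrable_costL (h : Admissible A a b d κ M m K μs) (hW : MemH1 A a b W)
    (hv : MemH1 A a b v) (hj : IsInterior j) (lam : ℝ) :
    IntegrableOn (fun y => (2 * ∑ s, residual A d K μs W j y s * linOp A a b d K μs W v j y s) *
      Real.exp (2 * lam * y)) (Ioo a b) := by
  refine integrable_mul_exp (Integrable.const_mul (integrable_finsetSum _ fun s _ => ?_) 2) lam
  exact (h.memLp_residual hW hj s).integrable_mul (h.memLp_linOp hW hv hj s)

/-- The density of the remainder of the first order expansion of the cost functional. -/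
noncomputable def remDens (A a b d : ℝ) (K : Pt n → ℝ → ℝ → ℝ) (μs : Pt n → ℝ) (lam : ℝ)
    (W v : VecFun n m N) (j : Node n m) (y : ℝ) : ℝ :=
  (nsq (linOp A a b d K μs W v j y + remOp A a b d K μs W v j y) +
    2 * ∑ s, residual A d K μs W j y s * remOp A a b d K μs W v j y s) * Real.exp (2 * lam * y)

lemma Admissible.remDens_ae (h : Admissible A a b d κ M m K μs) (hW : MemH1 A a b W)
    (hv : MemH1 A a b v) (hj : IsInterior j) (lam : ℝ) :
    ∀ᵐ y ∂volume.restrict (Ioo a b),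
      nsq (residual A d K μs (W + v) j y) * Real.exp (2 * lam * y) -
      nsq (residual A d K μs W j y) * Real.exp (2 * lam * y) -
      (2 * ∑ s, residual A d K μs W j y s * linOp A a b d K μs W v j y s) *
        Real.exp (2 * lam * y) = remDens A a b d K μs lam W v j y := by
  filter_upwards [hW.ae_diffY_add h.hab hv hj] with y hy
  have h1 := nsq_add_sub (residual A d K μs W j y)
    (linOp A a b d K μs W v j y + remOp A a b d K μs W v j y)
  rw [residual_add (a := a) (b := b) hy, remDens, ← sub_mul, ← sub_mul, h1]
  simp only [Pi.add_apply, mul_add, Finset.sum_add_distrib]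
  ring

/-- As an almost everywhere difference of integrable functions; the Taylor remainder needs no
measurability argument of its own. -/
lemma Admissible.integrable_remDens (h : Admissible A a b d κ M m K μs) (hW : MemH1 A a b W)
    (hv : MemH1 A a b v) (hj : IsInterior j) (lam : ℝ) :
    IntegrableOn (remDens A a b d K μs lam W v j) (Ioo a b) :=
  (((h.integrable_residual (hW.add h.hab hv) hj lam).sub (h.integrable_residual hW hj lam)).sub
    (h.integrable_costL hW hv hj lam)).congr (h.remDens_ae hW hv hj lam)

lemma Admissible.cost_expansion (h : Admissible A a b d κ M m K μs) (hW : MemH1 A a b W)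
    (hv : MemH1 A a b v) (lam : ℝ) :
    costJ A a b d K μs lam (W + v) - costJ A a b d K μs lam W - costL A a b d K μs lam W v =
      ∑ j ∈ interiorNodes n m, ∫ y in Ioo a b, remDens A a b d K μs lam W v j y := by
  rw [costJ_eq h.hab, costJ_eq h.hab, costL, ← Finset.sum_sub_distrib, ← Finset.sum_sub_distrib]
  refine Finset.sum_congr rfl fun j hj => ?_
  rw [mem_interiorNodes] at hj
  have h1 := h.integrable_residual (hW.add h.hab hv) hj lam
  have h2 := h.integrable_residual hW hj lam
  have h3 := h.integrable_costL hW hv hj lam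
  rw [← integral_congr_ae (h.remDens_ae hW hv hj lam), ← integral_sub h1 h2]
  exact (integral_sub (h1.sub h2) h3).symm

/-! ### Fréchet differentiability -/

lemma linOp_smul (t : ℝ) (j : Node n m) (y : ℝ) :
    linOp A a b d K μs W (t • v) j y = t • linOp A a b d K μs W v j y := by
  simp only [linOp, diffY_smul, diffX_smul, Pi.smul_apply, vecF'_smul, Matrix.mulVec_smul,
    Finset.smul_sum, smul_add]

lemma Admissible.linOp_add (h : Admissible A a b d κ M m K μs) {u : VecFun n m N} {y : ℝ}
    (hy : y ∈ Ioo a b) (hd : diffY (u + v) j y = diffY u j y + diffY v j y) :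
    linOp A a b d K μs W (u + v) j y =
      linOp A a b d K μs W u j y + linOp A a b d K μs W v j y := by
  simp only [linOp, hd, diffX_add, Pi.add_apply, Matrix.mulVec_add, Finset.sum_add_distrib,
    vecF'_add h.hK h.hμ h.hA h.ha0 h.hab h.hd _ _ _
      (nodePt_mem h.hA h.hm j (Ioo_subset_Icc_self hy))]
  abel

lemma costL_smul (t : ℝ) (W v : VecFun n m N) :
    costL A a b d K μs lam W (t • v) = t * costL A a b d K μs lam W v := by
  simp only [costL, Finset.mul_sum, ← integral_const_mul]
  refine Finset.sum_congr rfl fun j _ => integral_congr_ae (Filter.Eventually.of_forall fun y => ?_)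
  have h1 : ∀ s, residual A d K μs W j y s * (t * linOp A a b d K μs W v j y s) =
      t * (residual A d K μs W j y s * linOp A a b d K μs W v j y s) := fun s => by ring
  simp only [linOp_smul, Pi.smul_apply, smul_eq_mul, h1, ← Finset.mul_sum]
  ring

lemma Admissible.costL_add (h : Admissible A a b d κ M m K μs) (hW : MemH1 A a b W)
    {u : VecFun n m N} (hu : MemH1 A a b u) (hv : MemH1 A a b v) (lam : ℝ) :
    costL A a b d K μs lam W (u + v) =
      costL A a b d K μs lam W u + costL A a b d K μs lam W v := by
  simp only [costL, ← Finset.sum_add_distrib]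
  refine Finset.sum_congr rfl fun j hj => ?_
  rw [mem_interiorNodes] at hj
  rw [← integral_add (h.integrable_costL hW hu hj lam) (h.integrable_costL hW hv hj lam)]
  refine integral_congr_ae ?_
  filter_upwards [hu.ae_diffY_add h.hab hv hj, ae_restrict_mem measurableSet_Ioo] with y hy hy'
  simp only [h.linOp_add hy' hy, Pi.add_apply, mul_add, Finset.sum_add_distrib, add_mul]

/-- A homogeneous functional that grows at most quadratically is bounded. -/
lemma abs_le_mul_of_homogeneous {L α β r : ℝ} (hr : 0 ≤ r)
    (h : ∀ t > 0, t * r ≤ 1 → t * |L| ≤ α + β * (t * r) ^ 2) : |L| ≤ (α + β) * r := by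
  rcases hr.eq_or_lt with rfl | hr
  · have hα : 0 ≤ α := by
      have := h 1 one_pos (by simp)
      simp only [mul_zero, ne_eq, OfNat.ofNat_ne_zero, not_false_eq_true, zero_pow, add_zero,
        one_mul] at this
      exact (abs_nonneg L).trans this
    by_contra! hc
    rw [mul_zero] at hc
    -- For r = 0 every t > 0 is admissible, and this one would give α + 1 ≤ α.
    have := h ((α + 1) / |L|) (by positivity) (by simp)
    rw [div_mul_cancel₀ _ hc.ne'] at this
    simp only [mul_zero, ne_eq, OfNat.ofNat_ne_zero, not_false_eq_true, zero_pow, add_zero] at this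
    linarith
  · have := h (1 / r) (by positivity) (by rw [one_div, inv_mul_cancel₀ hr.ne'])
    rw [one_div, inv_mul_cancel₀ hr.ne', inv_mul_le_iff₀ hr] at this
    linarith

lemma exp_le_exp_right (hlam : 0 ≤ lam) {y : ℝ} (hy : y ∈ Ioo a b) :
    Real.exp (2 * lam * y) ≤ Real.exp (2 * lam * b) :=
  Real.exp_le_exp.2 (mul_le_mul_of_nonneg_left hy.2.le (by linarith))

lemma exp_left_le_exp (hlam : 0 ≤ lam) {y : ℝ} (hy : y ∈ Ioo a b) :
    Real.exp (2 * lam * a) ≤ Real.exp (2 * lam * y) :=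
  Real.exp_le_exp.2 (mul_le_mul_of_nonneg_left hy.1.le (by linarith))

/-- The weighted integral of a density that is dominated by the energy. -/
lemma MemH1.integral_mul_exp_le (hab : a < b) (hn : 1 ≤ n) (hv : MemH1 A a b v)
    (hj : IsInterior j) (hlam : 0 ≤ lam) {C : ℝ} (hC : 0 ≤ C) {f : ℝ → ℝ}
    (hf : IntegrableOn (fun y => f y * Real.exp (2 * lam * y)) (Ioo a b))
    (hle : ∀ᵐ y ∂volume.restrict (Ioo a b), f y ≤ C * energy A v j y) :
    ∫ y in Ioo a b, f y * Real.exp (2 * lam * y) ≤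
      Real.exp (2 * lam * b) * C * ((n + 2) * normH1 A a b v ^ 2) := by
  calc _ ≤ ∫ y in Ioo a b, Real.exp (2 * lam * b) * C * energy A v j y := by
        refine integral_mono_ae hf ((hv.integrable_energy hab hj).const_mul _) ?_
        filter_upwards [hle, ae_restrict_mem measurableSet_Ioo] with y h1 hy
        calc f y * Real.exp (2 * lam * y) ≤ C * energy A v j y * Real.exp (2 * lam * y) :=
              mul_le_mul_of_nonneg_right h1 (Real.exp_pos _).le
          _ ≤ C * energy A v j y * Real.exp (2 * lam * b) :=
              mul_le_mul_of_nonneg_left (exp_le_exp_right hlam hy)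
                (mul_nonneg hC (energy_nonneg _ _ _ _))
          _ = _ := by ring
    _ ≤ _ := by
        rw [integral_const_mul]
        exact mul_le_mul_of_nonneg_left (hv.integral_energy_le hab hn hj)
          (mul_nonneg (Real.exp_pos _).le hC)

/-- The pointwise bound of the linearization is available only for v in a bounded set. Increments of
norm at most 1 are treated with 2|r·l| ≤ |r|² + |l|², and homogeneity extends the resulting bound to
all v. -/
lemma Admissible.exists_costL_bound (h : Admissible A a b d κ M m K μs) (hW : MemH1 A a b W)
    (hlam : 0 ≤ lam) : ∃ C : ℝ, ∀ v, MemH1 A a b v →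
      |costL A a b d K μs lam W v| ≤ C * normH1 A a b v := by
  have hS := sobolevConst_nonneg a b
  have hW0 := normH1_nonneg (A := A) (a := a) (b := b) W
  have hρ : 0 ≤ sobolevConst a b * (normH1 A a b W + 1) := by positivity
  obtain ⟨C, hC0, hC⟩ := exists_expansion_bounds h.hA h.ha h.hab h.hd n N κ M (c₀ := 0)
    (fun x _ v => by rw [zero_mul]; exact nsq_nonneg _) hρ
  refine ⟨costJ A a b d K μs lam W +
    (interiorNodes n m).card * (Real.exp (2 * lam * b) * C * (n + 2)), fun v hv => ?_⟩
  refine abs_le_mul_of_homogeneous (normH1_nonneg v) fun t ht htr => ?_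
  have ht' : t * normH1 A a b v = normH1 A a b (t • v) := by
    rw [normH1_smul h.hab, abs_of_pos ht]
  rw [show t * |costL A a b d K μs lam W v| = |costL A a b d K μs lam W (t • v)| by
    rw [costL_smul, abs_mul, abs_of_pos ht]]
  rw [ht'] at htr ⊢
  have hu := hv.smul t
  set u := t • v
  have hl : ∀ j ∈ interiorNodes n m, IntegrableOn
      (fun y => nsq (linOp A a b d K μs W u j y) * Real.exp (2 * lam * y)) (Ioo a b) :=
    fun j hj => integrable_mul_exp (integrable_nsq fun s =>
      h.memLp_linOp hW hu (mem_interiorNodes.1 hj) s) lam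
  calc |costL A a b d K μs lam W u|
      ≤ ∑ j ∈ interiorNodes n m, ∫ y in Ioo a b,
        (nsq (residual A d K μs W j y) * Real.exp (2 * lam * y) +
          nsq (linOp A a b d K μs W u j y) * Real.exp (2 * lam * y)) := by
        refine (Finset.abs_sum_le_sum_abs _ _).trans (Finset.sum_le_sum fun j hj => ?_)
        have hj' := mem_interiorNodes.1 hj
        refine abs_integral_le_integral_abs.trans (integral_mono
          (h.integrable_costL hW hu hj' lam).abs
          ((h.integrable_residual hW hj' lam).add (hl j hj)) fun y => ?_)
        simp only [abs_mul _ (Real.exp _), Real.abs_exp, ← add_mul]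
        refine mul_le_mul_of_nonneg_right ?_ (Real.exp_pos _).le
        have h1 := nsq_add_sub (residual A d K μs W j y) (linOp A a b d K μs W u j y)
        have h2 := nsq_add_sub (residual A d K μs W j y) (-linOp A a b d K μs W u j y)
        simp only [nsq_neg, Pi.neg_apply, mul_neg, Finset.sum_neg_distrib] at h2
        rw [abs_le]
        constructor
        · linarith [nsq_nonneg (residual A d K μs W j y + linOp A a b d K μs W u j y)]
        · linarith [nsq_nonneg (residual A d K μs W j y + -linOp A a b d K μs W u j y)]
    _ ≤ costJ A a b d K μs lam W + ∑ _j ∈ interiorNodes n m,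
        Real.exp (2 * lam * b) * C * ((n + 2) * normH1 A a b u ^ 2) := by
        rw [costJ_eq h.hab, ← Finset.sum_add_distrib]
        refine Finset.sum_le_sum fun j hj => ?_
        have hj' := mem_interiorNodes.1 hj
        rw [integral_add (h.integrable_residual hW hj' lam) (hl j hj)]
        refine add_le_add le_rfl (hu.integral_mul_exp_le h.hab h.hn hj' hlam hC0 (hl j hj) ?_)
        filter_upwards [ae_restrict_mem measurableSet_Ioo] with y hy
        have hy' := Ioo_subset_Icc_self hy
        exact (hC m K μs h.hm h.hK h.hμ W u j y hy
          (hW.abs_le h.hab h.hn hj' hy' (by linarith))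
          (hu.abs_le h.hab h.hn hj' hy' (by linarith))).2.1
    _ = _ := by
        rw [Finset.sum_const, nsmul_eq_mul]; ring

/-- The remainder of the first order expansion of the cost functional is quadratic. -/
lemma Admissible.exists_remainder_bound (h : Admissible A a b d κ M m K μs) (hW : MemH1 A a b W)
    (hlam : 0 ≤ lam) : ∃ C : ℝ, 0 ≤ C ∧ ∀ v, MemH1 A a b v → normH1 A a b v ≤ 1 →
      |costJ A a b d K μs lam (W + v) - costJ A a b d K μs lam W - costL A a b d K μs lam W v| ≤
        C * normH1 A a b v ^ 2 := by
  have hS := sobolevConst_nonneg a b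
  have hW0 := normH1_nonneg (A := A) (a := a) (b := b) W
  have hba : 0 < b - a := sub_pos.2 h.hab
  have hρ : 0 ≤ sobolevConst a b * (normH1 A a b W + 1) := by positivity
  obtain ⟨C, hC0, hC⟩ := exists_expansion_bounds h.hA h.ha h.hab h.hd n N κ M (c₀ := 0)
    (fun x _ v => by rw [zero_mul]; exact nsq_nonneg _) hρ
  -- The squared Sobolev constant: it takes |v|² out of the integral, since the square of the
  -- residual is merely integrable.
  set s2 := 2 / (b - a) + 2 * (b - a) with hs2
  have hs20 : 0 ≤ s2 := by positivity
  set X := Real.exp (2 * lam * b) with hX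
  have hX0 : 0 < X := Real.exp_pos _
  have hR0 : ∀ j, 0 ≤ ∫ y in Ioo a b, (nsq (residual A d K μs W j y) + C) := fun j =>
    integral_nonneg fun y => add_nonneg (nsq_nonneg _) hC0
  refine ⟨∑ j ∈ interiorNodes n m, (X * (C * (n + 2)) +
    X * s2 * ∫ y in Ioo a b, (nsq (residual A d K μs W j y) + C)),
    Finset.sum_nonneg fun j _ => add_nonneg (by positivity)
      (mul_nonneg (by positivity) (hR0 j)), fun v hv hv1 => ?_⟩
  rw [h.cost_expansion hW hv, Finset.sum_mul]
  refine (Finset.abs_sum_le_sum_abs _ _).trans (Finset.sum_le_sum fun j hj => ?_)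
  have hj' := mem_interiorNodes.1 hj
  have hrC : Integrable (fun y => nsq (residual A d K μs W j y) + C)
      (volume.restrict (Ioo a b)) := (h.integrable_nsq_residual hW hj').add (integrable_const C)
  have hE := hv.integrable_energy h.hab hj'
  calc |∫ y in Ioo a b, remDens A a b d K μs lam W v j y|
      ≤ ∫ y in Ioo a b, (X * C * energy A v j y +
        X * s2 * normH1 A a b v ^ 2 * (nsq (residual A d K μs W j y) + C)) := by
        refine abs_integral_le_integral_abs.trans (setIntegral_mono_on
          (h.integrable_remDens hW hv hj' lam).abs
          ((hE.const_mul _).add (hrC.const_mul _)) measurableSet_Ioo fun y hy => ?_)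
        have hy' := Ioo_subset_Icc_self hy
        obtain ⟨-, -, h3, h4, -⟩ := hC m K μs h.hm h.hK h.hμ W v j y hy
          (hW.abs_le h.hab h.hn hj' hy' (by linarith))
          (hv.abs_le h.hab h.hn hj' hy' (by linarith))
        have h5 := abs_two_mul_sum_le (r := residual A d K μs W j y) hC0 (nsq_nonneg _) h3
        have h6 := hv.nsq_le h.hab h.hn hj' hy'
        have h7 := nsq_nonneg (residual A d K μs W j y)
        have h8 : (nsq (residual A d K μs W j y) + C) * nsq (v j y) ≤
            (nsq (residual A d K μs W j y) + C) * (s2 * normH1 A a b v ^ 2) := by gcongr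
        have h9 := nsq_nonneg (linOp A a b d K μs W v j y + remOp A a b d K μs W v j y)
        rw [remDens, abs_mul, Real.abs_exp]
        have h10 : |nsq (linOp A a b d K μs W v j y + remOp A a b d K μs W v j y) +
            2 * ∑ s, residual A d K μs W j y s * remOp A a b d K μs W v j y s| ≤
            C * energy A v j y +
              (nsq (residual A d K μs W j y) + C) * (s2 * normH1 A a b v ^ 2) := by
          refine (abs_add_le _ _).trans (add_le_add ?_ (h5.trans h8))
          rwa [abs_of_nonneg h9]
        refine (mul_le_mul h10 (exp_le_exp_right hlam hy) (Real.exp_pos _).le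
          ((abs_nonneg _).trans h10)).trans (le_of_eq ?_)
        ring
    _ = X * C * (∫ y in Ioo a b, energy A v j y) + X * s2 * normH1 A a b v ^ 2 *
        ∫ y in Ioo a b, (nsq (residual A d K μs W j y) + C) := by
        rw [integral_add (hE.const_mul _) (hrC.const_mul _), integral_const_mul,
          integral_const_mul]
    _ ≤ X * C * ((n + 2) * normH1 A a b v ^ 2) + X * s2 * normH1 A a b v ^ 2 *
        ∫ y in Ioo a b, (nsq (residual A d K μs W j y) + C) := by
        gcongr
        exact hv.integral_energy_le h.hab h.hn hj'
    _ = _ := by ring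

lemma Admissible.isFrechetDeriv (h : Admissible A a b d κ M m K μs) (hW : MemH1 A a b W)
    (hlam : 0 ≤ lam) :
    IsFrechetDeriv A a b (costJ A a b d K μs lam) W (costL A a b d K μs lam W) where
  add u v hu hv := h.costL_add hW hu.1 hv.1 lam
  smul t v _ := costL_smul t W v
  bounded := by
    obtain ⟨C, hC⟩ := h.exists_costL_bound hW hlam
    exact ⟨C, fun v hv => hC v hv.1⟩
  littleO ε hε := by
    obtain ⟨C, hC0, hC⟩ := h.exists_remainder_bound hW hlam
    refine ⟨min 1 (ε / (C + 1)), by positivity, fun v hv hη => ?_⟩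
    refine (hC v hv.1 (hη.trans (min_le_left _ _))).trans ?_
    have h0 := normH1_nonneg (A := A) (a := a) (b := b) v
    rw [sq, ← mul_assoc]
    refine mul_le_mul_of_nonneg_right ?_ h0
    have h1 := hη.trans (min_le_right _ _)
    rw [le_div_iff₀ (by positivity)] at h1
    nlinarith

end Cost

end RTE

/-! ### Strong convexity from the Carleman estimates; cost near a solution. -/

namespace RTE

/-! ### Strong convexity of the cost functional -/

section Convexity

variable {n m N : ℕ} {A a b d κ M lam h₀ : ℝ} {K : Pt n → ℝ → ℝ → ℝ} {μs : Pt n → ℝ}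
  {W v : VecFun n m N} {j : Node n m}

/-- The weighted squared norm of the `y`-derivative at a node. -/
noncomputable def wDeriv (a b lam : ℝ) (v : VecFun n m N) (j : Node n m) : ℝ :=
  ∫ y in Ioo a b, nsq (diffY v j y) * Real.exp (2 * lam * y)

lemma wDeriv_nonneg (v : VecFun n m N) (j : Node n m) : 0 ≤ wDeriv a b lam v j :=
  integral_nonneg fun _ => mul_nonneg (nsq_nonneg _) (Real.exp_pos _).le

lemma MemH1.integrable_sq_exp (hab : a < b) (hv : MemH1 A a b v) (hj : IsInterior j) (s : Fin N)
    (lam : ℝ) : IntegrableOn (fun y => v j y s ^ 2 * Real.exp (2 * lam * y)) (Ioo a b) :=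
  integrable_mul_exp (hv.memLp hab hj s).integrable_sq lam

lemma MemH1.wDeriv_eq (hv : MemH1 A a b v) (hj : IsInterior j) (lam : ℝ) : wDeriv a b lam v j =
    ∑ s, ∫ y in Ioo a b, diffY v j y s ^ 2 * Real.exp (2 * lam * y) := by
  simp only [wDeriv, nsq, Finset.sum_mul]
  exact integral_finsetSum _ fun s _ => integrable_mul_exp (hv.memLp_diffY hj s).integrable_sq lam

lemma MemH10.zero_left (hab : a < b) (hv : MemH10 A a b v) (j : Node n m) (s : Fin N) :
    v j a s = 0 := by
  rw [hv.2 j a (left_mem_Icc.2 hab.le) (Or.inr (Or.inl rfl))]; rfl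

lemma MemH10.zero_right (hab : a < b) (hv : MemH10 A a b v) (j : Node n m) (s : Fin N) :
    v j b s = 0 := by
  rw [hv.2 j b (right_mem_Icc.2 hab.le) (Or.inr (Or.inr rfl))]; rfl

lemma MemH10.carleman (hab : a < b) (hv : MemH10 A a b v) (hj : IsInterior j) (hlam : 0 < lam) :
    ∫ y in Ioo a b, nsq (v j y) * Real.exp (2 * lam * y) ≤ 1 / lam ^ 2 * wDeriv a b lam v j := by
  rw [hv.1.wDeriv_eq hj, Finset.mul_sum]
  simp only [nsq, Finset.sum_mul]
  rw [integral_finsetSum _ fun s _ => hv.1.integrable_sq_exp hab hj s lam]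
  refine Finset.sum_le_sum fun s _ => ?_
  have h := RTE.carleman hab (hv.1.ac hj s) (hv.1.memLp_diffY hj s) (hv.zero_left hab j s)
    (hv.zero_right hab j s) hlam
  rw [one_div, inv_mul_eq_div, le_div_iff₀ (by positivity), mul_comm]
  exact h

lemma MemH10.carleman_sup (hab : a < b) (hv : MemH10 A a b v) (hj : IsInterior j)
    (hlam : 0 < lam) {y : ℝ} (hy : y ∈ Icc a b) :
    nsq (v j y) * Real.exp (2 * lam * y) ≤ 4 / lam * wDeriv a b lam v j := by
  rw [hv.1.wDeriv_eq hj, Finset.mul_sum]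
  simp only [nsq, Finset.sum_mul]
  exact Finset.sum_le_sum fun s _ => RTE.carleman_sup hab (hv.1.ac hj s) (hv.1.memLp_diffY hj s)
    (hv.zero_left hab j s) (hv.zero_right hab j s) hlam hy

lemma MemH1.integrable_totSq (hab : a < b) (hv : MemH1 A a b v) :
    IntegrableOn (totSq v) (Ioo a b) :=
  integrable_finsetSum _ fun _ hj => hv.integrable_val hab (mem_interiorNodes.1 hj)

lemma MemH10.integral_totSq_le (hab : a < b) (hv : MemH10 A a b v) (hlam : 0 < lam) :
    ∫ y in Ioo a b, totSq v y * Real.exp (2 * lam * y) ≤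
      1 / lam ^ 2 * ∑ j ∈ interiorNodes n m, wDeriv a b lam v j := by
  simp only [totSq, Finset.sum_mul]
  rw [integral_finsetSum _ fun j hj =>
    integrable_mul_exp (hv.1.integrable_val hab (mem_interiorNodes.1 hj)) lam, Finset.mul_sum]
  exact Finset.sum_le_sum fun j hj => hv.carleman hab (mem_interiorNodes.1 hj) hlam

/-- The weight is smallest at y = a; the factor e^{2λa} in the convexity inequality comes from here.
-/
lemma MemH1.le_wDeriv (hv : MemH1 A a b v) (hlam : 0 ≤ lam) :
    Real.exp (2 * lam * a) * derivSq a b v ≤ ∑ j ∈ interiorNodes n m, wDeriv a b lam v j := by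
  rw [derivSq, Finset.mul_sum]
  refine Finset.sum_le_sum fun j hj => ?_
  have hj' := mem_interiorNodes.1 hj
  rw [← integral_const_mul]
  refine setIntegral_mono_on ((hv.integrable_diffY hj').const_mul _)
    (integrable_mul_exp (hv.integrable_diffY hj') lam) measurableSet_Ioo fun y hy => ?_
  rw [mul_comm]
  exact mul_le_mul_of_nonneg_left (exp_left_le_exp hlam hy) (nsq_nonneg _)

/-- The uniform bound of the residual on bounded sets. -/
lemma Admissible.integral_residual_le (h : Admissible A a b d κ M m K μs) (hW : MemH1 A a b W)
    (hj : IsInterior j) {C R : ℝ} (hC0 : 0 ≤ C) (hR : normH1 A a b W ≤ R)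
    (hC : ∀ y ∈ Ioo a b, nsq (residual A d K μs W j y) ≤ C * (energy A W j y + 1)) :
    ∫ y in Ioo a b, nsq (residual A d K μs W j y) ≤ C * ((n + 2) * R ^ 2 + (b - a)) := by
  have h0 := normH1_nonneg (A := A) (a := a) (b := b) W
  have hE := hW.integrable_energy h.hab hj
  calc _ ≤ ∫ y in Ioo a b, C * (energy A W j y + 1) :=
        setIntegral_mono_on (h.integrable_nsq_residual hW hj)
          ((hE.add (integrable_const 1)).const_mul C) measurableSet_Ioo hC
    _ = C * ((∫ y in Ioo a b, energy A W j y) + (b - a)) := by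
        rw [integral_const_mul, integral_add hE (integrable_const 1)]
        simp [max_eq_left (sub_nonneg.2 h.hab.le)]
    _ ≤ C * ((n + 2) * normH1 A a b W ^ 2 + (b - a)) := by
        gcongr
        exact hW.integral_energy_le h.hab h.hn hj
    _ ≤ _ := by gcongr

/-- Strong convexity of the cost functional on bounded sets, for large `λ`. -/
lemma exists_strong_convexity (hA : 0 < A) (hd : 0 < d) (ha : 1 ≤ a) (hab : a < b) (hn : 1 ≤ n)
    (N : ℕ) {c₀ : ℝ} (hc₀ : 0 < c₀)
    (hD : ∀ x ∈ closedPrism n A a b, ∀ v : Fin N → ℝ, c₀ * nsq v ≤ nsq ((matD d N x).mulVec v))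
    (hh₀ : 0 < h₀) (κ M : ℝ) {R : ℝ} (hR : 0 ≤ R) :
    ∃ Λ : ℝ, 1 ≤ Λ ∧ ∃ c > 0, ∀ m : ℕ, h₀ ≤ step A m →
      ∀ (K : Pt n → ℝ → ℝ → ℝ) (μs : Pt n → ℝ), Admissible A a b d κ M m K μs →
      ∀ lam ≥ Λ, ∀ W v : VecFun n m N, MemH1 A a b W → MemH10 A a b v → normH1 A a b W ≤ R →
        normH1 A a b v ≤ 2 * R →
        c * Real.exp (2 * lam * a) * normH1 A a b v ^ 2 ≤
          costJ A a b d K μs lam (W + v) - costJ A a b d K μs lam W -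
            costL A a b d K μs lam W v := by
  have hS := sobolevConst_nonneg a b
  have hba : 0 < b - a := sub_pos.2 hab
  -- One radius for both W, of norm at most R, and an increment, of norm at most 2R.
  have hρ : 0 ≤ sobolevConst a b * (2 * R) := by positivity
  obtain ⟨C, hC0, hC⟩ := exists_expansion_bounds hA ha hab hd n N κ M hD hρ
  -- cR bounds the unweighted integral of |residual|² + C on the ball, cT collects the terms of
  -- order zero, cS gathers all that must be absorbed, and cN compares the full norm with v_y. None
  -- of them depends on λ.
  set cR := C * ((n + 2) * R ^ 2 + (b - a)) + C * (b - a) with hcR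
  have hcR0 : 0 ≤ cR := by positivity
  set cT := C * (n * (1 / h₀ ^ 2) + 1) with hcT
  have hcT0 : 0 ≤ cT := by positivity
  set card := (2 * A / h₀ + 1) ^ n with hcard
  have hcard0 : 0 ≤ card := by positivity
  set cS := cT * card + 4 * cR with hcS
  have hcS0 : 0 ≤ cS := by positivity
  set cN := card * n * ((b - a) ^ 2 * (1 + 1 / h₀ ^ 2)) + n with hcN
  have hn0 : (0 : ℝ) < n := by exact_mod_cast hn
  have hcN0 : 0 < cN := by positivity
  have hq : 0 ≤ 4 * cS / c₀ := by positivity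
  -- λ ≥ 4cS/c₀ makes the absorbed terms at most c₀/4 of the weighted |v_y|², out of the available
  -- c₀/2. The remaining c₀/4 divided by cN is the modulus.
  refine ⟨1 + 4 * cS / c₀, by linarith, c₀ / (4 * cN), by positivity, fun m hh K μs h lam hlam W v hW hv hWR hvR => ?_⟩
  have hlam1 : 1 ≤ lam := by linarith
  have hlam0 : 0 < lam := by linarith
  set E := ∑ j ∈ interiorNodes n m, wDeriv a b lam v j with hE
  have hE0 : 0 ≤ E := Finset.sum_nonneg fun j _ => wDeriv_nonneg v j
  have hT := hv.integral_totSq_le hab hlam0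
  set T := ∫ y in Ioo a b, totSq v y * Real.exp (2 * lam * y) with hTdef
  -- At a single node: the coercive term, minus the terms of order zero, which involve neighbouring
  -- nodes through `totSq`, minus the residual times the Taylor remainder. In the last one the
  -- weight is used up by the supremum estimate, so the residual enters unweighted.
  have hnode : ∀ j ∈ interiorNodes n m,
      c₀ / 2 * wDeriv a b lam v j - cT * T - 4 / lam * wDeriv a b lam v j * cR ≤
        ∫ y in Ioo a b, remDens A a b d K μs lam W v j y := by
    intro j hj
    have hj' := mem_interiorNodes.1 hj
    set Ej := wDeriv a b lam v j with hEj
    have hEj0 : 0 ≤ Ej := wDeriv_nonneg v j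
    have hexp : ∀ y ∈ Ioo a b, _ := fun y (hy : y ∈ Ioo a b) =>
      hC m K μs h.hm h.hK h.hμ W v j y hy
        (hW.abs_le hab hn hj' (Ioo_subset_Icc_self hy) (by linarith))
        (hv.1.abs_le hab hn hj' (Ioo_subset_Icc_self hy) hvR)
    have hres := h.integral_residual_le hW hj' hC0 hWR fun y hy => (hexp y hy).1
    have i1 := integrable_mul_exp (hv.1.integrable_diffY hj') lam
    have i2 := integrable_mul_exp (hv.1.integrable_totSq hab) lam
    have i3 : Integrable (fun y => nsq (residual A d K μs W j y) + C)
      (volume.restrict (Ioo a b)) := (h.integrable_nsq_residual hW hj').add (integrable_const C)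
    have i12 : Integrable (fun y => c₀ / 2 * (nsq (diffY v j y) * Real.exp (2 * lam * y)) -
        cT * (totSq v y * Real.exp (2 * lam * y))) (volume.restrict (Ioo a b)) :=
      (i1.const_mul _).sub (i2.const_mul _)
    have i4 : Integrable (fun y => 4 / lam * Ej * (nsq (residual A d K μs W j y) + C))
      (volume.restrict (Ioo a b)) := i3.const_mul _
    calc _ ≤ ∫ y in Ioo a b, (c₀ / 2 * (nsq (diffY v j y) * Real.exp (2 * lam * y)) -
          cT * (totSq v y * Real.exp (2 * lam * y)) -
          4 / lam * Ej * (nsq (residual A d K μs W j y) + C)) := by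
          rw [integral_sub i12 i4, integral_sub (i1.const_mul _) (i2.const_mul _),
            integral_const_mul, integral_const_mul, integral_const_mul,
            integral_add (h.integrable_nsq_residual hW hj') (integrable_const C)]
          refine sub_le_sub_left (mul_le_mul_of_nonneg_left ?_ (by positivity)) _
          simp only [integral_const, MeasurableSet.univ, measureReal_restrict_apply, univ_inter,
            Real.volume_real_Ioo_of_le hab.le, smul_eq_mul]
          rw [hcR]; linarith
      _ ≤ _ := by
          refine setIntegral_mono_on (i12.sub i4) (h.integrable_remDens hW hv.1 hj' lam)
            measurableSet_Ioo fun y hy => ?_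
          have hy' := Ioo_subset_Icc_self hy
          obtain ⟨-, -, h3, -, h5⟩ := hexp y hy
          have h6 := abs_two_mul_sum_le (r := residual A d K μs W j y) hC0 (nsq_nonneg _) h3
          have h7 := (abs_le.1 h6).1
          have h8 : (∑ i, nsq (diffX A i v j y)) + nsq (v j y) ≤
              (n * (1 / h₀ ^ 2) + 1) * totSq v y := by
            have h9 := nsq_le_totSq hv.2 hy' j
            have h10 : ∑ i, nsq (diffX A i v j y) ≤ n * (1 / h₀ ^ 2 * totSq v y) := by
              simpa using Finset.sum_le_sum (s := Finset.univ) fun i _ =>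
                nsq_diffX_le hh₀ hh hv.2 hy' j i
            linarith
          have h9 : C * ((∑ i, nsq (diffX A i v j y)) + nsq (v j y)) ≤ cT * totSq v y := by
            rw [hcT, mul_assoc]; gcongr
          have h10 := hv.carleman_sup hab hj' hlam0 hy'
          have h11 : 0 ≤ nsq (residual A d K μs W j y) + C := add_nonneg (nsq_nonneg _) hC0
          have h12 := mul_le_mul_of_nonneg_left h10 h11
          have h13 : c₀ / 2 * nsq (diffY v j y) - cT * totSq v y -
              (nsq (residual A d K μs W j y) + C) * nsq (v j y) ≤
              nsq (linOp A a b d K μs W v j y + remOp A a b d K μs W v j y) +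
              2 * ∑ s, residual A d K μs W j y s * remOp A a b d K μs W v j y s := by
            linarith
          have h14 := mul_le_mul_of_nonneg_right h13 (Real.exp_pos (2 * lam * y)).le
          rw [remDens]
          linarith
  rw [h.cost_expansion hW hv.1]
  -- With λ ≥ 1 the gain λ⁻² of the terms of order zero is weakened to λ⁻¹, to match the supremum
  -- estimate.
  have hlamsq : 1 / lam ^ 2 ≤ 1 / lam := by
    refine one_div_le_one_div_of_le hlam0 ?_
    nlinarith
  have hcardle := card_interiorNodes_le (n := n) hh₀ h.hm hh
  have hsum : c₀ / 2 * E - cT * T * card - 4 / lam * E * cR ≤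
      ∑ j ∈ interiorNodes n m, ∫ y in Ioo a b, remDens A a b d K μs lam W v j y := by
    have hT0 : 0 ≤ T := integral_nonneg fun y => mul_nonneg (totSq_nonneg _ _) (Real.exp_pos _).le
    calc c₀ / 2 * E - cT * T * card - 4 / lam * E * cR
        ≤ c₀ / 2 * E - cT * T * (interiorNodes n m).card - 4 / lam * E * cR := by gcongr
      _ = ∑ j ∈ interiorNodes n m,
          (c₀ / 2 * wDeriv a b lam v j - cT * T - 4 / lam * wDeriv a b lam v j * cR) := by
          simp only [Finset.sum_sub_distrib, ← Finset.mul_sum, ← Finset.sum_mul, Finset.sum_const,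
            nsmul_eq_mul, hE]
          ring
      _ ≤ _ := Finset.sum_le_sum hnode
  have h1 : cT * T * card ≤ cT * (1 / lam * E) * card := by
    have : T ≤ 1 / lam * E := hT.trans (mul_le_mul_of_nonneg_right hlamsq hE0)
    gcongr
  have h2 : cS / lam ≤ c₀ / 4 := by
    rw [div_le_iff₀ hlam0]
    have : 4 * cS / c₀ ≤ lam := by linarith
    rw [div_le_iff₀ hc₀] at this
    linarith
  have h3 : c₀ / 4 * E ≤ c₀ / 2 * E - cT * T * card - 4 / lam * E * cR := by
    have h4 := mul_le_mul_of_nonneg_right h2 hE0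
    have h5 : cT * (1 / lam * E) * card + 4 / lam * E * cR = cS / lam * E := by
      rw [hcS]; field_simp
    linarith
  refine le_trans ?_ (h3.trans hsum)
  have h6 := hv.1.le_wDeriv (lam := lam) hlam0.le
  have h7 := hv.normH1_sq_le hab hh₀ h.hm hh
  calc c₀ / (4 * cN) * Real.exp (2 * lam * a) * normH1 A a b v ^ 2
      ≤ c₀ / (4 * cN) * Real.exp (2 * lam * a) * (cN * derivSq a b v) := by gcongr
    _ = c₀ / 4 * (Real.exp (2 * lam * a) * derivSq a b v) := by field_simp
    _ ≤ _ := by gcongr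

/-- The cost functional is small near a solution. -/
lemma exists_cost_le (hA : 0 < A) (hd : 0 < d) (ha : 1 ≤ a) (hab : a < b)
    (N : ℕ) (hh₀ : 0 < h₀) (κ M : ℝ) {R lam : ℝ} (hR : 0 ≤ R) (hlam : 0 ≤ lam) :
    ∃ C : ℝ, 0 ≤ C ∧ ∀ m : ℕ, h₀ ≤ step A m →
      ∀ (K : Pt n → ℝ → ℝ → ℝ) (μs : Pt n → ℝ), Admissible A a b d κ M m K μs →
      ∀ W v : VecFun n m N, MemH1 A a b W → MemH1 A a b v → normH1 A a b W ≤ R →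
        normH1 A a b v ≤ R → IsSolution A a b d K μs W →
        costJ A a b d K μs lam (W + v) ≤ C * normH1 A a b v ^ 2 := by
  have hS := sobolevConst_nonneg a b
  have hρ : 0 ≤ sobolevConst a b * R := by positivity
  obtain ⟨C, hC0, hC⟩ := exists_expansion_bounds hA ha hab hd n N κ M (c₀ := 0)
    (fun x _ v => by rw [zero_mul]; exact nsq_nonneg _) hρ
  -- The factor e^{2λb} is harmless because λ is fixed before the constant. Here v need not vanish
  -- on the boundary, so its differences are estimated by the norm itself.
  refine ⟨(2 * A / h₀ + 1) ^ n * (Real.exp (2 * lam * b) * C * (n + 2)), by positivity,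
    fun m hh K μs h W v hW hv hWR hvR hsol => ?_⟩
  have hcard := card_interiorNodes_le (n := n) hh₀ h.hm hh
  rw [costJ_eq hab]
  calc _ ≤ ∑ _j ∈ interiorNodes n m,
        Real.exp (2 * lam * b) * C * ((n + 2) * normH1 A a b v ^ 2) := by
        refine Finset.sum_le_sum fun j hj => ?_
        have hj' := mem_interiorNodes.1 hj
        refine hv.integral_mul_exp_le hab h.hn hj' hlam hC0
          (h.integrable_residual (hW.add hab hv) hj' lam) ?_
        filter_upwards [hW.ae_diffY_add hab hv hj', hsol j hj', ae_restrict_mem measurableSet_Ioo]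
          with y h1 h2 hy
        have hy' := Ioo_subset_Icc_self hy
        -- At an exact solution the residual of W drops out, leaving only terms at least linear in
        -- v.
        rw [residual_add (a := a) (b := b) h1, h2, zero_add]
        exact (hC m K μs h.hm h.hK h.hμ W v j y hy (hW.abs_le hab h.hn hj' hy' hWR)
          (hv.abs_le hab h.hn hj' hy' hvR)).2.2.2.1
    _ = (interiorNodes n m).card * (Real.exp (2 * lam * b) * C * (n + 2)) *
        normH1 A a b v ^ 2 := by rw [Finset.sum_const, nsmul_eq_mul]; ring
    _ ≤ _ := by gcongr

end Convexity

end RTE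

/-! ### Completeness and the direct method. -/

namespace RTE

/-! ### Completeness of the space of functions vanishing on the boundary -/

section Complete

open Filter Topology

variable {n m N : ℕ} {A a b : ℝ}

lemma norm_toLp_sq {f : ℝ → ℝ} {μ : Measure ℝ} (hf : MemLp f 2 μ) :
    ‖hf.toLp f‖ ^ 2 = ∫ y, f y ^ 2 ∂μ := by
  rw [← real_inner_self_eq_norm_sq, L2.inner_def]
  refine integral_congr_ae ?_
  filter_upwards [hf.coeFn_toLp] with y hy
  rw [hy, real_inner_self_eq_norm_sq, Real.norm_eq_abs, sq_abs]

/-- Completeness of `H^1_0(a, b)`. -/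
lemma exists_limit_of_cauchy (hab : a < b) {f : ℕ → ℝ → ℝ}
    (hac : ∀ k, AbsolutelyContinuousOnInterval (f k) a b)
    (hL : ∀ k, MemLp (deriv (f k)) 2 (volume.restrict (Ioo a b)))
    (h0 : ∀ k, f k a = 0) (h1 : ∀ k, f k b = 0)
    (hC : ∀ ε > 0, ∃ K, ∀ k ≥ K, ∀ l ≥ K,
      ∫ y in Ioo a b, (deriv (f k) y - deriv (f l) y) ^ 2 < ε ^ 2) :
    ∃ g : ℝ → ℝ, AbsolutelyContinuousOnInterval g a b ∧
      MemLp (deriv g) 2 (volume.restrict (Ioo a b)) ∧ g a = 0 ∧ g b = 0 ∧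
      Tendsto (fun k => ∫ y in Ioo a b, (deriv (f k) y - deriv g y) ^ 2) atTop (𝓝 0) := by
  set μ := volume.restrict (Ioo a b) with hμ
  have hcau : CauchySeq fun k => (hL k).toLp (deriv (f k)) := by
    rw [Metric.cauchySeq_iff]
    intro ε hε
    obtain ⟨K, hK⟩ := hC ε hε
    refine ⟨K, fun k hk l hl => ?_⟩
    rw [dist_eq_norm, ← MemLp.toLp_sub]
    refine lt_of_pow_lt_pow_left₀ 2 hε.le ?_
    rw [norm_toLp_sq]
    exact hK k hk l hl
  -- The derivatives converge in L² to G; the limit function is the primitive of G that vanishes at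
  -- a.
  obtain ⟨G, hG⟩ := cauchySeq_tendsto_of_complete hcau
  have hGL : MemLp G 2 μ := Lp.memLp G
  have hGi : IntervalIntegrable G volume a b := by
    rw [intervalIntegrable_iff_Ioo hab.le]
    exact hGL.integrable (by norm_num)
  set g : ℝ → ℝ := fun y => ∫ t in a..y, G t with hg
  have hgac : AbsolutelyContinuousOnInterval g a b :=
    hGi.absolutelyContinuousOnInterval_intervalIntegral left_mem_uIcc
  have hder : deriv g =ᵐ[μ] G := by
    filter_upwards [ae_restrict_of_ae hGi.ae_hasDerivAt_integral,
      ae_restrict_mem measurableSet_Ioo] with y hy hy'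
    have hy2 : y ∈ uIcc a b := by rw [uIcc_of_le hab.le]; exact Ioo_subset_Icc_self hy'
    exact (hy hy2 a left_mem_uIcc).deriv
  have hlim : Tendsto (fun k => ∫ y, (deriv (f k) y - deriv g y) ^ 2 ∂μ) atTop (𝓝 0) := by
    have h2 : Tendsto (fun k => ‖(hL k).toLp (deriv (f k)) - G‖ ^ 2) atTop (𝓝 0) := by
      have := (tendsto_iff_norm_sub_tendsto_zero.1 hG).pow 2
      simpa using this
    refine h2.congr fun k => ?_
    have h3 : (hL k).toLp (deriv (f k)) - G = ((hL k).sub hGL).toLp (deriv (f k) - (G : ℝ → ℝ)) := by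
      rw [MemLp.toLp_sub (hL k) hGL, Lp.toLp_coeFn G hGL]
    rw [h3, norm_toLp_sq]
    refine integral_congr_ae ?_
    filter_upwards [hder] with y hy
    rw [hy, Pi.sub_apply]
  have hgL : MemLp (deriv g) 2 μ := hGL.ae_eq hder.symm
  refine ⟨g, hgac, hgL, by simp [hg], ?_, hlim⟩
  -- The value at b also vanishes: g(b) is the integral of g', and each f_k' has integral zero.
  have hb : ∀ k, g b ^ 2 ≤ (b - a) * ∫ y in Ioo a b, (deriv (f k) y - deriv g y) ^ 2 := by
    intro k
    have h2 := sq_integral_le hab ((hL k).sub hgL)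
    have h3 : ∫ y in Ioo a b, (deriv (f k) - deriv g) y = -g b := by
      have h4 := (hac k).integral_deriv_eq_sub
      have h5 := hgac.integral_deriv_eq_sub
      rw [intervalIntegral_eq_Ioo hab.le] at h4 h5
      have h6 : g a = 0 := by simp [hg]
      calc _ = (∫ y in Ioo a b, deriv (f k) y) - ∫ y in Ioo a b, deriv g y :=
            integral_sub ((hL k).integrable (by norm_num)) (hgL.integrable (by norm_num))
        _ = -g b := by rw [h4, h5, h0, h1, h6]; ring
    rw [h3, neg_sq] at h2
    exact h2
  have h2 : g b ^ 2 ≤ (b - a) * 0 :=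
    ge_of_tendsto' (hlim.const_mul (b - a)) hb
  rw [mul_zero] at h2
  exact pow_eq_zero_iff two_ne_zero |>.1 (le_antisymm h2 (sq_nonneg _))

lemma diffY_sub_ae (hab : a < b) {u v : VecFun n m N} (hu : MemH1 A a b u) (hv : MemH1 A a b v)
    {j : Node n m} (hj : IsInterior j) : ∀ᵐ y ∂volume.restrict (Ioo a b),
      diffY (u - v) j y = diffY u j y - diffY v j y := by
  have h := hu.ae_diffY_add hab (hv.smul (-1)) hj
  filter_upwards [h] with y hy
  rw [diffY_smul] at hy
  rw [sub_eq_add_neg u v, ← neg_one_smul ℝ v, hy]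
  simp [sub_eq_add_neg]

/-- There are finitely many nodes and components, so limits are taken one by one and set to zero at
boundary nodes. Convergence of the y-derivatives suffices, as they control the whole norm on
functions with zero boundary values. -/
lemma exists_limit_memH10 (hA : 0 < A) (hab : a < b) (hn : 1 ≤ n) (hm : 1 < m)
    {v : ℕ → VecFun n m N} (hv : ∀ k, MemH10 A a b (v k))
    (hC : ∀ ε > 0, ∃ K, ∀ k ≥ K, ∀ l ≥ K, normH1 A a b (v k - v l) < ε) :
    ∃ u, MemH10 A a b u ∧ Tendsto (fun k => normH1 A a b (v k - u)) atTop (𝓝 0) := by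
  classical
  have hex : ∀ j : Node n m, IsInterior j → ∀ s : Fin N, ∃ g : ℝ → ℝ,
      AbsolutelyContinuousOnInterval g a b ∧
      MemLp (deriv g) 2 (volume.restrict (Ioo a b)) ∧ g a = 0 ∧ g b = 0 ∧
      Tendsto (fun k => ∫ y in Ioo a b, (diffY (v k) j y s - deriv g y) ^ 2) atTop (𝓝 0) := by
    intro j hj s
    refine exists_limit_of_cauchy hab (f := fun k y => v k j y s) (fun k => (hv k).1.ac hj s)
      (fun k => (hv k).1.memLp_diffY hj s) (fun k => (hv k).zero_left hab j s)
      (fun k => (hv k).zero_right hab j s) fun ε hε => ?_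
    obtain ⟨K, hK⟩ := hC ε hε
    refine ⟨K, fun k hk l hl => ?_⟩
    have h1 := hK k hk l hl
    have hkl := (hv k).1.sub hab (hv l).1
    have h2 := hkl.integral_diffY_le hab hn hj
    calc ∫ y in Ioo a b, (deriv (fun y => v k j y s) y - deriv (fun y => v l j y s) y) ^ 2
        = ∫ y in Ioo a b, diffY (v k - v l) j y s ^ 2 := by
          refine integral_congr_ae ?_
          filter_upwards [diffY_sub_ae hab (hv k).1 (hv l).1 hj] with y hy
          rw [hy]; rfl
      _ ≤ ∫ y in Ioo a b, nsq (diffY (v k - v l) j y) :=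
          integral_mono (hkl.memLp_diffY hj s).integrable_sq (hkl.integrable_diffY hj)
            fun y => sq_le_nsq _ s
      _ ≤ normH1 A a b (v k - v l) ^ 2 := h2
      _ < ε ^ 2 := pow_lt_pow_left₀ h1 (normH1_nonneg _) two_ne_zero
  choose g hgac hgL hga hgb hglim using hex
  set u : VecFun n m N := fun j y s => if hj : IsInterior j then g j hj s y else 0 with hu
  have hui : ∀ (j : Node n m) (hj : IsInterior j) (s : Fin N), (fun y => u j y s) = g j hj s := by
    intro j hj s; ext y; simp [hu, hj]
  have huac : ∀ (j : Node n m) (s : Fin N),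
      AbsolutelyContinuousOnInterval (fun y => u j y s) a b := by
    intro j s
    by_cases hj : IsInterior j
    · rw [hui j hj s]; exact hgac j hj s
    · simp only [hu, hj, dif_neg, not_false_eq_true]
      exact (contDiff_const.contDiffOn).absolutelyContinuousOnInterval
  have hmem : MemH10 A a b u := by
    refine ⟨fun j hj s => ⟨huac j s, ?_, fun i => ?_⟩, fun j y hy hb => ?_⟩
    · simp only [diffY, hui j hj s]; exact hgL j hj s
    · have h1 := ac_memLp hab (huac (Function.update j i (j i + 1)) s)
      have h2 := ac_memLp hab (huac (Function.update j i (j i - 1)) s)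
      refine ((h1.sub h2).const_mul (1 / (2 * step A m))).ae_eq
        (Filter.Eventually.of_forall fun y => ?_)
      simp only [diffX, Pi.sub_apply]; ring
    · ext s
      by_cases hj : IsInterior j
      · have : u j y s = g j hj s y := congrFun (hui j hj s) y
        rcases hb with hb | rfl | rfl
        · exact absurd hj hb
        · rw [this, hga]; rfl
        · rw [this, hgb]; rfl
      · simp [hu, hj]
  refine ⟨u, hmem, ?_⟩
  have hm0 : (0 : ℝ) < m := by exact_mod_cast (by omega : 0 < m)
  have hst : 0 < step A m := by rw [step]; positivity
  -- The grid is fixed here, so its own step plays the role of h₀.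
  set C := (2 * A / step A m + 1) ^ n * n * ((b - a) ^ 2 * (1 + 1 / step A m ^ 2)) + n
  have hle : ∀ k, normH1 A a b (v k - u) ^ 2 ≤ C * derivSq a b (v k - u) := fun k =>
    MemH10.normH1_sq_le hab hst hm le_rfl (memH10_sub hab (hv k).1 hmem.1 (hv k).2 hmem.2)
  have hder : Tendsto (fun k => derivSq a b (v k - u)) atTop (𝓝 0) := by
    have h1 : Tendsto (fun k => ∑ j ∈ (interiorNodes n m).attach, ∑ s : Fin N,
        ∫ y in Ioo a b, (diffY (v k) j.1 y s -
          deriv (g j.1 (mem_interiorNodes.1 j.2) s) y) ^ 2) atTop (𝓝 0) := by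
      have := tendsto_finsetSum (interiorNodes n m).attach fun j _ =>
        tendsto_finsetSum (Finset.univ : Finset (Fin N)) fun s _ =>
          hglim j.1 (mem_interiorNodes.1 j.2) s
      simpa using this
    refine h1.congr fun k => ?_
    rw [derivSq, ← Finset.sum_attach (interiorNodes n m)
      fun j => ∫ y in Ioo a b, nsq (diffY (v k - u) j y)]
    refine Finset.sum_congr rfl fun j _ => ?_
    have hj := mem_interiorNodes.1 j.2
    simp only [nsq]
    rw [integral_finsetSum _ fun s _ =>
      (((hv k).1.sub hab hmem.1).memLp_diffY hj s).integrable_sq]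
    refine Finset.sum_congr rfl fun s _ => integral_congr_ae ?_
    filter_upwards [diffY_sub_ae hab (hv k).1 hmem.1 hj] with y hy
    rw [hy, Pi.sub_apply]
    simp only [diffY, hui j.1 hj s]
  have hsq : Tendsto (fun k => normH1 A a b (v k - u) ^ 2) atTop (𝓝 0) :=
    squeeze_zero (fun k => sq_nonneg _) hle (by simpa using hder.const_mul C)
  have := hsq.sqrt
  simpa [Real.sqrt_sq (normH1_nonneg _)] using this

end Complete

/-! ### Minimizers of strongly convex functionals -/

section Minimizer

open Filter Topology

variable {n m N : ℕ} {A a b R c : ℝ} {J : VecFun n m N → ℝ} {P : VecFun n m N}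

/-- `J` is strongly convex on the closed ball, with modulus `c`. -/
def StronglyConvex (A a b R c : ℝ) (J : VecFun n m N → ℝ) (P : VecFun n m N) : Prop :=
  ∀ W₁ ∈ closedBallB A a b R P, ∃ L : VecFun n m N → ℝ, IsFrechetDeriv A a b J W₁ L ∧
    ∀ W₂ ∈ closedBallB A a b R P, c * normH1 A a b (W₂ - W₁) ^ 2 ≤ J W₂ - J W₁ - L (W₂ - W₁)

lemma midpoint_mem (hab : a < b) {V W : VecFun n m N} (hV : V ∈ closedBallB A a b R P)
    (hW : W ∈ closedBallB A a b R P) : (1 / 2 : ℝ) • (V + W) ∈ closedBallB A a b R P := by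
  refine ⟨(hV.1.add hab hW.1).smul _, ?_, ?_⟩
  · have h := (hV.2.1.add hW.2.1).smul (1 / 2)
    rwa [← two_smul ℝ P, smul_smul, show (1 / 2 : ℝ) * 2 = 1 by norm_num, one_smul] at h
  · rw [normH1_smul hab, abs_of_pos (by norm_num)]
    linarith [normH1_add_le hab hV.1 hW.1, hV.2.2, hW.2.2]

/-- The convexity inequality at the midpoint is applied to both ends; the increments are opposite,
so the linear terms cancel. -/
lemma StronglyConvex.midpoint (hJ : StronglyConvex A a b R c J P) (hab : a < b)
    {V W : VecFun n m N} (hV : V ∈ closedBallB A a b R P) (hW : W ∈ closedBallB A a b R P) :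
    c / 2 * normH1 A a b (V - W) ^ 2 ≤ J V + J W - 2 * J ((1 / 2 : ℝ) • (V + W)) := by
  obtain ⟨L, hL, hLc⟩ := hJ _ (midpoint_mem hab hV hW)
  have h1 := hLc V hV
  have h2 := hLc W hW
  have e1 : V - (1 / 2 : ℝ) • (V + W) = (1 / 2 : ℝ) • (V - W) := by
    ext j y s; simp only [Pi.sub_apply, Pi.smul_apply, Pi.add_apply, smul_eq_mul]; ring
  have e2 : W - (1 / 2 : ℝ) • (V + W) = (-1 / 2 : ℝ) • (V - W) := by
    ext j y s; simp only [Pi.sub_apply, Pi.smul_apply, Pi.add_apply, smul_eq_mul]; ring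
  have hVW := memH10_sub hab hV.1 hW.1 hV.2.1 hW.2.1
  rw [e1, normH1_smul hab, hL.smul _ _ hVW, mul_pow, sq_abs] at h1
  rw [e2, normH1_smul hab, hL.smul _ _ hVW, mul_pow, sq_abs] at h2
  linarith

/-- Comparing the minimizer with the midpoint replaces the variational inequality J'(W)(V - W) ≥ 0
for a constrained minimizer. -/
lemma StronglyConvex.le_of_isMinimizer (hJ : StronglyConvex A a b R c J P) (hab : a < b)
    {V W : VecFun n m N} (hV : V ∈ closedBallB A a b R P)
    (hW : IsMinimizer J (closedBallB A a b R P) W) :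
    c / 2 * normH1 A a b (V - W) ^ 2 ≤ J V - J W := by
  have h1 := hJ.midpoint hab hV hW.1
  have h2 := hW.2 _ (midpoint_mem hab hV hW.1)
  linarith

/-- Strong convexity replaces weak compactness in the direct method: the midpoint inequality makes a
minimizing sequence Cauchy in norm. -/
lemma StronglyConvex.exists_isMinimizer (hJ : StronglyConvex A a b R c J P) (hc : 0 < c)
    (hJ0 : ∀ W, 0 ≤ J W) (hA : 0 < A) (hab : a < b) (hn : 1 ≤ n) (hm : 1 < m)
    (hne : (closedBallB A a b R P).Nonempty) :
    ∃ W, IsMinimizer J (closedBallB A a b R P) W := by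
  set B := closedBallB A a b R P with hB
  set I := sInf (J '' B) with hI
  have hbdd : BddBelow (J '' B) := ⟨0, by rintro _ ⟨W, -, rfl⟩; exact hJ0 W⟩
  have hIle : ∀ W ∈ B, I ≤ J W := fun W hW => csInf_le hbdd (mem_image_of_mem J hW)
  have hseq : ∀ k : ℕ, ∃ W ∈ B, J W < I + 1 / ((k : ℝ) + 1) := by
    intro k
    obtain ⟨_, ⟨W, hW, rfl⟩, hlt⟩ := exists_lt_of_csInf_lt (hne.image J)
      (show sInf (J '' B) < I + 1 / ((k : ℝ) + 1) from lt_add_of_pos_right _ (by positivity))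
    exact ⟨W, hW, hlt⟩
  choose W hWB hWI using hseq
  have hlim0 : Tendsto (fun k : ℕ => 1 / ((k : ℝ) + 1)) atTop (𝓝 0) :=
    tendsto_one_div_add_atTop_nhds_zero_nat
  -- W 0 is subtracted because completeness is available in the zero-boundary subspace.
  have hC : ∀ ε > 0, ∃ K, ∀ k ≥ K, ∀ l ≥ K,
      normH1 A a b ((W k - W 0) - (W l - W 0)) < ε := by
    intro ε hε
    -- If both values are within cε²/4 of the infimum and the midpoint is not below it, then
    -- (c/2)‖W_k - W_l‖² < cε²/2.
    obtain ⟨K, hK⟩ := ((tendsto_order.1 hlim0).2 (c * ε ^ 2 / 4) (by positivity)).exists_forall_of_atTop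
    refine ⟨K, fun k hk l hl => ?_⟩
    rw [sub_sub_sub_cancel_right]
    have h1 := hJ.midpoint hab (hWB k) (hWB l)
    have h2 := hIle _ (midpoint_mem hab (hWB k) (hWB l))
    have h3 := hK k hk
    have h4 := hK l hl
    have h5 := hWI k
    have h6 := hWI l
    refine lt_of_pow_lt_pow_left₀ 2 hε.le ?_
    have h7 : c / 2 * normH1 A a b (W k - W l) ^ 2 < c / 2 * ε ^ 2 := by linarith
    exact lt_of_mul_lt_mul_left h7 (by positivity)
  have hv : ∀ k, MemH10 A a b (W k - W 0) := fun k =>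
    memH10_sub hab (hWB k).1 (hWB 0).1 (hWB k).2.1 (hWB 0).2.1
  obtain ⟨u, hu, hulim⟩ := exists_limit_memH10 hA hab hn hm hv hC
  set V := W 0 + u with hVdef
  have hdiff : ∀ k, W k - W 0 - u = W k - V := fun k => by rw [hVdef, sub_sub]
  simp only [hdiff] at hulim
  have hVmem : MemH1 A a b V := (hWB 0).1.add hab hu.1
  have hVP : EqOnBoundary a b V P := by simpa using (hWB 0).2.1.add hu.2
  have hWV : ∀ k, MemH10 A a b (W k - V) := fun k =>
    memH10_sub hab (hWB k).1 hVmem (hWB k).2.1 hVP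
  have hVB : V ∈ B := by
    refine ⟨hVmem, hVP, ?_⟩
    have h1 : ∀ k, normH1 A a b V ≤ R + normH1 A a b (W k - V) := by
      intro k
      have h2 := normH1_add_le hab (hWB k).1 (hVmem.sub hab (hWB k).1)
      rw [add_sub_cancel, normH1_sub_comm hab V (W k)] at h2
      linarith [(hWB k).2.2]
    have h2 := ge_of_tendsto' (hulim.const_add R) h1
    simpa using h2
  -- Lower semicontinuity along the sequence: differentiability at V gives J(W_k) ≥ J(V) - (C +
  -- 1)‖W_k - V‖ near V.
  obtain ⟨L, hL, -⟩ := hJ V hVB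
  obtain ⟨C, hC⟩ := hL.bounded
  obtain ⟨η, hη, hlit⟩ := hL.littleO 1 one_pos
  have hJV : ∀ᶠ k : ℕ in atTop, J V ≤ I + 1 / ((k : ℝ) + 1) + (C + 1) * normH1 A a b (W k - V) := by
    filter_upwards [(tendsto_order.1 hulim).2 η hη] with k hk
    have h1 := hlit _ (hWV k) hk.le
    rw [add_sub_cancel] at h1
    have h2 := hC _ (hWV k)
    have h3 := (abs_le.1 h1).1
    have h4 := (abs_le.1 h2).1
    linarith [hWI k]
  have hlim : Tendsto (fun k : ℕ => I + 1 / ((k : ℝ) + 1) + (C + 1) * normH1 A a b (W k - V)) atTop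
      (𝓝 (I + 0 + (C + 1) * 0)) := (hlim0.const_add I).add (hulim.const_mul (C + 1))
  have hJVI := ge_of_tendsto hlim hJV
  simp only [mul_zero, add_zero] at hJVI
  exact ⟨V, hVB, fun X hX => hJVI.trans (hIle X hX)⟩

/-- At interior nodes the difference vanishes at a and has zero derivative norm. The norm does not
see the boundary nodes; there equality comes from the common boundary data. -/
lemma eqOn_of_normH1_sub_eq_zero (hab : a < b) (hn : 1 ≤ n) {V W : VecFun n m N}
    (h : MemH10 A a b (V - W)) (h0 : normH1 A a b (V - W) = 0) (j : Node n m) :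
    EqOn (V j) (W j) (Icc a b) := by
  intro y hy
  by_cases hj : IsInterior j
  · have h1 := h.1.integral_diffY_le hab hn hj
    have h2 := h.nsq_le_deriv hab hj hy
    rw [h0] at h1
    have h3 : nsq ((V - W) j y) ≤ 0 := by
      have hba := sub_pos.2 hab
      nlinarith
    ext s
    have h4 := (sq_le_nsq _ s).trans h3
    have h5 : (V - W) j y s = 0 :=
      pow_eq_zero_iff two_ne_zero |>.1 (le_antisymm h4 (sq_nonneg _))
    simpa [sub_eq_zero] using h5
  · have := h.2 j y hy (Or.inl hj)
    simpa [sub_eq_zero] using this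

end Minimizer

end RTE

/-! ### The main theorem -/

open RTE in
lemma RTE.exists_isConvexityThreshold {N n : ℕ} {A d a b h₀ c₀ : ℝ} (hA : 0 < A) (hd : 0 < d)
    (ha : 1 ≤ a) (hab : a < b) (hn : 1 ≤ n) (hc₀ : 0 < c₀)
    (hD : ∀ x ∈ closedPrism n A a b, ∀ v : Fin N → ℝ, c₀ * nsq v ≤ nsq ((matD d N x).mulVec v))
    (hh₀ : 0 < h₀) (κ M : ℝ) {R : ℝ} (hR : 0 < R) :
    ∃ Λ, IsConvexityThreshold n N A d a b h₀ κ M R Λ := by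
  obtain ⟨Λ, hΛ, c, hc, hconv⟩ := exists_strong_convexity hA hd ha hab hn N hc₀ hD hh₀ κ M hR.le
  refine ⟨Λ, hΛ, c, hc, fun m hm hh K μs hK hμ lam hlam P W₁ hW₁ => ?_⟩
  have h : Admissible A a b d κ M m K μs := ⟨hA, hd, ha, hab, hn, hm, hK, hμ⟩
  refine ⟨costL A a b d K μs lam W₁, h.isFrechetDeriv hW₁.1 (by linarith), fun W₂ hW₂ => ?_⟩
  have hv := memH10_sub hab hW₂.1 hW₁.1 hW₂.2.1 hW₁.2.1
  have hnorm : normH1 A a b (W₂ - W₁) ≤ 2 * R := by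
    have h1 := normH1_add_le hab hW₂.1 (hW₁.1.smul (-1))
    rw [neg_one_smul, normH1_neg hab, ← sub_eq_add_neg] at h1
    linarith [hW₁.2.2, hW₂.2.2]
  have := hconv m hh K μs h lam hlam W₁ (W₂ - W₁) hW₁.1 hv hW₁.2.2 hnorm
  rwa [add_sub_cancel] at this

theorem theorem4p4 (N : ℕ) (hN : 1 ≤ N) (A d : ℝ) (hA : 0 < A) (hd : 0 < d) :
    ∃ a₀ > 1, ∀ n : ℕ, 1 ≤ n → ∀ a b : ℝ, a₀ ≤ a → a < b →
      (∀ x ∈ RTE.closedPrism n A a b, IsUnit (RTE.matD d N x)) ∧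
      ∀ h₀ > 0, ∀ κ M : ℝ, ∃ lam₁ : ℝ → ℝ,
        (∀ R > 0, RTE.IsConvexityThreshold n N A d a b h₀ κ M R (lam₁ R)) ∧
        ∀ R > 0, ∃ C₃ > 0,
          ∀ m : ℕ, 1 < m → h₀ ≤ RTE.step A m →
          ∀ (K : RTE.Pt n → ℝ → ℝ → ℝ) (μs : RTE.Pt n → ℝ),
            RTE.IsPhaseFunction A a b d κ K → RTE.IsScatteringCoeff A a b M μs →
          ∀ (P Pstar S Sstar Wstar : RTE.VecFun n m N) (α δ : ℝ),
            0 < α → α < R → 0 < δ →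
            RTE.IsSolution A a b d K μs Wstar →
            Wstar ∈ RTE.ballB A a b (R - α) Pstar →
            S ∈ RTE.ballB A a b R P →
            Sstar ∈ RTE.ballB A a b R Pstar →
            RTE.normH1 A a b (S - Sstar) < δ →
            C₃ * δ < α →
            (∃ W, RTE.IsMinimizer (RTE.costJ A a b d K μs (lam₁ (2 * R)))
              (RTE.closedBallB A a b R P) W) ∧
            (∀ V W, RTE.IsMinimizer (RTE.costJ A a b d K μs (lam₁ (2 * R)))
                (RTE.closedBallB A a b R P) V →
              RTE.IsMinimizer (RTE.costJ A a b d K μs (lam₁ (2 * R)))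
                (RTE.closedBallB A a b R P) W →
              ∀ j, Set.EqOn (V j) (W j) (Set.Icc a b)) ∧
            ∀ W, RTE.IsMinimizer (RTE.costJ A a b d K μs (lam₁ (2 * R)))
                (RTE.closedBallB A a b R P) W →
              W ∈ RTE.ballB A a b R P ∧ RTE.normH1 A a b (W - Wstar) ≤ C₃ * δ := by
  obtain ⟨a₀, ha₀, c₀, hc₀, hD⟩ := RTE.exists_matD_lower hA hd N
  refine ⟨a₀, ha₀, fun n hn a b ha hab => ⟨fun x hx =>
    RTE.isUnit_of_nsq_lower hc₀ (hD n a b ha x hx), fun h₀ hh₀ κ M => ?_⟩⟩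
  have ha1 : 1 ≤ a := by linarith
  -- The implication allows λ₁ to be chosen as a total function; its values at R ≤ 0 are irrelevant.
  have hex : ∀ R : ℝ, ∃ Λ : ℝ, 0 < R → RTE.IsConvexityThreshold n N A d a b h₀ κ M R Λ := by
    intro R
    by_cases hR : 0 < R
    · obtain ⟨Λ, hΛ⟩ := RTE.exists_isConvexityThreshold hA hd ha1 hab hn hc₀ (hD n a b ha) hh₀ κ M hR
      exact ⟨Λ, fun _ => hΛ⟩
    · exact ⟨0, fun h => absurd h hR⟩
  choose lam₁ hlam₁ using hex
  refine ⟨lam₁, hlam₁, fun R hR => ?_⟩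
  obtain ⟨hΛ1, c, hc, hconv⟩ := hlam₁ (2 * R) (by linarith)
  set lam := lam₁ (2 * R)
  obtain ⟨C, hC0, hC⟩ := RTE.exists_cost_le hA hd ha1 hab N hh₀ κ M hR.le
    (show (0 : ℝ) ≤ lam by linarith)
  set c' := c * Real.exp (2 * lam * a) with hc'
  have hc'0 : 0 < c' := mul_pos hc (Real.exp_pos _)
  set σ := Real.sqrt (2 * C / c') with hσ
  have hσ0 : 0 ≤ σ := Real.sqrt_nonneg _
  -- σδ will bound the distance of the minimizer to W* + (S - S*), and the extra δ bounds ‖S - S*‖.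
  refine ⟨σ + 1, by positivity, fun m hm hh K μs hK hμ P Pstar S Sstar Wstar α δ hα hαR hδ hsol
    hWstar hS hSstar hSS hCδ => ?_⟩
  have h : RTE.Admissible A a b d κ M m K μs := ⟨hA, hd, ha1, hab, hn, hm, hK, hμ⟩
  have hsub : RTE.closedBallB A a b R P ⊆ RTE.closedBallB A a b (2 * R) P := fun W hW =>
    ⟨hW.1, hW.2.1, hW.2.2.trans (by linarith)⟩
  have hJ : RTE.StronglyConvex A a b R c' (RTE.costJ A a b d K μs lam) P := by
    intro W₁ hW₁
    obtain ⟨L, hL, hLc⟩ := hconv m hm hh K μs hK hμ lam le_rfl P W₁ (hsub hW₁)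
    exact ⟨L, hL, fun W₂ hW₂ => hLc W₂ (hsub hW₂)⟩
  refine ⟨hJ.exists_isMinimizer hc'0 (fun W => RTE.costJ_nonneg hab W) hA hab hn hm
    ⟨S, hS.1, hS.2.1, hS.2.2.le⟩, fun V W hV hW => ?_, fun W hW => ?_⟩
  · refine RTE.eqOn_of_normH1_sub_eq_zero (A := A) hab hn
      (RTE.memH10_sub hab hV.1.1 hW.1.1 hV.1.2.1 hW.1.2.1) ?_
    have h1 := hJ.le_of_isMinimizer hab hV.1 hW
    have h2 := hV.2 W hW.1
    have h3 : c' / 2 * RTE.normH1 A a b (V - W) ^ 2 ≤ c' / 2 * 0 := by linarith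
    have h4 := le_of_mul_le_mul_left h3 (by positivity)
    exact pow_eq_zero_iff two_ne_zero |>.1 (le_antisymm h4 (sq_nonneg _))
  -- Because C₃ = σ + 1 ≥ 1.
  · have hδα : δ < α := by nlinarith
    have hv := hS.1.sub hab hSstar.1
    -- Adding S - S* corrects the boundary data of W* from P* to P, and the margin α > δ keeps the
    -- sum in the ball, where it competes with the minimizer.
    have hWt : Wstar + (S - Sstar) ∈ RTE.closedBallB A a b R P := by
      refine ⟨hWstar.1.add hab hv, ?_, ?_⟩
      · simpa using hWstar.2.1.add (hS.2.1.sub hSstar.2.1)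
      · linarith [RTE.normH1_add_le hab hWstar.1 hv, hWstar.2.2]
    have hcost := hC m hh K μs h Wstar (S - Sstar) hWstar.1 hv (by linarith [hWstar.2.2])
      (by linarith) hsol
    have h1 := hJ.le_of_isMinimizer hab hWt hW
    have h2 := RTE.costJ_nonneg (A := A) (d := d) (K := K) (μs := μs) (lam := lam) hab W
    have h0 := RTE.normH1_nonneg (A := A) (a := a) (b := b) (S - Sstar)
    have h3 : RTE.normH1 A a b (Wstar + (S - Sstar) - W) ≤ σ * δ := by
      refine le_of_sq_le_sq ?_ (by positivity)
      rw [mul_pow, hσ, Real.sq_sqrt (by positivity), div_mul_eq_mul_div, le_div_iff₀ hc'0]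
      have h4 : C * RTE.normH1 A a b (S - Sstar) ^ 2 ≤ C * δ ^ 2 := by gcongr
      linarith
    have h5 : RTE.normH1 A a b (W - Wstar) ≤ (σ + 1) * δ := by
      have h6 := RTE.normH1_add_le hab (hW.1.1.sub hab hWt.1) hv
      rw [RTE.normH1_sub_comm hab W, show W - (Wstar + (S - Sstar)) + (S - Sstar) = W - Wstar by abel]
        at h6
      linarith
    -- Interior position: ‖W‖ ≤ ‖W*‖ + C₃δ < (R - α) + α.
    refine ⟨⟨hW.1.1, hW.1.2.1, ?_⟩, h5⟩
    have h7 := RTE.normH1_add_le hab hWstar.1 (hW.1.1.sub hab hWstar.1)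
    rw [add_sub_cancel] at h7
    linarith [hWstar.2.2]
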